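/- A hypergraph $G$ consists of finite sets $V(G)$ (vertices) and $E(G)$ (edges) and a map $i_G:E(G)\to 2^{V(G)}$ with $|i_G(e)|\ge 2$ for all $e$ (so multiple edges are allowed). The degree $d_G(v)$ is the number of edges $e$ with $v\in i_G(e)$; a set $S\subseteq V(G)$ is independent if no edge satisfies $i_G(e)\subseteq S$, and $G[S]$ denotes the induced subhypergraph. A matching is a set of edges such that every vertex lies in at most one of them. $G$ is connected if any two vertices are joined by a path. For a simple graph $K$, $tK$ is the graph obtained by replacing each edge by $t$ parallel edges; $A(G)$ is the set of two-sets $\{u,v\}$ with $i_G(e)=\{u,v\}$ for some $e\in E(G)$; $K_{(n,t)}$ is the simple complete $n$-partite graph with all partite sets of size $t$, and $K_{t,t}=K_{(2,t)}$. A cover of $G$ is a pair $(X,H)$, where $H$ is a hypergraph and $X$ assigns to each $v\in V(G)$ a set $X_v\subseteq V(H)$, such that the sets $X_v$ are pairwise disjoint and independent in $H$, $V(H)=\bigcup_v X_v$, and for each $e\in E(G)$ there is a (possibly empty) matching $M_e$ in $H[\bigcup_{v\in i_G(e)}X_v]$ with $|i_H(\tilde e)\cap X_v|=1$ for all $v\in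 i_G(e)$ and $\tilde e\in M_e$, where $E(H)=\bigcup_{e\in E(G)}M_e$. The triple $(G,X,H)$ is a feasible configuration if $G$ is connected and $(X,H)$ is a cover of $G$; it is degree-feasible if moreover $|X_v|\ge d_G(v)$ for all $v$. It is colorable if there is an independent set $T$ of $H$ with $|T\cap X_v|=1$ for all $v\in V(G)$, and minimal uncolorable if it is not colorable but $(G,X,H-e)$ is colorable for every $e\in E(H)$. Let $(X,H)$ be a cover of $G$. The triple $(G,X,H)$ is * a K-configuration if $G=tK_n$ for some $t,n\ge 1$ and the sets $X_v$ have partitions $(X_v^1,\dots,X_v^{n-1})$ such that each $H^i=H[\bigcup_v X_v^i]$ is a $K_{(n,t)}$ with partite sets $X_v^i$ ($v\in V(G)$), and $H=\bigcup_i H^i$ (for $n=1$ this means that $X_v=\varnothing$ and $H=\varnothing$); * an odd C-configuration if $G=tC_n$ for some $t\ge 1$ and odd $n\ge 5$ and the sets $X_v$ have partitions $(X_v^1,X_v^2)$ such that for all $i\in\{1,2\}$ and $\{u,v\}\in A(G)$ the graph $H[X_u^i\cup X_v^i]$ is a $K_{t,t}$ with partite sets $X_u^i,X_v^i$, and $H$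 is the union of these graphs; * an even C-configuration if $G=tC_n$ for some $t\ge 1$ and even $n\ge 4$ and there are partitions $(X_v^1,X_v^2)$ of the sets $X_v$ and a pair $\{w,w'\}\in A(G)$ such that $H[X_u^i\cup X_v^i]$ is a $K_{t,t}$ with partite sets $X_u^i,X_v^i$ for all $i\in\{1,2\}$ and all $\{u,v\}\in A(G)\setminus\{\{w,w'\}\}$, while $H[X_w^1\cup X_{w'}^2]$ and $H[X_w^2\cup X_{w'}^1]$ are $K_{t,t}$'s with partite sets $X_w^1,X_{w'}^2$ and $X_w^2,X_{w'}^1$, respectively, and $H$ is the union of all these graphs; * a C-configuration if it is an odd or an even C-configuration; * an E-configuration if $G$ has exactly one edge $e$ and $i_G(e)=V(G)$, $|X_v|=1$ for all $v\in V(G)$, and $H\cong G$. Given feasible configurations $(G^1,X^1,H^1)$ and $(G^2,X^2,H^2)$ with $G^1,G^2$ disjoint and $H^1,H^2$ disjoint, and $v^j\in V(G^j)$ for $j\in\{1,2\}$, merging $v^1$ and $v^2$ gives the configuration $(G,X,H)$ in which $G$ arises from the disjoint union of $G^1$ and $G^2$ by identifying $v^1$ and $v^2$ to a new vertex $v^*$,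 $H=H^1\cup H^2$, $X_{v^*}=X^1_{v^1}\cup X^2_{v^2}$, and $X_v=X^j_v$ for $v\in V(G^j)\setminus\{v^j\}$. The class of constructible configurations is the smallest class of feasible configurations (with configurations that differ only in the names of vertices and edges identified) that contains all K-, C- and E-configurations and is closed under merging. **Theorem.** Let $(G,X,H)$ be a degree-feasible configuration. Then $(G,X,H)$ is minimal uncolorable if and only if it is constructible. -/

import Mathlib

universe u v w z

namespace DPColoring

/-- A finite hypergraph with vertex set `V`, edge set `E` and incidence function `inc`; multiple
edges are allowed, and every edge is incident to at least two vertices. -/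
structure MultiHypergraph (V : Type u) (E : Type v) where
  inc : E → Set V
  finite_vertices : Finite V
  finite_edges : Finite E
  two_le_ncard_inc : ∀ e, 2 ≤ (inc e).ncard

namespace MultiHypergraph

variable {V : Type u} {E : Type v} {C : Type w} {F : Type z}

/-- The degree of a vertex: the number of edges incident to it. -/
noncomputable def degree (G : MultiHypergraph V E) (a : V) : ℕ := {e | a ∈ G.inc e}.ncard

/-- Two distinct vertices are adjacent if some edge is incident to both. -/
def Adj (G : MultiHypergraph V E) (a b : V) : Prop := a ≠ b ∧ ∃ e, a ∈ G.inc e ∧ b ∈ G.inc e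

/-- Any two vertices are joined by a path. -/
def Connected (G : MultiHypergraph V E) : Prop := ∀ a b, Relation.ReflTransGen G.Adj a b

/-- `{a, b}` is a two-set which is the vertex set of an (ordinary) edge. -/
def OrdAdj (G : MultiHypergraph V E) (a b : V) : Prop := ∃ e, G.inc e = {a, b}

/-- A vertex set is independent if no edge is contained in it. -/
def Independent (G : MultiHypergraph V E) (S : Set V) : Prop := ∀ e, ¬ G.inc e ⊆ S

/-- A set of edges is a matching if each vertex is in at most one of its edges. -/
def IsMatching (G : MultiHypergraph V E) (M : Set E) : Prop :=
  ∀ e ∈ M, ∀ e' ∈ M, ∀ a, a ∈ G.inc e → a ∈ G.inc e' → e = e'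

/-- The hypergraph obtained by deleting the edge `e`. -/
def deleteEdge (G : MultiHypergraph V E) (e : E) : MultiHypergraph V {e' : E // e' ≠ e} where
  inc e' := G.inc e'.1
  finite_vertices := G.finite_vertices
  finite_edges := by
    have := G.finite_edges
    infer_instance
  two_le_ncard_inc e' := G.two_le_ncard_inc e'.1

/-- Two hypergraphs are isomorphic. -/
def Isomorphic (G : MultiHypergraph V E) (H : MultiHypergraph C F) : Prop :=
  ∃ (φ : V ≃ C) (ψ : E ≃ F), ∀ e, H.inc (ψ e) = φ '' G.inc e

/-- `G` is (a copy of) `tK`, obtained from the simple graph `K` by replacing each edge by `t`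
parallel edges. -/
def IsMultiple {W : Type*} (G : MultiHypergraph V E) (t : ℕ) (K : SimpleGraph W) : Prop :=
  ∃ φ : W ≃ V,
    (∀ e, ∃ a b, K.Adj a b ∧ G.inc e = {φ a, φ b}) ∧
    ∀ a b, K.Adj a b → {e | G.inc e = {φ a, φ b}}.ncard = t

/-- The hypergraph consists of a single edge containing all vertices. -/
def IsSingleEdge (G : MultiHypergraph V E) : Prop :=
  ∃ e, G.inc e = Set.univ ∧ ∀ e', e' = e

/-- The subhypergraph of `H` induced by the union of the sets `P i` is a (simple) complete
multipartite graph whose partite sets are the sets `P i`, each of which has `t` elements. -/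
def InducesCompleteMultipartite {ι : Type*} (H : MultiHypergraph C F) (P : ι → Set C) (t : ℕ) :
    Prop :=
  (∀ i, (P i).ncard = t) ∧
  (∀ i j, i ≠ j → Disjoint (P i) (P j)) ∧
  (∀ f, H.inc f ⊆ ⋃ i, P i → ∃ i j, i ≠ j ∧ ∃ x ∈ P i, ∃ y ∈ P j, H.inc f = {x, y}) ∧
  ∀ i j, i ≠ j → ∀ x ∈ P i, ∀ y ∈ P j, ∃! f, H.inc f = {x, y}

/-- `H[A ∪ B]` is a complete bipartite graph `K_{t,t}` with partite sets `A` and `B`. -/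
def InducesKtt (H : MultiHypergraph C F) (A B : Set C) (t : ℕ) : Prop :=
  H.InducesCompleteMultipartite ![A, B] t

end MultiHypergraph

open MultiHypergraph

section

variable {V : Type u} {E : Type v} {C : Type w} {F : Type z}

/-- `(X, H)` is a cover of `G`. -/
structure IsCover (G : MultiHypergraph V E) (X : V → Set C) (H : MultiHypergraph C F) : Prop where
  disjoint : ∀ a b, a ≠ b → Disjoint (X a) (X b)
  iUnion_eq : ⋃ a, X a = Set.univ
  independent : ∀ a, H.Independent (X a)
  exists_matchings : ∃ M : E → Set F,
    (∀ e, H.IsMatching (M e)) ∧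
    (∀ e, ∀ f ∈ M e, H.inc f ⊆ ⋃ a ∈ G.inc e, X a) ∧
    (∀ e, ∀ f ∈ M e, ∀ a ∈ G.inc e, (H.inc f ∩ X a).ncard = 1) ∧
    ⋃ e, M e = Set.univ

/-- `(G, X, H)` is a feasible configuration. -/
structure Feasible (G : MultiHypergraph V E) (X : V → Set C) (H : MultiHypergraph C F) :
    Prop where
  connected : G.Connected
  cover : IsCover G X H

/-- `(G, X, H)` is a degree-feasible configuration. -/
structure DegreeFeasible (G : MultiHypergraph V E) (X : V → Set C) (H : MultiHypergraph C F) :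
    Prop extends Feasible G X H where
  degree_le : ∀ a, G.degree a ≤ (X a).ncard

/-- `T` meets each of the sets `X a` in exactly one colour. -/
def IsTransversal (X : V → Set C) (T : Set C) : Prop := ∀ a, (T ∩ X a).ncard = 1

/-- `(X, H)` has an independent transversal. -/
def Colorable (X : V → Set C) (H : MultiHypergraph C F) : Prop :=
  ∃ T : Set C, IsTransversal X T ∧ H.Independent T

/-- The feasible configuration `(G, X, H)` is minimal uncolorable. -/
structure MinimalUncolorable (G : MultiHypergraph V E) (X : V → Set C)
    (H : MultiHypergraph C F) : Prop where
  feasible : Feasible G X H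
  not_colorable : ¬ Colorable X H
  colorable_deleteEdge : ∀ f, Colorable X (H.deleteEdge f)

/-- The sets `P i` partition `S`. (Wherever this is used, the sets `P i` are also required to have
`t ≥ 1` elements, so they are nonempty.) -/
def IsPartition {ι : Type*} (P : ι → Set C) (S : Set C) : Prop :=
  (∀ i j, i ≠ j → Disjoint (P i) (P j)) ∧ ⋃ i, P i = S

/-- K-configurations. The last clause says that `H` is the union of the induced subgraphs
`H[⋃ a, P a i]`. -/
def IsKConfiguration (G : MultiHypergraph V E) (X : V → Set C) (H : MultiHypergraph C F) : Prop :=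
  IsCover G X H ∧ ∃ t n : ℕ, 1 ≤ t ∧ 1 ≤ n ∧ G.IsMultiple t (⊤ : SimpleGraph (Fin n)) ∧
    ∃ P : V → Fin (n - 1) → Set C,
      (∀ a, IsPartition (P a) (X a)) ∧
      (∀ i, H.InducesCompleteMultipartite (fun a => P a i) t) ∧
      ∀ f, ∃ i, H.inc f ⊆ ⋃ a, P a i

/-- Odd C-configurations. The last clause says that `H` is the union of the induced subgraphs
`H[P a i ∪ P b i]`. -/
def IsOddCConfiguration (G : MultiHypergraph V E) (X : V → Set C) (H : MultiHypergraph C F) :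
    Prop :=
  IsCover G X H ∧
  ∃ t n : ℕ, 1 ≤ t ∧ 5 ≤ n ∧ Odd n ∧ G.IsMultiple t (SimpleGraph.cycleGraph n) ∧
    ∃ P : V → Fin 2 → Set C,
      (∀ a, IsPartition (P a) (X a)) ∧
      (∀ i a b, G.OrdAdj a b → H.InducesKtt (P a i) (P b i) t) ∧
      ∀ f, ∃ i a b, G.OrdAdj a b ∧ H.inc f ⊆ P a i ∪ P b i

/-- Even C-configurations, where the two classes are interchanged along precisely one pair
`{c, c'}` of adjacent vertices. The last clause says that `H` is the union of all the complete
bipartite graphs in the preceding clauses. -/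
def IsEvenCConfiguration (G : MultiHypergraph V E) (X : V → Set C) (H : MultiHypergraph C F) :
    Prop :=
  IsCover G X H ∧
  ∃ t n : ℕ, 1 ≤ t ∧ 4 ≤ n ∧ Even n ∧ G.IsMultiple t (SimpleGraph.cycleGraph n) ∧
    ∃ (P : V → Fin 2 → Set C) (c c' : V),
      (∀ a, IsPartition (P a) (X a)) ∧
      G.OrdAdj c c' ∧
      (∀ i a b, G.OrdAdj a b → ({a, b} : Set V) ≠ {c, c'} → H.InducesKtt (P a i) (P b i) t) ∧
      H.InducesKtt (P c 0) (P c' 1) t ∧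
      H.InducesKtt (P c 1) (P c' 0) t ∧
      ∀ f,
        (∃ i a b, G.OrdAdj a b ∧ ({a, b} : Set V) ≠ {c, c'} ∧ H.inc f ⊆ P a i ∪ P b i) ∨
        H.inc f ⊆ P c 0 ∪ P c' 1 ∨ H.inc f ⊆ P c 1 ∪ P c' 0

/-- C-configurations. -/
def IsCConfiguration (G : MultiHypergraph V E) (X : V → Set C) (H : MultiHypergraph C F) : Prop :=
  IsOddCConfiguration G X H ∨ IsEvenCConfiguration G X H

/-- E-configurations. -/
def IsEConfiguration (G : MultiHypergraph V E) (X : V → Set C) (H : MultiHypergraph C F) : Prop :=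
  IsCover G X H ∧ G.IsSingleEdge ∧ (∀ a, (X a).ncard = 1) ∧ H.Isomorphic G

end

/-- `(G, X, H)` is obtained from (disjoint copies of) `(G₁, X₁, H₁)` and `(G₂, X₂, H₂)` by merging
the vertices `v₁` and `v₂`: the maps `φ₁`, `φ₂` rename the vertices of `G₁` and `G₂` and send
`v₁`, `v₂` to the same new vertex, and nothing else is identified; the edges of `G`, the vertices of
`H` and the edges of `H` are the disjoint unions of those of the two parts. -/
structure Merging {V V₁ V₂ : Type u} {E E₁ E₂ : Type v} {C C₁ C₂ : Type w} {F F₁ F₂ : Type z}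
    (G₁ : MultiHypergraph V₁ E₁) (X₁ : V₁ → Set C₁) (H₁ : MultiHypergraph C₁ F₁) (v₁ : V₁)
    (G₂ : MultiHypergraph V₂ E₂) (X₂ : V₂ → Set C₂) (H₂ : MultiHypergraph C₂ F₂) (v₂ : V₂)
    (G : MultiHypergraph V E) (X : V → Set C) (H : MultiHypergraph C F) where
  φ₁ : V₁ → V
  φ₂ : V₂ → V
  ε : E₁ ⊕ E₂ ≃ E
  κ : C₁ ⊕ C₂ ≃ C
  η : F₁ ⊕ F₂ ≃ F
  φ₁_injective : Function.Injective φ₁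
  φ₂_injective : Function.Injective φ₂
  φ_eq_iff : ∀ a b, φ₁ a = φ₂ b ↔ a = v₁ ∧ b = v₂
  φ_surjective : ∀ c, (∃ a, φ₁ a = c) ∨ ∃ b, φ₂ b = c
  inc_left : ∀ e, G.inc (ε (Sum.inl e)) = φ₁ '' G₁.inc e
  inc_right : ∀ e, G.inc (ε (Sum.inr e)) = φ₂ '' G₂.inc e
  cover_inc_left : ∀ f, H.inc (η (Sum.inl f)) = (fun x => κ (Sum.inl x)) '' H₁.inc f
  cover_inc_right : ∀ f, H.inc (η (Sum.inr f)) = (fun x => κ (Sum.inr x)) '' H₂.inc f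
  X_merged : X (φ₁ v₁) = (fun x => κ (Sum.inl x)) '' X₁ v₁ ∪ (fun x => κ (Sum.inr x)) '' X₂ v₂
  X_left : ∀ a, a ≠ v₁ → X (φ₁ a) = (fun x => κ (Sum.inl x)) '' X₁ a
  X_right : ∀ b, b ≠ v₂ → X (φ₂ b) = (fun x => κ (Sum.inr x)) '' X₂ b

/-- The smallest class of configurations that contains all K-, C- and E-configurations and is closed
under merging. -/
inductive Constructible : ∀ {V : Type u} {E : Type v} {C : Type w} {F : Type z},
    MultiHypergraph V E → (V → Set C) → MultiHypergraph C F → Prop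
  | ofK {V : Type u} {E : Type v} {C : Type w} {F : Type z} {G : MultiHypergraph V E}
      {X : V → Set C} {H : MultiHypergraph C F} (h : IsKConfiguration G X H) : Constructible G X H
  | ofC {V : Type u} {E : Type v} {C : Type w} {F : Type z} {G : MultiHypergraph V E}
      {X : V → Set C} {H : MultiHypergraph C F} (h : IsCConfiguration G X H) : Constructible G X H
  | ofE {V : Type u} {E : Type v} {C : Type w} {F : Type z} {G : MultiHypergraph V E}
      {X : V → Set C} {H : MultiHypergraph C F} (h : IsEConfiguration G X H) : Constructible G X H
  | merge {V V₁ V₂ : Type u} {E E₁ E₂ : Type v} {C C₁ C₂ : Type w} {F F₁ F₂ : Type z}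
      {G₁ : MultiHypergraph V₁ E₁} {X₁ : V₁ → Set C₁} {H₁ : MultiHypergraph C₁ F₁}
      {G₂ : MultiHypergraph V₂ E₂} {X₂ : V₂ → Set C₂} {H₂ : MultiHypergraph C₂ F₂}
      {G : MultiHypergraph V E} {X : V → Set C} {H : MultiHypergraph C F}
      (v₁ : V₁) (v₂ : V₂) (h₁ : Constructible G₁ X₁ H₁) (h₂ : Constructible G₂ X₂ H₂)
      (m : Merging G₁ X₁ H₁ v₁ G₂ X₂ H₂ v₂ G X H) : Constructible G X H

end DPColoring

/-! Everything rests on counting forbidden colours. Colour all vertices of `G` except one vertex `r`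
properly. An edge at `r` whose other vertices are coloured forbids at most one colour of `r`,
because these colours lie in at most one common edge of its matching. As `r` has at least as many
colours as edges, a colouring that does not extend to `r` makes every edge at `r` forbid exactly one
colour, with different edges forbidding different colours (`Cov.hole`). Such colourings are
plentiful: colouring the vertices in order of decreasing distance from `r` never gets stuck, even if
colours are prescribed on a set whose removal leaves every other vertex connected to `r`
(`Cov.exists_extension`).

Suppose that `G` has no cut vertex. Then one colour can be prescribed, which makes all matchings
perfect and all degrees equal. Moving the hole around shows that an edge with three or more vertices
must be the only edge. If all edges are ordinary, prescribing two colours shows that any two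
nonadjacent neighbours of a vertex separate the graph, so that it is complete or a cycle
(`SimpleGraph.eq_top_or_isCycles`). In the complete case adjacency of colours is transitive between
distinct vertices, and the classes of a K-configuration appear. On a cycle the colours of each
vertex split into two halves of twins, consecutive vertices are joined straight or crosswise, and
uncolorability decides by the parity of the length how the cycle closes up.

At a cut vertex `r`, each colour of `r` can be forbidden from exactly one side. This divides the
colours of `r` between the sides, and minimality places each edge of the cover inside one side. Both
sides are again minimal uncolorable and degree-feasible, and the configuration is their merging, so
induction on the number of vertices applies.

For the converse, the induction over mergings also carries colorability after deleting a vertex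
(`Robust`): when an edge of one part is deleted, the other part has to be coloured everywhere except
at the merged vertex. For K- and C-configurations only the classes of the chosen colours matter
(`robust_of_classes`), which leaves a pigeonhole argument and a parity argument. -/

namespace SimpleGraph

/-! ### Separating pairs, complete graphs and cycles -/

variable {V : Type u}

/-- The graph obtained by deleting all edges which meet `A`. -/
def away (S : SimpleGraph V) (A : Set V) : SimpleGraph V where
  Adj a b := S.Adj a b ∧ a ∉ A ∧ b ∉ A
  symm := ⟨fun _ _ h => ⟨h.1.symm, h.2.2, h.2.1⟩⟩
  loopless := ⟨fun _ h => h.1.ne rfl⟩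

variable {S : SimpleGraph V}

theorem away_empty : S.away ∅ = S := by ext; simp [away]

theorem away_anti {A B : Set V} (h : A ⊆ B) : S.away B ≤ S.away A :=
  fun _ _ hab => ⟨hab.1, fun hA => hab.2.1 (h hA), fun hA => hab.2.2 (h hA)⟩

theorem Reachable.head_induction {a b : V} {P : V → Prop} (h : S.Reachable a b) (refl : P b)
    (head : ∀ x y, S.Adj x y → S.Reachable y b → P y → P x) : P a := by
  rw [reachable_iff_reflTransGen] at h
  induction h using Relation.ReflTransGen.head_induction_on with
  | refl => exact refl
  | head hxy hyb ih => exact head _ _ hxy ((reachable_iff_reflTransGen _ _).2 hyb) ih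

/-- A walk avoiding `A` from `a` to a vertex of `B` has a first vertex in `B`. -/
theorem Reachable.exists_first {A B : Set V} {a b : V} (h : (S.away A).Reachable a b)
    (hb : b ∈ B) (ha : a ∉ B) :
    ∃ y x, x ∈ B ∧ (S.away A).Adj y x ∧ y ∉ B ∧ (S.away (A ∪ B)).Reachable a y := by
  revert ha
  refine h.head_induction (P := fun a => a ∉ B → ∃ y x, x ∈ B ∧ (S.away A).Adj y x ∧ y ∉ B ∧
    (S.away (A ∪ B)).Reachable a y) (fun hn => (hn hb).elim) ?_
  intro z y hzy _ ih hz
  by_cases hy : y ∈ B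
  · exact ⟨z, y, hy, hzy, hz, Reachable.refl _⟩
  · obtain ⟨y', x, hx, hadj, hy', hr⟩ := ih hy
    refine ⟨y', x, hx, hadj, hy', Reachable.trans (Adj.reachable ?_) hr⟩
    exact ⟨hzy.1, by simp [hz, hzy.2.1], by simp [hy, hzy.2.2]⟩

/-- A walk avoiding `A` either avoids `B` or has a last vertex in `B`. -/
theorem Reachable.exists_last {A B : Set V} {a b : V} (h : (S.away A).Reachable a b)
    (hb : b ∉ B) :
    (S.away (A ∪ B)).Reachable a b ∨
      ∃ x y, x ∈ B ∧ (S.away A).Adj x y ∧ (S.away (A ∪ B)).Reachable y b ∧ y ∉ B := by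
  refine h.head_induction (P := fun a => (S.away (A ∪ B)).Reachable a b ∨
      ∃ x y, x ∈ B ∧ (S.away A).Adj x y ∧ (S.away (A ∪ B)).Reachable y b ∧ y ∉ B)
    (Or.inl (Reachable.refl _)) ?_
  intro z y hzy _ ih
  rcases ih with ih | ih
  · by_cases hy : y ∈ B
    · have : b = y := by
        refine ih.head_induction (P := fun x => x ∈ B → b = x) (fun _ => rfl) ?_ hy
        intro x y hxy _ _ hx
        exact (hxy.2.1 (Or.inr hx)).elim
      exact (hb (this ▸ hy)).elim
    by_cases hz : z ∈ B
    · exact Or.inr ⟨z, y, hz, hzy, ih, hy⟩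
    · exact Or.inl (Reachable.trans (Adj.reachable
        ⟨hzy.1, by simp [hz, hzy.2.1], by simp [hy, hzy.2.2]⟩) ih)
  · exact Or.inr ih

/-- There is no cut vertex. -/
def NoCutVertex (S : SimpleGraph V) : Prop :=
  ∀ v a b, a ≠ v → b ≠ v → (S.away {v}).Reachable a b

/-- `u` and `w` are nonadjacent and their deletion separates the graph. -/
def IsSeparatingPair (S : SimpleGraph V) (u w : V) : Prop :=
  u ≠ w ∧ ¬ S.Adj u w ∧ ∃ p q, p ∉ ({u, w} : Set V) ∧ q ∉ ({u, w} : Set V) ∧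
    ¬ (S.away {u, w}).Reachable p q

theorem IsSeparatingPair.symm {u w : V} (h : S.IsSeparatingPair u w) :
    S.IsSeparatingPair w u := by
  obtain ⟨h1, h2, h3⟩ := h
  refine ⟨h1.symm, fun h => h2 h.symm, ?_⟩
  rwa [Set.pair_comm]

/-- Any two nonadjacent neighbours of a vertex form a separating pair. -/
def NeighborsSeparate (S : SimpleGraph V) : Prop :=
  ∀ v u w, u ≠ w → ¬ S.Adj u w → S.Adj v u → S.Adj v w → S.IsSeparatingPair u w

/-- If `u` and `w` were still joined after removing `d` and `d'`, then so would be everything else: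
each other vertex `z` is cut off by `u` and `w` from one of `d`, `d'`, and a walk from `z` avoiding
the other one leads to `u` or `w`. But `d` and `d'` are nonadjacent neighbours of `u`, so they
separate. -/
theorem not_reachable_of_separating (h2 : S.NoCutVertex) (h3 : S.NeighborsSeparate) {u w : V}
    {d d' : V} (hd : S.Adj u d) (hd' : S.Adj u d') (hw : d ≠ w) (hw' : d' ≠ w) (huw : u ≠ w)
    (hn : ¬ (S.away {u, w}).Reachable d d') : ¬ (S.away {d, d'}).Reachable u w := by
  intro hr
  have hdd : d ≠ d' := by rintro rfl; exact hn (Reachable.refl _)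
  have hnadj : ¬ S.Adj d d' := fun h => hn (Adj.reachable
    ⟨h, by simp [hd.ne', hw], by simp [hd'.ne', hw']⟩)
  obtain ⟨-, -, p, q, hp, hq, hpq⟩ := h3 u d d' hdd hnadj hd hd'
  have key : ∀ z, z ∉ ({d, d'} : Set V) → (S.away {d, d'}).Reachable z u := by
    intro z hz
    simp only [Set.mem_insert_iff, Set.mem_singleton_iff, not_or] at hz
    by_cases hzu : z = u
    · subst hzu; exact Reachable.refl _
    by_cases hzw : z = w
    · subst hzw; exact hr.symm
    have hzA : z ∉ ({u, w} : Set V) := by simp [hzu, hzw]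
    -- A walk from `z` to `u` avoiding `d` is cut at its first vertex in `{u, w}`. Until then it
    -- stays in the component of `z` in the graph without `u` and `w`, which does not contain `d'`.
    have main : ∀ d d', S.Adj u d → d ≠ w → d' ≠ w → u ≠ d' → z ≠ d → z ≠ d' →
        ¬ (S.away {u, w}).Reachable z d' →
        (S.away {d, d'}).Reachable z u ∨ (S.away {d, d'}).Reachable z w := by
      intro d d' hd hdw hdw' hud' hzd hzd' hnr
      obtain ⟨y, x, hx, hyx, hy, hzy⟩ := (h2 d z u hzd hd.ne).exists_first
        (B := {u, w}) (by simp) hzA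
      have h1 : (S.away {d, d'}).Reachable z y ∧ y ≠ d' := by
        have aux : ∀ a, (S.away ({d} ∪ {u, w})).Reachable a y → a ≠ d' ∧
            ¬ (S.away {u, w}).Reachable a d' → (S.away {d, d'}).Reachable a y ∧ y ≠ d' := by
          intro a ha
          refine ha.head_induction (P := fun a => a ≠ d' ∧ ¬ (S.away {u, w}).Reachable a d' →
            (S.away {d, d'}).Reachable a y ∧ y ≠ d') (fun h => ⟨Reachable.refl _, h.1⟩) ?_
          rintro x y' hxy - ih ⟨hx1, hx2⟩
          have hxy' : (S.away {u, w}).Adj x y' :=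
            ⟨hxy.1, fun h => hxy.2.1 (Or.inr h), fun h => hxy.2.2 (Or.inr h)⟩
          have hy1 : ¬ (S.away {u, w}).Reachable y' d' := fun h => hx2 (hxy'.reachable.trans h)
          have hy2 : y' ≠ d' := by rintro rfl; exact hy1 (Reachable.refl _)
          obtain ⟨i1, i2⟩ := ih ⟨hy2, hy1⟩
          refine ⟨Reachable.trans (Adj.reachable ⟨hxy.1, ?_, ?_⟩) i1, i2⟩
          · have : x ≠ d := fun h => hxy.2.1 (Or.inl h)
            simp [this, hx1]
          · have : y' ≠ d := fun h => hxy.2.2 (Or.inl h)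
            simp [this, hy2]
        exact aux z hzy ⟨hzd', hnr⟩
      have hyd : y ≠ d := fun h => hyx.2.1 h
      have h4 : (S.away {d, d'}).Adj y x := by
        refine ⟨hyx.1, by simp [hyd, h1.2], ?_⟩
        rcases hx with rfl | rfl
        · simp [hd.ne, hud']
        · simp [hdw.symm, hdw'.symm]
      rcases hx with rfl | rfl
      · exact Or.inl (h1.1.trans h4.reachable)
      · exact Or.inr (h1.1.trans h4.reachable)
    have h5 : (S.away {d, d'}).Reachable z u ∨ (S.away {d, d'}).Reachable z w := by
      by_cases hzd : (S.away {u, w}).Reachable z d'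
      · have := main d' d hd' hw' hw hd.ne hz.2 hz.1 (fun h => hn (h.symm.trans hzd))
        rwa [Set.pair_comm] at this
      · exact main d d' hd hw hw' hd'.ne hz.1 hz.2 hzd
    rcases h5 with h | h
    · exact h
    · exact h.trans hr.symm
  exact hpq ((key p hp).trans (key q hq).symm)

/-- Otherwise there is a walk from `d₁` to `w` avoiding `u` and `d'`. Preceding its part after the
last visit to `{d₁, d₂}` by the edge from `u` gives a walk from `u` to `w` that avoids `d'` and one
of `d₁`, `d₂`. This contradicts `not_reachable_of_separating` for that pair. -/
theorem subsingleton_side (h2 : S.NoCutVertex) (h3 : S.NeighborsSeparate) {u w : V}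
    {d₁ d₂ d' : V} (hd₁ : S.Adj u d₁) (hd₂ : S.Adj u d₂) (hd' : S.Adj u d') (hw₁ : d₁ ≠ w)
    (hw₂ : d₂ ≠ w) (hw' : d' ≠ w) (huw : u ≠ w)
    (hn₁ : ¬ (S.away {u, w}).Reachable d₁ d') (hn₂ : ¬ (S.away {u, w}).Reachable d₂ d') :
    d₁ = d₂ := by
  by_contra hne
  have c₁ := not_reachable_of_separating h2 h3 hd₁ hd' hw₁ hw' huw hn₁
  have c₂ := not_reachable_of_separating h2 h3 hd₂ hd' hw₂ hw' huw hn₂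
  -- a walk from `d₁` to `w` avoiding `u` and `d'`
  obtain ⟨y, x, hx, hyx, hy, hzy⟩ := (h2 u d₁ w hd₁.ne' huw.symm).exists_first
    (B := {w}) (by simp) hw₁
  obtain rfl : x = w := hx
  have aux : ∀ a, (S.away ({u} ∪ {x})).Reachable a y → ¬ (S.away {u, x}).Reachable a d' →
      (S.away {u, d'}).Reachable a y ∧ y ≠ d' := by
    intro a ha
    refine ha.head_induction (P := fun a => ¬ (S.away {u, x}).Reachable a d' →
      (S.away {u, d'}).Reachable a y ∧ y ≠ d')
      (fun h => ⟨Reachable.refl _, by rintro rfl; exact h (Reachable.refl _)⟩) ?_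
    intro a b hab _ ih hna
    have hab' : (S.away {u, x}).Adj a b := hab
    have hb1 : ¬ (S.away {u, x}).Reachable b d' := fun h => hna (hab'.reachable.trans h)
    have hb2 : b ≠ d' := by rintro rfl; exact hb1 (Reachable.refl _)
    have ha2 : a ≠ d' := by rintro rfl; exact hna (Reachable.refl _)
    obtain ⟨i1, i2⟩ := ih hb1
    have e1 : a ≠ u := fun h => hab'.2.1 (Or.inl h)
    have e2 : b ≠ u := fun h => hab'.2.2 (Or.inl h)
    exact ⟨Reachable.trans (Adj.reachable ⟨hab.1, by simp [e1, ha2], by simp [e2, hb2]⟩) i1, i2⟩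
  obtain ⟨r1, r2⟩ := aux d₁ hzy hn₁
  have hyu : y ≠ u := fun h => hyx.2.1 h
  have r3 : (S.away {u, d'}).Reachable d₁ x := r1.trans (Adj.reachable
    ⟨hyx.1, by simp [hyu, r2], by simp [huw.symm, hw'.symm]⟩)
  rcases r3.exists_last (B := {d₁, d₂}) (by simp [hw₁.symm, hw₂.symm]) with
    h | ⟨a, b, ha, hab, hbx, hb⟩
  · have : x = d₁ := by
      refine h.head_induction (P := fun a => a = d₁ → x = a) (fun _ => rfl) ?_ rfl
      rintro a b hab - - rfl
      exact (hab.2.1 (by simp)).elim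
    exact hw₁ this.symm
  · have hbu : b ≠ u ∧ b ≠ d' := by
      have := hab.2.2; simpa using this
    simp only [Set.mem_insert_iff, Set.mem_singleton_iff, not_or] at hb
    rcases ha with rfl | rfl
    · refine c₂ (Reachable.trans (Adj.reachable ⟨hd₁, ?_, ?_⟩)
        (Reachable.trans (Adj.reachable ⟨hab.1, ?_, ?_⟩) (hbx.mono (away_anti ?_))))
      · simp [hd₂.ne, hd'.ne]
      · have : a ≠ d' := by rintro rfl; exact hn₁ (Reachable.refl _)
        simp [hne, this]
      · have : a ≠ d' := by rintro rfl; exact hn₁ (Reachable.refl _)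
        simp [hne, this]
      · simp [hb.2, hbu.2]
      · rintro z (rfl | rfl) <;> simp
    · refine c₁ (Reachable.trans (Adj.reachable ⟨hd₂, ?_, ?_⟩)
        (Reachable.trans (Adj.reachable ⟨hab.1, ?_, ?_⟩) (hbx.mono (away_anti ?_))))
      · simp [hd₁.ne, hd'.ne]
      · have : a ≠ d' := by rintro rfl; exact hn₂ (Reachable.refl _)
        simp [Ne.symm hne, this]
      · have : a ≠ d' := by rintro rfl; exact hn₂ (Reachable.refl _)
        simp [Ne.symm hne, this]
      · simp [hb.1, hbu.2]
      · rintro z (rfl | rfl) <;> simp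

/-- Since `w` is not a cut vertex, each component left by `u` and `w` contains a neighbour of `u`;
by `subsingleton_side` there is only one on each side. These two are nonadjacent neighbours of `u`,
so they form a separating pair in turn, which lets the property spread. -/
theorem IsSeparatingPair.neighbors (h2 : S.NoCutVertex) (h3 : S.NeighborsSeparate) {u w : V}
    (h : S.IsSeparatingPair u w) :
    ∃ d d', d ≠ d' ∧ S.IsSeparatingPair d d' ∧ ∀ x, S.Adj u x ↔ x = d ∨ x = d' := by
  obtain ⟨huw, hnadj, p, q, hp, hq, hpq⟩ := h
  have key : ∀ p, p ∉ ({u, w} : Set V) → ∃ d, S.Adj u d ∧ d ≠ w ∧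
      (S.away {u, w}).Reachable p d := by
    intro p hp
    simp only [Set.mem_insert_iff, Set.mem_singleton_iff, not_or] at hp
    obtain ⟨y, x, hx, hyx, hy, hzy⟩ := (h2 w p u hp.2 huw).exists_first
      (B := {u}) (by simp) hp.1
    obtain rfl : x = u := hx
    refine ⟨y, hyx.1.symm, fun h => hyx.2.1 h, ?_⟩
    rwa [Set.pair_comm]
  obtain ⟨d, hd, hdw, hpd⟩ := key p hp
  obtain ⟨d', hd', hdw', hqd⟩ := key q hq
  have hn : ¬ (S.away {u, w}).Reachable d d' := fun h => hpq (hpd.trans (h.trans hqd.symm))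
  have hne : d ≠ d' := by rintro rfl; exact hn (Reachable.refl _)
  refine ⟨d, d', hne, h3 u d d' hne ?_ hd hd', fun x => ⟨fun hx => ?_, ?_⟩⟩
  · exact fun h => hn (Adj.reachable ⟨h, by simp [hd.ne', hdw], by simp [hd'.ne', hdw']⟩)
  · have hxw : x ≠ w := by rintro rfl; exact hnadj hx
    by_cases hxd : (S.away {u, w}).Reachable x d'
    · right
      exact subsingleton_side h2 h3 hx hd' hd hxw hdw' hdw huw
        (fun h => hn (h.symm.trans hxd)) (fun h => hn h.symm)
    · left
      exact subsingleton_side h2 h3 hx hd hd' hxw hdw hdw' huw hxd hn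
  · rintro (rfl | rfl) <;> assumption

/-- A graph without cut vertices in which nonadjacent neighbours of a vertex always separate is
complete or a cycle of length at least four. -/
theorem eq_top_or_isCycles (h1 : S.Preconnected) (h2 : S.NoCutVertex)
    (h3 : S.NeighborsSeparate) :
    (∀ a b, a ≠ b → S.Adj a b) ∨
      ((∃ a b, a ≠ b ∧ ¬ S.Adj a b) ∧
        ∀ u, ∃ d d', d ≠ d' ∧ ∀ x, S.Adj u x ↔ x = d ∨ x = d') := by
  by_cases hc : ∀ a b, a ≠ b → S.Adj a b
  · exact Or.inl hc
  right
  push Not at hc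
  refine ⟨hc, ?_⟩
  obtain ⟨a, b, hab, hnab⟩ := hc
  -- Without separating pairs, being equal or adjacent to `b` would propagate along walks.
  have hpair : ∃ u w, S.IsSeparatingPair u w := by
    by_contra hno
    push Not at hno
    have : ∀ x, S.Reachable x b → x = b ∨ S.Adj x b := by
      intro x hx
      refine hx.head_induction (P := fun x => x = b ∨ S.Adj x b) (Or.inl rfl) ?_
      intro x y hxy _ ih
      rcases ih with rfl | ih
      · exact Or.inr hxy
      · by_contra hx
        push Not at hx
        exact hno x b (h3 y x b hx.1 hx.2 hxy.symm ih)
    rcases this a (h1 a b) with h | h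
    · exact hab h
    · exact hnab h
  obtain ⟨u₀, w₀, h₀⟩ := hpair
  -- The two neighbours of a member of a separating pair form a separating pair, so membership
  -- passes along edges.
  have hall : ∀ u, ∃ w, S.IsSeparatingPair u w := by
    intro u
    refine (h1 u u₀).head_induction (P := fun x => ∃ w, S.IsSeparatingPair x w) ⟨w₀, h₀⟩ ?_
    rintro x y hxy - ⟨w, hw⟩
    obtain ⟨d, d', -, hs, hN⟩ := hw.neighbors h2 h3
    rcases (hN x).1 hxy.symm with rfl | rfl
    · exact ⟨d', hs⟩
    · exact ⟨d, hs.symm⟩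
  intro u
  obtain ⟨w, hw⟩ := hall u
  obtain ⟨d, d', hne, -, hN⟩ := hw.neighbors h2 h3
  exact ⟨d, d', hne, hN⟩

/-- A finite connected graph in which all degrees are two is a cycle. -/
theorem exists_equiv_cycleGraph [Finite V] [Nonempty V] (h1 : S.Preconnected)
    (h2 : ∀ u, ∃ d d', d ≠ d' ∧ ∀ x, S.Adj u x ↔ x = d ∨ x = d') :
    ∃ (n : ℕ) (φ : Fin n ≃ V), 3 ≤ n ∧ ∀ i j, (cycleGraph n).Adj i j ↔ S.Adj (φ i) (φ j) := by
  classical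
  have := Fintype.ofFinite V
  have hN : ∀ u, ∃ d d', d ≠ d' ∧ S.neighborSet u = {d, d'} := by
    intro u
    obtain ⟨d, d', hne, h⟩ := h2 u
    exact ⟨d, d', hne, by ext x; simp [h]⟩
  have hcyc : S.IsCycles := by
    intro u _
    obtain ⟨d, d', hne, h⟩ := hN u
    rw [h, Set.ncard_pair hne]
  obtain ⟨a⟩ := ‹Nonempty V›
  have ha : (S.neighborSet a).Nonempty := by
    obtain ⟨d, d', hne, h⟩ := hN a
    exact ⟨d, by simp [h]⟩
  obtain ⟨p, hp, hsupp⟩ := hcyc.exists_cycle_toSubgraph_verts_eq_connectedComponentSupp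
    (c := S.connectedComponentMk a) rfl ha
  -- The cycle covers the component of `a`, which is the whole graph.
  have hlen : p.length = Fintype.card V := by
    have hs : ∀ x, x ∈ p.support.tail := by
      intro x
      have : x ∈ p.toSubgraph.verts := by
        rw [hsupp, ConnectedComponent.mem_supp_iff, ConnectedComponent.eq]
        exact h1 x a
      rw [Walk.mem_verts_toSubgraph] at this
      rw [Walk.mem_support_iff] at this
      rcases this with rfl | h
      · exact Walk.end_mem_tail_support hp.not_nil
      · exact h
    have hnd := hp.support_nodup
    have h3 : p.support.tail.toFinset = Finset.univ := by ext x; simp [hs]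
    have h4 := List.toFinset_card_of_nodup hnd
    rw [h3, Finset.card_univ, List.length_tail, Walk.length_support] at h4
    omega
  have h3n := hp.three_le_length
  obtain ⟨f⟩ := (cycleGraph_isContained_iff (G := S) (n := p.length) (by omega)).2 ⟨a, p, hp, rfl⟩
  have hinj : Function.Injective f := f.injective
  have hbij : Function.Bijective f := by
    rw [Fintype.bijective_iff_injective_and_card]
    exact ⟨hinj, by simp [hlen]⟩
  refine ⟨p.length, Equiv.ofBijective f hbij, h3n, fun i j => ⟨fun h => f.toHom.map_adj h, ?_⟩⟩
  intro h
  obtain ⟨m, hm⟩ : ∃ m, p.length = m + 3 := ⟨p.length - 3, by omega⟩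
  generalize p.length = n at *
  subst hm
  have hdeg := cycleGraph_degree_three_le (n := m) (v := i)
  -- Neighbourhoods have two elements in both graphs, so the copy of the cycle misses no edge of
  -- `S`.
  have hsub : ((cycleGraph (m + 3)).neighborFinset i).image f ⊆ S.neighborFinset (f i) := by
    intro x hx
    simp only [Finset.mem_image, mem_neighborFinset] at hx ⊢
    obtain ⟨k, hk, rfl⟩ := hx
    exact f.toHom.map_adj hk
  have hcard : (S.neighborFinset (f i)).card ≤
      (((cycleGraph (m + 3)).neighborFinset i).image f).card := by
    rw [Finset.card_image_of_injective _ hinj, (cycleGraph (m + 3)).card_neighborFinset_eq_degree,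
      hdeg]
    obtain ⟨d, d', hne, hd⟩ := hN (f i)
    rw [neighborFinset_def, Set.toFinset_card, ← Nat.card_eq_fintype_card, Nat.card_coe_set_eq,
      hd, Set.ncard_pair hne]
  have heq := Finset.eq_of_subset_of_card_le hsub hcard
  have hj : f j ∈ S.neighborFinset (f i) := by simpa using h
  rw [← heq] at hj
  simp only [Finset.mem_image, mem_neighborFinset] at hj
  obtain ⟨k, hk, hkj⟩ := hj
  rwa [← hinj hkj]

end SimpleGraph

/-! ### Covers, forbidden colours and greedy colouring -/

namespace DPColoring

open MultiHypergraph

section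

variable {V : Type u} {E : Type v} {C : Type w} {F : Type z}

/-- The simple graph in which two vertices are adjacent if some edge contains both. -/
def MultiHypergraph.adjGraph (G : MultiHypergraph V E) : SimpleGraph V where
  Adj := G.Adj
  symm := ⟨fun _ _ ⟨h, e, ha, hb⟩ => ⟨h.symm, e, hb, ha⟩⟩
  loopless := ⟨fun _ h => h.1 rfl⟩

theorem MultiHypergraph.Connected.preconnected {G : MultiHypergraph V E} (h : G.Connected) :
    G.adjGraph.Preconnected :=
  fun a b => (SimpleGraph.reachable_iff_reflTransGen a b).2 (h a b)

theorem MultiHypergraph.exists_mem_ne (G : MultiHypergraph V E) (e : E) (r : V) :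
    ∃ b ∈ G.inc e, b ≠ r :=
  Set.exists_ne_of_one_lt_ncard (G.two_le_ncard_inc e) r

/-- A cover described by the map `p` sending each colour to its vertex and by the matchings. -/
structure Cov (G : MultiHypergraph V E) (H : MultiHypergraph C F) (p : C → V) (M : E → Set F) :
    Prop where
  matching : ∀ {e f f' x}, f ∈ M e → f' ∈ M e → x ∈ H.inc f → x ∈ H.inc f' → f = f'
  bijOn : ∀ {e f}, f ∈ M e → Set.BijOn p (H.inc f) (G.inc e)
  exists_mem : ∀ f, ∃ e, f ∈ M e

/-- As the sets `X a` partition the colours, they are the fibres of a map. Meeting each relevant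
fibre once then becomes bijectivity of this map on the edges of a matching. -/
theorem IsCover.exists_cov {G : MultiHypergraph V E} {X : V → Set C} {H : MultiHypergraph C F}
    (h : IsCover G X H) : ∃ p M, Cov G H p M ∧ X = fun a => p ⁻¹' {a} := by
  obtain ⟨hd, hU, -, M, h1, h2, h3, h4⟩ := h
  have hp : ∀ x, ∃ a, x ∈ X a := fun x => by
    have : x ∈ ⋃ a, X a := hU ▸ Set.mem_univ x
    simpa using this
  choose p hp using hp
  have huniq : ∀ x a, x ∈ X a ↔ p x = a := by
    refine fun x a => ⟨fun hx => ?_, fun h => h ▸ hp x⟩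
    by_contra hne
    exact Set.disjoint_left.1 (hd _ _ hne) (hp x) hx
  refine ⟨p, M, ⟨fun {e f f' x} => fun hf hf' hx hx' => h1 e f hf f' hf' x hx hx', ?_, ?_⟩, ?_⟩
  · intro e f hf
    refine ⟨fun x hx => ?_, fun x hx y hy hxy => ?_, fun a ha => ?_⟩
    · have := h2 e f hf hx
      simp only [Set.mem_iUnion] at this
      obtain ⟨a, ha, hxa⟩ := this
      rwa [(huniq x a).1 hxa]
    · have hxe : p x ∈ G.inc e := by
        have := h2 e f hf hx
        simp only [Set.mem_iUnion] at this
        obtain ⟨a, ha, hxa⟩ := this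
        rwa [(huniq x a).1 hxa]
      obtain ⟨c, hc⟩ := Set.ncard_eq_one.1 (h3 e f hf (p x) hxe)
      have e1 : x ∈ H.inc f ∩ X (p x) := ⟨hx, hp x⟩
      have e2 : y ∈ H.inc f ∩ X (p x) := ⟨hy, hxy ▸ hp y⟩
      rw [hc] at e1 e2
      exact e1.trans e2.symm
    · obtain ⟨c, hc⟩ := Set.ncard_eq_one.1 (h3 e f hf a ha)
      have : c ∈ H.inc f ∩ X a := by rw [hc]; rfl
      exact ⟨c, this.1, (huniq _ _).1 this.2⟩
  · intro f
    have : f ∈ ⋃ e, M e := h4 ▸ Set.mem_univ f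
    simpa using this
  · ext a x; simp [huniq]

theorem Cov.isCover {G : MultiHypergraph V E} {H : MultiHypergraph C F} {p : C → V}
    {M : E → Set F} (h : Cov G H p M) : IsCover G (fun a => p ⁻¹' {a}) H where
  disjoint a b hab := Set.disjoint_left.2 fun x hx hx' => hab (by simp_all)
  iUnion_eq := by ext; simp
  independent a f hf := by
    obtain ⟨e, he⟩ := h.exists_mem f
    obtain ⟨b, hb, hne⟩ := G.exists_mem_ne e a
    obtain ⟨x, hx, rfl⟩ := (h.bijOn he).surjOn hb
    exact hne (hf hx)
  exists_matchings := by
    refine ⟨M, fun e f hf f' hf' a => h.matching hf hf', fun e f hf x hx => ?_,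
      fun e f hf a ha => ?_, ?_⟩
    · simpa using (h.bijOn hf).mapsTo hx
    · obtain ⟨x, hx, rfl⟩ := (h.bijOn hf).surjOn ha
      rw [Set.ncard_eq_one]
      refine ⟨x, Set.eq_singleton_iff_unique_mem.2 ⟨⟨hx, rfl⟩, fun y hy => ?_⟩⟩
      exact (h.bijOn hf).injOn hy.1 hx hy.2
    · ext f; simpa using h.exists_mem f

/-- `c` colours the vertices of `A`, and no edge of `H` is contained in the set of these colours. -/
def ProperOn (H : MultiHypergraph C F) (p : C → V) (A : Set V) (c : V → C) : Prop :=
  (∀ a ∈ A, p (c a) = a) ∧ ∀ f, ¬ H.inc f ⊆ c '' A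

theorem exists_proper_iff_colorable {H : MultiHypergraph C F} {p : C → V} :
    (∃ c, ProperOn H p Set.univ c) ↔ Colorable (fun a => p ⁻¹' {a}) H := by
  constructor
  · rintro ⟨c, h1, h2⟩
    refine ⟨Set.range c, fun a => Set.ncard_eq_one.2 ⟨c a, ?_⟩, fun f hf => h2 f ?_⟩
    · ext x
      constructor
      · rintro ⟨⟨b, rfl⟩, hb⟩
        have : b = a := (h1 b trivial).symm.trans hb
        simp [this]
      · rintro rfl
        exact ⟨⟨a, rfl⟩, h1 a trivial⟩
    · simpa using hf
  · rintro ⟨T, h1, h2⟩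
    choose c hc using fun a => Set.ncard_eq_one.1 (h1 a)
    have hc' : ∀ a, c a ∈ T ∩ p ⁻¹' {a} := fun a => by rw [hc]; rfl
    refine ⟨c, fun a _ => (hc' a).2, fun f hf => h2 f (hf.trans ?_)⟩
    rintro _ ⟨a, -, rfl⟩
    exact (hc' a).1

/-- The edge `e` forbids the colour `x` of the vertex `r`, given the colours of the other
vertices. -/
def Blocks (G : MultiHypergraph V E) (H : MultiHypergraph C F) (M : E → Set F) (c : V → C) (r : V)
    (e : E) (x : C) : Prop :=
  r ∈ G.inc e ∧ ∃ f ∈ M e, x ∈ H.inc f ∧ ∀ a ∈ G.inc e, a ≠ r → c a ∈ H.inc f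

variable {G : MultiHypergraph V E} {H : MultiHypergraph C F} {p : C → V} {M : E → Set F}
  {c : V → C} {r : V}

/-- The edge `e` has a second vertex; its colour lies in at most one edge of the matching, and that
edge contains a single colour of `r`. -/
theorem Cov.blocks_unique (h : Cov G H p M) {e : E} {x x' : C} (hx : Blocks G H M c r e x)
    (hx' : Blocks G H M c r e x') (hp : p x = r) (hp' : p x' = r) : x = x' := by
  obtain ⟨-, f, hf, hxf, h1⟩ := hx
  obtain ⟨-, f', hf', hxf', h2⟩ := hx'
  obtain ⟨b, hb, hbr⟩ := G.exists_mem_ne e r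
  obtain rfl := h.matching hf hf' (h1 b hb hbr) (h2 b hb hbr)
  exact (h.bijOn hf).injOn hxf hxf' (hp.trans hp'.symm)

/-- If all colours of `r` are forbidden by edges in `D`, then each edge at `r` is in `D` and forbids
exactly one colour, and different edges forbid different colours. -/
theorem Cov.exhaust (h : Cov G H p M) (hdeg : G.degree r ≤ (p ⁻¹' {r}).ncard) {D : Set E}
    (hD : ∀ x, p x = r → ∃ e ∈ D, Blocks G H M c r e x) :
    (∀ e, r ∈ G.inc e → e ∈ D ∧ ∃ x, p x = r ∧ Blocks G H M c r e x) ∧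
      (∀ x e e', p x = r → Blocks G H M c r e x → Blocks G H M c r e' x → e = e') ∧
      G.degree r = (p ⁻¹' {r}).ncard := by
  have := G.finite_edges
  choose g hgD hg using fun x : p ⁻¹' {r} => hD x x.2
  let g' : (p ⁻¹' {r}) → {e | r ∈ G.inc e} := fun x => ⟨g x, (hg x).1⟩
  have hinj : Function.Injective g' := by
    intro x y hxy
    have hxy' : g x = g y := congrArg Subtype.val hxy
    exact Subtype.ext (h.blocks_unique (hg x) (hxy' ▸ hg y) x.2 y.2)
  -- Different colours are forbidden by different edges, and there are at least as many colours as
  -- edges at `r`, so nothing is left over on either side.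
  have hbij := hinj.bijective_of_nat_card_le (by
    rw [Nat.card_coe_set_eq, Nat.card_coe_set_eq]; exact hdeg)
  have hsurj : ∀ e, r ∈ G.inc e → ∃ x, g x = e := by
    intro e he
    obtain ⟨x, hx⟩ := hbij.surjective ⟨e, he⟩
    exact ⟨x, congrArg Subtype.val hx⟩
  have huniq : ∀ x e, Blocks G H M c r e x.1 → e = g x := by
    intro x e hb
    obtain ⟨y, rfl⟩ := hsurj e hb.1
    rw [Subtype.ext (h.blocks_unique hb (hg y) x.2 y.2)]
  refine ⟨fun e he => ?_, fun x e e' hx he he' => ?_, ?_⟩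
  · obtain ⟨x, rfl⟩ := hsurj e he
    exact ⟨hgD x, x, x.2, hg x⟩
  · rw [huniq ⟨x, hx⟩ e he, huniq ⟨x, hx⟩ e' he']
  · have := Nat.card_congr (Equiv.ofBijective _ hbij)
    rw [Nat.card_coe_set_eq, Nat.card_coe_set_eq] at this
    exact this.symm

theorem Cov.subset_image_iff (h : Cov G H p M) {A : Set V} (hA : ∀ a ∈ A, p (c a) = a) {e : E}
    {f : F} (hf : f ∈ M e) :
    H.inc f ⊆ c '' A ↔ ∀ a ∈ G.inc e, a ∈ A ∧ c a ∈ H.inc f := by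
  constructor
  · intro hs a ha
    obtain ⟨x, hx, rfl⟩ := (h.bijOn hf).surjOn ha
    obtain ⟨b, hb, rfl⟩ := hs hx
    rw [hA b hb]
    exact ⟨hb, hx⟩
  · intro hs x hx
    obtain ⟨h1, h2⟩ := hs (p x) ((h.bijOn hf).mapsTo hx)
    exact ⟨p x, h1, (h.bijOn hf).injOn h2 hx (hA _ h1)⟩

theorem Cov.properOn_iff (h : Cov G H p M) {A : Set V} :
    ProperOn H p A c ↔ (∀ a ∈ A, p (c a) = a) ∧
      ∀ e, ∀ f ∈ M e, ¬ ∀ a ∈ G.inc e, a ∈ A ∧ c a ∈ H.inc f := by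
  refine and_congr_right fun hA => ⟨fun hc e f hf => ?_, fun hc f => ?_⟩
  · rw [← h.subset_image_iff hA hf]; exact hc f
  · obtain ⟨e, he⟩ := h.exists_mem f
    rw [h.subset_image_iff hA he]; exact hc e f he

open Classical in
/-- An unblocked colour extends a proper colouring. -/
theorem Cov.properOn_update (h : Cov G H p M) {A : Set V} (hc : ProperOn H p A c) (hr : r ∉ A)
    {x : C} (hx : p x = r)
    (hb : ∀ e, G.inc e ⊆ insert r A → ¬ Blocks G H M c r e x) :
    ProperOn H p (insert r A) (Function.update c r x) := by
  rw [h.properOn_iff] at hc ⊢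
  refine ⟨fun a ha => ?_, fun e f hf hall => ?_⟩
  · by_cases har : a = r
    · subst har; simpa
    · rw [Function.update_of_ne har]
      exact hc.1 a (ha.resolve_left har)
  · have hsub : G.inc e ⊆ insert r A := fun a ha => (hall a ha).1
    by_cases hre : r ∈ G.inc e
    · refine hb e hsub ⟨hre, f, hf, ?_, fun a ha har => ?_⟩
      · simpa using (hall r hre).2
      · simpa [Function.update_of_ne har] using (hall a ha).2
    · refine hc.2 e f hf fun a ha => ?_
      have har : a ≠ r := fun h => hre (h ▸ ha)
      exact ⟨(hsub ha).resolve_left har, by simpa [Function.update_of_ne har] using (hall a ha).2⟩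

/-- Greedy extension of a partial colouring towards the vertex `r`. -/
theorem Cov.exists_extension (h : Cov G H p M) (hdeg : ∀ a, G.degree a ≤ (p ⁻¹' {a}).ncard)
    {A : Set V} (hc : ProperOn H p A c) (hr : r ∉ A)
    (hreach : ∀ a, a ∉ A → (G.adjGraph.away A).Reachable a r) :
    ∃ c', ProperOn H p {r}ᶜ c' ∧ ∀ a ∈ A, c' a = c a := by
  classical
  have hfin := G.finite_vertices
  -- Here `d` will be the distance to `r` outside the precoloured set. The induction only needs that
  -- each uncoloured vertex other than `r` has an uncoloured neighbour with smaller value.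
  have key : ∀ (k : ℕ) (B : Set V) (c : V → C), Bᶜ.ncard = k → r ∉ B → ProperOn H p B c →
      ∀ d : V → ℕ, (∀ a, a ∉ B → a ≠ r → ∃ b, b ∉ B ∧ G.Adj a b ∧ d b < d a) →
      ∃ c', ProperOn H p {r}ᶜ c' ∧ ∀ a ∈ B, c' a = c a := by
    intro k
    induction k with
    | zero =>
      intro B c hB hr
      rw [Set.ncard_eq_zero] at hB
      have : r ∈ Bᶜ := hr
      simp [hB] at this
    | succ k ih =>
      intro B c hB hr hc d hd
      by_cases hex : ∃ a, a ∉ B ∧ a ≠ r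
      · obtain ⟨a, ⟨haB, har⟩, hmax⟩ := Set.exists_max_image {a | a ∉ B ∧ a ≠ r} d
          (Set.toFinite _) hex
        obtain ⟨b, hb, ⟨hab, e, hae, hbe⟩, -⟩ := hd a haB har
        have hx : ∃ x, p x = a ∧ ∀ e, G.inc e ⊆ insert a B → ¬ Blocks G H M c a e x := by
          by_contra hno
          push Not at hno
          have := (h.exhaust (hdeg a) (D := {e | G.inc e ⊆ insert a B}) hno).1 e hae
          exact (this.1 hbe).elim (fun h => hab h.symm) hb
        obtain ⟨x, hxa, hx⟩ := hx
        have hrB : r ∉ insert a B := by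
          rintro (rfl | h)
          · exact har rfl
          · exact hr h
        obtain ⟨c', hc', hcc⟩ := ih (insert a B) (Function.update c a x) (by
            have h1 : insert a (insert a B)ᶜ = Bᶜ := by
              ext y; by_cases hy : y = a <;> simp [hy, haB]
            have h2 := Set.ncard_insert_of_notMem (s := (insert a B)ᶜ) (a := a) (by simp)
            rw [h1] at h2
            omega) hrB (h.properOn_update hc haB hxa hx) d (by
            intro a' ha' har'
            simp only [Set.mem_insert_iff, not_or] at ha'
            obtain ⟨b, hb, hadj, hlt⟩ := hd a' ha'.2 har'
            refine ⟨b, ?_, hadj, hlt⟩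
            rintro (rfl | hbB)
            · exact absurd (hmax a' ⟨ha'.2, har'⟩) (not_le.2 hlt)
            · exact hb hbB)
        refine ⟨c', hc', fun y hy => ?_⟩
        rw [hcc y (Or.inr hy), Function.update_of_ne]
        rintro rfl
        exact haB hy
      · push Not at hex
        have : B = {r}ᶜ := by
          ext y
          refine ⟨?_, fun hy => by_contra fun hyB => hy (hex y hyB)⟩
          rintro hy rfl
          exact hr hy
        exact ⟨c, this ▸ hc, fun _ _ => rfl⟩
  refine key _ A c rfl hr hc (fun a => (G.adjGraph.away A).dist a r) ?_
  intro a ha har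
  obtain ⟨q, hq⟩ := (hreach a ha).exists_walk_length_eq_dist
  cases q with
  | nil => exact (har rfl).elim
  | cons hadj q' =>
    refine ⟨_, hadj.2.2, hadj.1, ?_⟩
    have := SimpleGraph.dist_le q'
    rw [SimpleGraph.Walk.length_cons] at hq
    omega

/-- A colouring with a hole at `r` which does not extend blocks each colour of `r` exactly once. -/
theorem Cov.hole (h : Cov G H p M) (hdeg : G.degree r ≤ (p ⁻¹' {r}).ncard)
    (hunc : ¬ ∃ c, ProperOn H p Set.univ c) (hc : ProperOn H p {r}ᶜ c) :
    (∀ x, p x = r → ∃ e, Blocks G H M c r e x) ∧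
      (∀ e, r ∈ G.inc e → ∃ x, p x = r ∧ Blocks G H M c r e x) ∧
      (∀ x e e', p x = r → Blocks G H M c r e x → Blocks G H M c r e' x → e = e') ∧
      G.degree r = (p ⁻¹' {r}).ncard := by
  classical
  have h0 : ∀ x, p x = r → ∃ e, Blocks G H M c r e x := by
    intro x hx
    by_contra hno
    push Not at hno
    have := h.properOn_update hc (by simp) hx (fun e _ => hno e)
    rw [show insert r ({r}ᶜ : Set V) = Set.univ by ext y; by_cases hy : y = r <;> simp [hy]] at this
    exact hunc ⟨_, this⟩
  have := h.exhaust (c := c) hdeg (D := Set.univ) (fun x hx => by simpa using h0 x hx)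
  exact ⟨h0, fun e he => (this.1 e he).2, this.2⟩

open Classical in
/-- Moving the hole along an edge. -/
theorem Cov.properOn_shift (h : Cov G H p M) (hdeg : G.degree r ≤ (p ⁻¹' {r}).ncard)
    (hunc : ¬ ∃ c, ProperOn H p Set.univ c) (hc : ProperOn H p {r}ᶜ c) {e : E} {x : C}
    (hx : p x = r) (hb : Blocks G H M c r e x) {a : V} (ha : a ∈ G.inc e) (har : a ≠ r) :
    ProperOn H p {a}ᶜ (Function.update c r x) := by
  -- The only edge forbidding `x` is `e`, and it is released because `a` loses its colour.
  have hu := (h.hole hdeg hunc hc).2.2.1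
  rw [h.properOn_iff] at hc ⊢
  refine ⟨fun b hb => ?_, fun e' f hf hall => ?_⟩
  · by_cases hbr : b = r
    · subst hbr; simpa
    · rw [Function.update_of_ne hbr]; exact hc.1 b hbr
  · have hae' : a ∉ G.inc e' := fun h => (hall a h).1 rfl
    by_cases hre : r ∈ G.inc e'
    · have : Blocks G H M c r e' x := ⟨hre, f, hf, by simpa using (hall r hre).2, fun b hb hbr => by
        simpa [Function.update_of_ne hbr] using (hall b hb).2⟩
      obtain rfl := hu x e e' hx hb this
      exact hae' ha
    · refine hc.2 e' f hf fun b hb => ?_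
      have hbr : b ≠ r := fun h => hre (h ▸ hb)
      exact ⟨hbr, by simpa [Function.update_of_ne hbr] using (hall b hb).2⟩

end

end DPColoring

/-! ### Uncolorable covers without cut vertices -/

namespace DPColoring

open MultiHypergraph

section

variable {V : Type u} {E : Type v} {C : Type w} {F : Type z}

/-- An uncolorable degree-feasible cover of a connected hypergraph without cut vertices. -/
structure UncolorableBlock (G : MultiHypergraph V E) (H : MultiHypergraph C F) (p : C → V)
    (M : E → Set F) : Prop where
  cov : Cov G H p M
  preconnected : G.adjGraph.Preconnected
  noCutVertex : G.adjGraph.NoCutVertex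
  degree_le : ∀ a, G.degree a ≤ (p ⁻¹' {a}).ncard
  not_colorable : ¬ ∃ c, ProperOn H p Set.univ c

variable {G : MultiHypergraph V E} {H : MultiHypergraph C F} {p : C → V} {M : E → Set F}

theorem properOn_singleton (x : C) : ProperOn H p {p x} fun _ => x := by
  refine ⟨fun a ha => ha.symm, fun f hf => ?_⟩
  obtain ⟨b, hb, hne⟩ := H.exists_mem_ne f x
  obtain ⟨_, _, h⟩ := hf hb
  exact hne h.symm

theorem properOn_empty (c : V → C) : ProperOn H p ∅ c := by
  refine ⟨fun a ha => ha.elim, fun f hf => ?_⟩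
  have := H.two_le_ncard_inc f
  rw [Set.image_empty, Set.subset_empty_iff] at hf
  simp [hf] at this

namespace UncolorableBlock

/-- The vertex `p x` is not a cut vertex, so the greedy colouring towards `r` can start from the
single colour `x`. -/
theorem exists_coloring_of_color (h : UncolorableBlock G H p M) (x : C) {r : V} (hr : r ≠ p x) :
    ∃ c, ProperOn H p {r}ᶜ c ∧ c (p x) = x := by
  obtain ⟨c, hc, hx⟩ := h.cov.exists_extension h.degree_le (properOn_singleton (H := H) x)
    (r := r) (by simpa using hr) (fun a ha => h.noCutVertex _ a r ha hr)
  exact ⟨c, hc, hx _ rfl⟩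

theorem exists_coloring [Nonempty C] (h : UncolorableBlock G H p M) (r : V) :
    ∃ c, ProperOn H p {r}ᶜ c := by
  obtain ⟨x⟩ := ‹Nonempty C›
  obtain ⟨c, hc, -⟩ := h.cov.exists_extension h.degree_le (properOn_empty (H := H) fun _ => x)
    (r := r) (by simp) (fun a _ => by rw [SimpleGraph.away_empty]; exact h.preconnected a r)
  exact ⟨c, hc⟩

/-- Prescribe `x` and leave a hole at another vertex of `e`: there `e` must forbid some colour, and
it does so through an edge of its matching containing `x`. Hence the matchings are perfect. -/
theorem exists_edge (h : UncolorableBlock G H p M) {x : C} {e : E} (hx : p x ∈ G.inc e) :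
    ∃ f ∈ M e, x ∈ H.inc f := by
  obtain ⟨r, hr, hne⟩ := G.exists_mem_ne e (p x)
  obtain ⟨c, hc, hcx⟩ := h.exists_coloring_of_color x hne
  obtain ⟨y, -, -, f, hf, -, hall⟩ :=
    (h.cov.hole (h.degree_le r) h.not_colorable hc).2.1 e hr
  exact ⟨f, hf, hcx ▸ hall _ hx hne.symm⟩

/-- Prescribe `x` and leave a hole at `p y`. Both `e` and `e'` forbid a colour there, through the
edge of their matching containing `x`, hence both forbid `y`; but different edges forbid different
colours. -/
theorem edge_unique (h : UncolorableBlock G H p M) {e e' : E} {f f' : F} {x y : C} (hf : f ∈ M e)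
    (hf' : f' ∈ M e') (hx : x ∈ H.inc f) (hx' : x ∈ H.inc f') (hy : y ∈ H.inc f)
    (hy' : y ∈ H.inc f') (hxy : x ≠ y) : e = e' ∧ f = f' := by
  suffices e = e' by subst this; exact ⟨rfl, h.cov.matching hf hf' hx hx'⟩
  have hne : p y ≠ p x := fun hp => hxy ((h.cov.bijOn hf).injOn hx hy hp.symm)
  obtain ⟨c, hc, hcx⟩ := h.exists_coloring_of_color x hne
  have hole := h.cov.hole (h.degree_le _) h.not_colorable hc
  have key : ∀ {e f}, f ∈ M e → x ∈ H.inc f → y ∈ H.inc f → Blocks G H M c (p y) e y := by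
    intro e f hf hx hy
    obtain ⟨y₁, hy₁, hb⟩ := hole.2.1 e ((h.cov.bijOn hf).mapsTo hy)
    obtain ⟨hm, f₁, hf₁, hyf, hall⟩ := hb
    have hxf := hall _ ((h.cov.bijOn hf).mapsTo hx) hne.symm
    rw [hcx] at hxf
    obtain rfl := h.cov.matching hf hf₁ hx hxf
    exact ⟨hm, f, hf, hy, hall⟩
  exact hole.2.2.1 y e e' rfl (key hf hx hy) (key hf' hx' hy')

theorem degree_eq [Nonempty C] (h : UncolorableBlock G H p M) (r : V) :
    G.degree r = (p ⁻¹' {r}).ncard := by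
  obtain ⟨c, hc⟩ := h.exists_coloring r
  exact (h.cov.hole (h.degree_le r) h.not_colorable hc).2.2.2

/-- Sending a colour of `r` to the edge of the perfect matching containing it is a bijection. The
right-hand side does not depend on `r`, so fibre sizes are constant along edges. -/
theorem ncard_fiber (h : UncolorableBlock G H p M) {e : E} {r : V} (hr : r ∈ G.inc e) :
    (p ⁻¹' {r}).ncard = (M e).ncard := by
  have h1 : ∀ x : p ⁻¹' {r}, ∃ f : M e, x.1 ∈ H.inc f := by
    rintro ⟨x, rfl⟩
    obtain ⟨f, hf, hx⟩ := h.exists_edge hr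
    exact ⟨⟨f, hf⟩, hx⟩
  choose g hg using h1
  have hbij : Function.Bijective g := by
    constructor
    · intro x y hxy
      refine Subtype.ext ((h.cov.bijOn (g x).2).injOn (hg x) (hxy ▸ hg y) ?_)
      exact x.2.trans y.2.symm
    · rintro ⟨f, hf⟩
      obtain ⟨x, hx, hxr⟩ := (h.cov.bijOn hf).surjOn hr
      exact ⟨⟨x, hxr⟩, Subtype.ext (h.cov.matching (g ⟨x, hxr⟩).2 hf (hg ⟨x, hxr⟩) hx)⟩
  rw [← Nat.card_coe_set_eq, ← Nat.card_coe_set_eq, Nat.card_congr (Equiv.ofBijective g hbij)]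

theorem ncard_fiber_eq (h : UncolorableBlock G H p M) (a b : V) :
    (p ⁻¹' {a}).ncard = (p ⁻¹' {b}).ncard := by
  refine (h.preconnected a b).head_induction
    (P := fun a => (p ⁻¹' {a}).ncard = (p ⁻¹' {b}).ncard) rfl ?_
  rintro x y ⟨-, e, hx, hy⟩ - ih
  rw [← ih, h.ncard_fiber hx, h.ncard_fiber hy]

/-- In a block with a vertex of degree at least two, all edges are ordinary. -/
theorem not_three_le [Nonempty C] (h : UncolorableBlock G H p M) {e e₂ : E} {r : V}
    (hr : r ∈ G.inc e) (hr₂ : r ∈ G.inc e₂) (hne : e₂ ≠ e) : ¬ 3 ≤ (G.inc e).ncard := by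
  classical
  intro h3
  obtain ⟨c, hc⟩ := h.exists_coloring r
  have hole := h.cov.hole (h.degree_le r) h.not_colorable hc
  obtain ⟨x₂, hx₂, hb₂⟩ := hole.2.1 e₂ hr₂
  obtain ⟨x₁, hx₁, -, f, hf, hxf, hall⟩ := hole.2.1 e hr
  have hx₂f : x₂ ∉ H.inc f := fun hx => hne (hole.2.2.1 x₂ e₂ e hx₂ hb₂ ⟨hr, f, hf, hx, hall⟩)
  obtain ⟨w, hw, hwr⟩ := G.exists_mem_ne e r
  obtain ⟨u₂, hu₂, hur⟩ := G.exists_mem_ne e₂ r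
  -- When the hole lies in `e`, a third vertex of `e` still has its colour in `f`, so `e` can forbid
  -- a colour only through `f`. But `r` now has the colour `x₂`, which is not in `f`.
  have inE : ∀ u c₁, u ∈ G.inc e → u ≠ r → ProperOn H p {u}ᶜ c₁ → c₁ r = x₂ →
      (∀ a ∈ G.inc e, a ≠ r → a ≠ u → c₁ a ∈ H.inc f) → False := by
    intro u c₁ hu hur hc₁ hc₁r hall₁
    obtain ⟨y, -, -, f', hf', -, hall'⟩ :=
      (h.cov.hole (h.degree_le u) h.not_colorable hc₁).2.1 e hu
    obtain ⟨b, hb, hbr⟩ : ∃ b ∈ G.inc e, b ∉ ({r, u} : Set V) := by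
      by_contra hno
      push Not at hno
      have := Set.ncard_le_ncard hno (Set.toFinite _)
      rw [Set.ncard_pair hur.symm] at this
      omega
    simp only [Set.mem_insert_iff, Set.mem_singleton_iff, not_or] at hbr
    obtain rfl := h.cov.matching hf hf' (hall₁ b hb hbr.1 hbr.2) (hall' b hb hbr.2)
    exact hx₂f (hc₁r ▸ hall' r hr hur.symm)
  -- The hole is moved from `u₂` towards `w` without passing through `r`. As long as it is outside
  -- `e`, the colours on `e` do not change, so it eventually enters `e` in the situation excluded by
  -- `inE`.
  have key : u₂ ≠ r → ∀ c₁, ProperOn H p {u₂}ᶜ c₁ → c₁ r = x₂ →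
      (∀ a ∈ G.inc e, a ≠ r → a ≠ u₂ → c₁ a ∈ H.inc f) → False := by
    refine (h.noCutVertex r u₂ w hur hwr).head_induction
      (P := fun u => u ≠ r → ∀ c₁, ProperOn H p {u}ᶜ c₁ → c₁ r = x₂ →
        (∀ a ∈ G.inc e, a ≠ r → a ≠ u → c₁ a ∈ H.inc f) → False) ?_ ?_
    · intro hwr c₁
      exact inE w c₁ hw hwr
    · rintro u y ⟨⟨huy, e', hue, hye⟩, -, hyr⟩ - ih hur c₁ hc₁ hc₁r hall₁
      by_cases hu : u ∈ G.inc e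
      · exact inE u c₁ hu hur hc₁ hc₁r hall₁
      · obtain ⟨z, hz, hbz⟩ := (h.cov.hole (h.degree_le u) h.not_colorable hc₁).2.1 e' hue
        refine ih hyr _ (h.cov.properOn_shift (h.degree_le u) h.not_colorable hc₁ hz hbz hye
          huy.symm) (by rwa [Function.update_of_ne hur.symm]) fun a ha har _ => ?_
        have hau : a ≠ u := fun h => hu (h ▸ ha)
        rw [Function.update_of_ne hau]
        exact hall₁ a ha har hau
  refine key hur _ (h.cov.properOn_shift (h.degree_le r) h.not_colorable hc hx₂ hb₂ hu₂ hur)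
    (by simp) fun a ha har _ => ?_
  rw [Function.update_of_ne har]
  exact hall a ha har

/-- If no vertex lies in two edges, connectedness leaves only one edge. Then all degrees, and hence
all fibres, have size one, and `p` itself is the isomorphism. -/
theorem isEConfiguration [Nonempty C] (h : UncolorableBlock G H p M)
    (h1 : ∀ r e e', r ∈ G.inc e → r ∈ G.inc e' → e = e') (e : E) :
    IsEConfiguration G (fun a => p ⁻¹' {a}) H := by
  have he : ∀ a, a ∈ G.inc e := by
    intro a
    obtain ⟨b, hb, -⟩ := G.exists_mem_ne e a
    refine (h.preconnected a b).head_induction (P := fun a => a ∈ G.inc e) hb ?_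
    rintro x y ⟨-, e', hx, hy⟩ - ih
    rwa [h1 y e e' ih hy]
  have hE : ∀ e', e' = e := by
    intro e'
    obtain ⟨a, ha⟩ := Set.nonempty_of_ncard_ne_zero
      (by have := G.two_le_ncard_inc e'; omega : (G.inc e').ncard ≠ 0)
    exact h1 a e' e ha (he a)
  have hcard : ∀ a, (p ⁻¹' {a}).ncard = 1 := by
    intro a
    rw [← h.degree_eq a, MultiHypergraph.degree, Set.ncard_eq_one]
    exact ⟨e, by ext e'; simp [hE e', he a]⟩
  have hp : Function.Bijective p := by
    constructor
    · intro x y hxy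
      obtain ⟨z, hz⟩ := Set.ncard_eq_one.1 (hcard (p y))
      have hx : x ∈ p ⁻¹' {p y} := hxy
      have hy : y ∈ p ⁻¹' {p y} := rfl
      rw [hz] at hx hy
      exact hx.trans hy.symm
    · intro a
      obtain ⟨z, hz⟩ := Set.ncard_eq_one.1 (hcard a)
      have : z ∈ p ⁻¹' {a} := hz ▸ rfl
      exact ⟨z, this⟩
  obtain ⟨x⟩ := ‹Nonempty C›
  obtain ⟨f, hf, hxf⟩ := h.exists_edge (he (p x))
  have hF : ∀ f', f' ∈ M e := fun f' => by
    obtain ⟨e', he'⟩ := h.cov.exists_mem f'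
    rwa [hE e'] at he'
  have hall : ∀ f' y, y ∈ H.inc f' := by
    intro f' y
    obtain ⟨y', hy', hyy⟩ := (h.cov.bijOn (hF f')).surjOn (he (p y))
    rwa [← hp.injective hyy]
  have hFe : ∀ f', f' = f := fun f' => h.cov.matching (hF f') hf (hall f' x) (hall f x)
  refine ⟨h.cov.isCover, ⟨e, by ext a; simp [he], hE⟩, hcard, Equiv.ofBijective p hp,
    ⟨fun _ => e, fun _ => f, fun _ => (hFe _).symm, fun _ => (hE _).symm⟩, fun f' => ?_⟩
  exact (h.cov.bijOn (hF f')).image_eq.symm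

end UncolorableBlock

end

end DPColoring

/-! ### Ordinary edges: transitivity and K-configurations -/

namespace DPColoring

open MultiHypergraph

section

variable {V : Type u} {E : Type v} {C : Type w} {F : Type z}

/-- Two colours are joined by an ordinary edge of the cover. -/
def Nb (H : MultiHypergraph C F) (x y : C) : Prop := ∃ f, H.inc f = {x, y}

theorem Nb.symm {H : MultiHypergraph C F} {x y : C} (h : Nb H x y) : Nb H y x := by
  obtain ⟨f, hf⟩ := h
  exact ⟨f, hf.trans (Set.pair_comm x y)⟩

theorem Nb.ne {H : MultiHypergraph C F} {x y : C} (h : Nb H x y) : x ≠ y := by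
  obtain ⟨f, hf⟩ := h
  rintro rfl
  have := H.two_le_ncard_inc f
  simp [hf] at this

/-- The neighbours of a colour among the colours of the vertex `a`. -/
def nbSet (H : MultiHypergraph C F) (p : C → V) (a : V) (x : C) : Set C := {y | p y = a ∧ Nb H x y}

/-- The number of ordinary edges joining `a` and `b`. -/
noncomputable def MultiHypergraph.mult (G : MultiHypergraph V E) (a b : V) : ℕ :=
  {e | G.inc e = {a, b}}.ncard

theorem MultiHypergraph.mult_comm (G : MultiHypergraph V E) (a b : V) :
    G.mult a b = G.mult b a := by
  rw [mult, mult, Set.pair_comm]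

/-- An uncolorable block all of whose edges have exactly two vertices. -/
structure OrdinaryBlock (G : MultiHypergraph V E) (H : MultiHypergraph C F) (p : C → V)
    (M : E → Set F) : Prop extends UncolorableBlock G H p M where
  ncard_inc : ∀ e, (G.inc e).ncard = 2

variable {G : MultiHypergraph V E} {H : MultiHypergraph C F} {p : C → V} {M : E → Set F}

namespace OrdinaryBlock

theorem inc_eq (h : OrdinaryBlock G H p M) {e : E} {a b : V} (ha : a ∈ G.inc e) (hb : b ∈ G.inc e)
    (hab : a ≠ b) : G.inc e = {a, b} := by
  refine (Set.eq_of_subset_of_ncard_le ?_ ?_ ?_).symm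
  · rintro x (rfl | rfl) <;> assumption
  · rw [h.ncard_inc, Set.ncard_pair hab]
  · exact Set.finite_of_ncard_ne_zero (by rw [h.ncard_inc]; simp)

theorem ncard_cover_inc (h : OrdinaryBlock G H p M) (f : F) : (H.inc f).ncard = 2 := by
  obtain ⟨e, he⟩ := h.cov.exists_mem f
  rw [← h.ncard_inc e, ← (h.cov.bijOn he).image_eq, (h.cov.bijOn he).injOn.ncard_image]

theorem inc_of_mem (h : OrdinaryBlock G H p M) {e : E} {f : F} {x y : C} (hf : f ∈ M e)
    (hxy : H.inc f = {x, y}) : G.inc e = {p x, p y} := by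
  rw [← (h.cov.bijOn hf).image_eq, hxy, Set.image_pair]

theorem p_ne (h : OrdinaryBlock G H p M) {x y : C} (hxy : Nb H x y) : p x ≠ p y := by
  obtain ⟨f, hf⟩ := hxy
  obtain ⟨e, he⟩ := h.cov.exists_mem f
  intro hp
  have := h.ncard_inc e
  simp [h.inc_of_mem he hf, hp] at this

theorem exists_ordinary (h : OrdinaryBlock G H p M) {x y : C} (hxy : Nb H x y) :
    ∃ e, G.inc e = {p x, p y} := by
  obtain ⟨f, hf⟩ := hxy
  obtain ⟨e, he⟩ := h.cov.exists_mem f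
  exact ⟨e, h.inc_of_mem he hf⟩

theorem adj (h : OrdinaryBlock G H p M) {x y : C} (hxy : Nb H x y) : G.Adj (p x) (p y) := by
  obtain ⟨e, he⟩ := h.exists_ordinary hxy
  exact ⟨h.p_ne hxy, e, by simp [he], by simp [he]⟩

theorem adj_iff (h : OrdinaryBlock G H p M) {a b : V} :
    G.Adj a b ↔ a ≠ b ∧ ∃ e, G.inc e = {a, b} := by
  constructor
  · rintro ⟨hab, e, ha, hb⟩
    exact ⟨hab, e, h.inc_eq ha hb hab⟩
  · rintro ⟨hab, e, he⟩
    exact ⟨hab, e, by simp [he], by simp [he]⟩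

theorem ordAdj_iff (h : OrdinaryBlock G H p M) {a b : V} : G.OrdAdj a b ↔ G.Adj a b := by
  rw [h.adj_iff]
  refine ⟨fun ⟨e, he⟩ => ⟨?_, e, he⟩, fun h => h.2⟩
  rintro rfl
  have := h.ncard_inc e
  simp [he] at this

theorem exists_pair (h : OrdinaryBlock G H p M) (f : F) : ∃ x y, H.inc f = {x, y} ∧ Nb H x y := by
  obtain ⟨x, y, -, hf⟩ := Set.ncard_eq_two.1 (h.ncard_cover_inc f)
  exact ⟨x, y, hf, f, hf⟩

theorem existsUnique_edge (h : OrdinaryBlock G H p M) {x y : C} (hxy : Nb H x y) :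
    ∃! f, H.inc f = {x, y} := by
  obtain ⟨f, hf⟩ := hxy
  refine ⟨f, hf, fun f' hf' => ?_⟩
  obtain ⟨e, he⟩ := h.cov.exists_mem f
  obtain ⟨e', he'⟩ := h.cov.exists_mem f'
  exact (h.edge_unique he' he (x := x) (y := y) (by simp [hf']) (by simp [hf]) (by simp [hf'])
    (by simp [hf]) (Nb.ne ⟨f, hf⟩)).2

/-- Each of the parallel edges contributes one neighbour of `x` because its matching is perfect, and
by `edge_unique` these neighbours are distinct. -/
theorem ncard_nbSet (h : OrdinaryBlock G H p M) {x : C} {b : V} (hb : p x ≠ b) :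
    (nbSet H p b x).ncard = G.mult (p x) b := by
  have h1 : ∀ e : {e | G.inc e = {p x, b}}, ∃ y : nbSet H p b x, ∃ f ∈ M e, H.inc f = {x, y.1} := by
    rintro ⟨e, he⟩
    obtain ⟨f, hf, hx⟩ := h.exists_edge (x := x) (e := e) (by simp [show G.inc e = _ from he])
    obtain ⟨y, hy, hyb⟩ := (h.cov.bijOn hf).surjOn (show b ∈ G.inc e by simp [show G.inc e = _ from he])
    have hxy : x ≠ y := by rintro rfl; exact hb hyb
    have hf2 : H.inc f = {x, y} := by
      refine (Set.eq_of_subset_of_ncard_le ?_ ?_ ?_).symm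
      · rintro z (rfl | rfl) <;> assumption
      · rw [h.ncard_cover_inc, Set.ncard_pair hxy]
      · exact Set.finite_of_ncard_ne_zero (by rw [h.ncard_cover_inc]; simp)
    exact ⟨⟨y, hyb, f, hf2⟩, f, hf, hf2⟩
  choose g hg using h1
  have hbij : Function.Bijective g := by
    constructor
    · intro e e' hee
      obtain ⟨f, hf, hxy⟩ := hg e
      obtain ⟨f', hf', hxy'⟩ := hg e'
      rw [← hee] at hxy'
      refine Subtype.ext (h.edge_unique hf hf' (x := x) (y := (g e).1) ?_ ?_ ?_ ?_ ?_).1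
      · simp [hxy]
      · simp [hxy']
      · simp [hxy]
      · simp [hxy']
      · exact Nb.ne ⟨f, hxy⟩
    · rintro ⟨y, hy, f, hf⟩
      obtain ⟨e, he⟩ := h.cov.exists_mem f
      have hinc : G.inc e = {p x, b} := by rw [h.inc_of_mem he hf, hy]
      refine ⟨⟨e, hinc⟩, Subtype.ext ?_⟩
      obtain ⟨f', hf', hxy'⟩ := hg ⟨e, hinc⟩
      obtain rfl := h.cov.matching (x := x) hf' he (by simp [hxy']) (by simp [hf])
      have hgm : (g ⟨e, hinc⟩).1 ∈ ({x, y} : Set C) := by rw [← hf, hxy']; simp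
      rcases hgm with h1 | h1
      · exact absurd h1 (Nb.ne ⟨f', hxy'⟩).symm
      · exact h1
  rw [mult, ← Nat.card_coe_set_eq, ← Nat.card_coe_set_eq, Nat.card_congr (Equiv.ofBijective g hbij)]

theorem mult_pos (h : OrdinaryBlock G H p M) {a b : V} (hab : G.Adj a b) : 0 < G.mult a b := by
  have := G.finite_edges
  obtain ⟨-, e, he⟩ := h.adj_iff.1 hab
  rw [mult, Set.ncard_pos (Set.toFinite _)]
  exact ⟨e, he⟩

theorem exists_nb (h : OrdinaryBlock G H p M) (x : C) {b : V} (hab : G.Adj (p x) b) :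
    ∃ y, p y = b ∧ Nb H x y := by
  have h1 := h.mult_pos hab
  rw [← h.ncard_nbSet hab.1] at h1
  exact Set.nonempty_of_ncard_ne_zero h1.ne'

theorem properOn_iff (h : OrdinaryBlock G H p M) {A : Set V} {c : V → C} :
    ProperOn H p A c ↔ (∀ a ∈ A, p (c a) = a) ∧ ∀ a ∈ A, ∀ b ∈ A, ¬ Nb H (c a) (c b) := by
  refine and_congr_right fun hA => ⟨?_, ?_⟩
  · rintro hc a ha b hb ⟨f, hf⟩
    refine hc f ?_
    rw [hf]
    rintro x (rfl | rfl)
    · exact ⟨a, ha, rfl⟩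
    · exact ⟨b, hb, rfl⟩
  · intro hc f hf
    obtain ⟨x, y, hxy, hn⟩ := h.exists_pair f
    rw [hxy] at hf
    obtain ⟨a, ha, rfl⟩ := hf (Set.mem_insert x _)
    obtain ⟨b, hb, rfl⟩ := hf (Set.mem_insert_of_mem _ rfl)
    exact hc a ha b hb hn

theorem hole (h : OrdinaryBlock G H p M) {r : V} {c : V → C} (hc : ProperOn H p {r}ᶜ c) :
    (∀ x, p x = r → ∃ u, u ≠ r ∧ Nb H (c u) x) ∧
      ∀ x u u', p x = r → u ≠ r → u' ≠ r → Nb H (c u) x → Nb H (c u') x → u = u' := by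
  have hole := h.cov.hole (h.degree_le r) h.not_colorable hc
  have hpc : ∀ a, a ≠ r → p (c a) = a := hc.1
  constructor
  · intro x hx
    obtain ⟨e, hr, f, hf, hxf, hall⟩ := hole.1 x hx
    obtain ⟨u, hu, hur⟩ := G.exists_mem_ne e r
    refine ⟨u, hur, f, (Set.eq_of_subset_of_ncard_le ?_ ?_ ?_).symm⟩
    · rintro z (rfl | rfl)
      · exact hall u hu hur
      · exact hxf
    · rw [h.ncard_cover_inc, Set.ncard_pair]
      intro heq
      apply hur
      rw [← hpc u hur, heq, hx]
    · exact Set.finite_of_ncard_ne_zero (by rw [h.ncard_cover_inc]; simp)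
  · intro x u u' hx hu hu' hn hn'
    have key : ∀ u, u ≠ r → Nb H (c u) x → ∃ e, Blocks G H M c r e x ∧ G.inc e = {u, r} := by
      rintro u hu ⟨f, hf⟩
      obtain ⟨e, he⟩ := h.cov.exists_mem f
      have hinc := h.inc_of_mem he hf
      rw [hpc u hu, hx] at hinc
      refine ⟨e, ⟨by simp [hinc], f, he, by simp [hf], fun a ha har => ?_⟩, hinc⟩
      rw [hinc] at ha
      rcases ha with rfl | ha
      · simp [hf]
      · exact absurd ha har
    obtain ⟨e, hb, hinc⟩ := key u hu hn
    obtain ⟨e', hb', hinc'⟩ := key u' hu' hn'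
    obtain rfl := hole.2.2.1 x e e' hx hb hb'
    have : u ∈ ({u', r} : Set V) := by rw [← hinc', hinc]; simp
    rcases this with h | h
    · exact h
    · exact absurd h hu

theorem p_surjective [Nonempty C] (h : OrdinaryBlock G H p M) (a : V) : ∃ x, p x = a := by
  have := H.finite_vertices
  obtain ⟨x⟩ := ‹Nonempty C›
  have h1 := h.ncard_fiber_eq a (p x)
  have h2 : 0 < (p ⁻¹' {p x}).ncard := (Set.ncard_pos (Set.toFinite _)).2 ⟨x, rfl⟩
  rw [← h1] at h2
  exact Set.nonempty_of_ncard_ne_zero h2.ne'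

theorem exists_coloring_of_pair (h : OrdinaryBlock G H p M) {x y : C} (hp : p x ≠ p y)
    (hn : ¬ Nb H x y) {r : V} (hr : r ∉ ({p x, p y} : Set V))
    (hreach : ∀ a, a ∉ ({p x, p y} : Set V) → (G.adjGraph.away {p x, p y}).Reachable a r) :
    ∃ c, ProperOn H p {r}ᶜ c ∧ c (p x) = x ∧ c (p y) = y := by
  classical
  obtain ⟨c, hc, hxy⟩ := h.cov.exists_extension h.degree_le (A := {p x, p y})
    (c := fun a => if a = p x then x else y) (r := r) (by
      rw [h.properOn_iff]
      constructor
      · rintro a (rfl | rfl)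
        · simp
        · simp [hp.symm]
      · rintro a (rfl | rfl) b (rfl | rfl)
        · simpa using fun h => Nb.ne h rfl
        · simpa [hp.symm] using hn
        · simpa [hp.symm] using fun h => hn (Nb.symm h)
        · simpa using fun h => Nb.ne h rfl) hr hreach
  refine ⟨c, hc, ?_, ?_⟩
  · simpa using hxy (p x) (by simp)
  · simpa [hp.symm] using hxy (p y) (by simp)

/-- Otherwise a colour `x` of `v` has neighbours at `u` and `w` that can both be prescribed, with
the hole at `v`. Then `x` is forbidden twice. -/
theorem neighborsSeparate [Nonempty C] (h : OrdinaryBlock G H p M) :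
    G.adjGraph.NeighborsSeparate := by
  intro v u w huw hnadj hvu hvw
  refine ⟨huw, hnadj, ?_⟩
  by_contra hno
  push Not at hno
  obtain ⟨x, rfl⟩ := h.p_surjective v
  obtain ⟨y, rfl, hy⟩ := h.exists_nb x hvu
  obtain ⟨z, rfl, hz⟩ := h.exists_nb x hvw
  have hr : p x ∉ ({p y, p z} : Set V) := by
    simp [h.p_ne hy, h.p_ne hz]
  obtain ⟨c, hc, hcy, hcz⟩ := h.exists_coloring_of_pair huw (fun hn => hnadj (h.adj hn)) hr
    (fun a ha => hno a (p x) ha hr)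
  exact huw ((h.hole hc).2 x (p y) (p z) rfl (h.p_ne hy).symm (h.p_ne hz).symm
    (by rw [hcy]; exact hy.symm) (by rw [hcz]; exact hz.symm))

theorem inducesCompleteMultipartite (h : OrdinaryBlock G H p M) {ι : Type*} {P : ι → Set C}
    {v : ι → V} (hv : Function.Injective v) {t : ℕ} (hP : ∀ i, ∀ x ∈ P i, p x = v i)
    (ht : ∀ i, (P i).ncard = t) (hnb : ∀ i j, i ≠ j → ∀ x ∈ P i, ∀ y ∈ P j, Nb H x y) :
    H.InducesCompleteMultipartite P t := by
  refine ⟨ht, fun i j hij => Set.disjoint_left.2 fun x hx hx' => hij (hv ?_), fun f hf => ?_,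
    fun i j hij x hx y hy => h.existsUnique_edge (hnb i j hij x hx y hy)⟩
  · rw [← hP i x hx, hP j x hx']
  · obtain ⟨x, y, hxy, hn⟩ := h.exists_pair f
    have hx := hf (show x ∈ H.inc f by simp [hxy])
    have hy := hf (show y ∈ H.inc f by simp [hxy])
    simp only [Set.mem_iUnion] at hx hy
    obtain ⟨i, hi⟩ := hx
    obtain ⟨j, hj⟩ := hy
    refine ⟨i, j, ?_, x, hi, y, hj, hxy⟩
    rintro rfl
    exact h.p_ne hn ((hP i x hi).trans (hP i y hj).symm)

theorem inducesKtt (h : OrdinaryBlock G H p M) {A B : Set C} {a b : V} (hab : a ≠ b) {t : ℕ}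
    (hA : ∀ x ∈ A, p x = a) (hB : ∀ x ∈ B, p x = b) (htA : A.ncard = t) (htB : B.ncard = t)
    (hnb : ∀ x ∈ A, ∀ y ∈ B, Nb H x y) : H.InducesKtt A B t := by
  refine h.inducesCompleteMultipartite (v := ![a, b]) ?_ ?_ ?_ ?_
  · intro i j
    fin_cases i <;> fin_cases j <;> simp [hab, hab.symm]
  · intro i
    fin_cases i
    · simpa using hA
    · simpa using hB
  · intro i
    fin_cases i
    · simpa using htA
    · simpa using htB
  · intro i j hij
    fin_cases i <;> fin_cases j
    · simp at hij
    · simpa using hnb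
    · simpa using fun x hx y hy => (hnb y hy x hx).symm
    · simp at hij

/-- If `x` and `z` were nonadjacent, they could be prescribed together with the hole at `p y`,
because a complete graph stays connected. Then `y` would be forbidden twice. -/
theorem nb_trans (h : OrdinaryBlock G H p M) (hc : ∀ a b, a ≠ b → G.Adj a b) {x y z : C}
    (hxy : Nb H x y) (hyz : Nb H y z) (hxz : p x ≠ p z) : Nb H x z := by
  by_contra hn
  have hr : p y ∉ ({p x, p z} : Set V) := by simp [(h.p_ne hxy).symm, h.p_ne hyz]
  obtain ⟨c, hc, hcx, hcz⟩ := h.exists_coloring_of_pair hxz hn hr (fun a ha => by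
    by_cases hay : a = p y
    · rw [hay]
    · exact SimpleGraph.Adj.reachable ⟨hc _ _ hay, ha, hr⟩)
  exact hxz ((h.hole hc).2 y (p x) (p z) rfl (h.p_ne hxy) (h.p_ne hyz).symm
    (by rwa [hcx]) (by rw [hcz]; exact hyz.symm))

/-- `nb_trans` through `y` settles all `w` at vertices other than `p y`; the remaining `w` are
reached by a detour through a third vertex. Colours of one vertex with a common neighbour are
therefore twins. -/
theorem nb_of_common (h : OrdinaryBlock G H p M) (hc : ∀ a b, a ≠ b → G.Adj a b) {x x' y w : C}
    (hp : p x = p x') (hxy : Nb H x y) (hxy' : Nb H x' y) (hw : Nb H x w) : Nb H x' w := by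
  have : Nonempty C := ⟨x⟩
  have first : ∀ w, p w ≠ p y → Nb H x w → Nb H x' w := by
    intro w hwy hw
    have h1 := h.nb_trans hc hw.symm hxy hwy
    exact (h.nb_trans hc h1 hxy'.symm (by rw [← hp]; exact (h.p_ne hw).symm)).symm
  by_cases hwy : p w = p y
  · by_cases hthird : ∃ a, a ≠ p x ∧ a ≠ p y
    · obtain ⟨a, hax, hay⟩ := hthird
      obtain ⟨z, rfl, hz⟩ := h.exists_nb x (hc _ _ hax.symm)
      have h1 := first z hay hz
      have h2 := h.nb_trans hc hw.symm hz (by rw [hwy]; exact hay.symm)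
      exact (h.nb_trans hc h2 h1.symm (by rw [← hp]; exact (h.p_ne hw).symm)).symm
    -- With only two vertices, all edges at `p x'` lead to `p y`, so by counting `x'` is adjacent to
    -- every colour of `p y`.
    · push Not at hthird
      have hne := h.p_ne hxy'
      have hdeg : G.degree (p x') = G.mult (p x') (p y) := by
        rw [MultiHypergraph.degree, mult]
        congr 1
        ext e
        refine ⟨fun he => ?_, fun he => by simp [show G.inc e = _ from he]⟩
        obtain ⟨b, hb, hbx⟩ := G.exists_mem_ne e (p x')
        have : b = p y := hthird b (by rw [hp]; exact hbx)
        exact h.inc_eq he (this ▸ hb) hne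
      have h1 := h.ncard_nbSet hne
      rw [← hdeg, h.degree_eq, h.ncard_fiber_eq _ (p y)] at h1
      have hfin := H.finite_vertices
      have h2 : nbSet H p (p y) x' = p ⁻¹' {p y} :=
        Set.eq_of_subset_of_ncard_le (fun z hz => hz.1) h1.ge (Set.toFinite _)
      have : w ∈ nbSet H p (p y) x' := by rw [h2]; exact hwy
      exact this.2
  · exact first w hwy hw

/-- Twin classes at one vertex `a₀` are indexed by the other vertices, using a colouring with a hole
at `a₀`; transitivity carries them to all vertices. -/
theorem isKConfiguration [Nonempty C] (h : OrdinaryBlock G H p M)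
    (hc : ∀ a b, a ≠ b → G.Adj a b) {a₀ b₀ : V} (hab₀ : a₀ ≠ b₀) :
    IsKConfiguration G (fun a => p ⁻¹' {a}) H := by
  classical
  have hfin := G.finite_vertices
  -- constant multiplicity
  have hmult1 : ∀ u v w, u ≠ v → u ≠ w → G.mult u v = G.mult u w := by
    intro u v w huv huw
    by_cases hvw : v = w
    · rw [hvw]
    obtain ⟨x, rfl⟩ := h.p_surjective v
    obtain ⟨z, rfl, hz⟩ := h.exists_nb x (hc _ _ hvw)
    rw [mult_comm, mult_comm _ _ (p z), ← h.ncard_nbSet huv.symm, ← h.ncard_nbSet huw.symm]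
    congr 1
    ext y
    constructor
    · rintro ⟨rfl, hy⟩
      exact ⟨rfl, h.nb_trans hc hz.symm hy huw.symm⟩
    · rintro ⟨rfl, hy⟩
      exact ⟨rfl, h.nb_trans hc hz hy huv.symm⟩
  obtain ⟨t, ht⟩ : ∃ t, ∀ a b, a ≠ b → G.mult a b = t := by
    refine ⟨G.mult b₀ a₀, fun a b hab => ?_⟩
    by_cases hab₁ : a = b₀
    · subst hab₁
      exact hmult1 _ _ _ hab hab₀.symm
    · rw [hmult1 a b b₀ hab hab₁, mult_comm]
      exact hmult1 _ _ _ (Ne.symm hab₁) hab₀.symm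
  -- Each colour of `a₀` is adjacent to the chosen colour of exactly one other vertex. This
  -- partitions the colours of `a₀` into one class for each other vertex, and `ξ` picks
  -- representatives.
  obtain ⟨c, hcol⟩ := h.exists_coloring a₀
  have hole := h.hole hcol
  have hpc : ∀ a, a ≠ a₀ → p (c a) = a := hcol.1
  have hx : ∀ u : {u // u ≠ a₀}, ∃ x, p x = a₀ ∧ Nb H (c u) x := by
    rintro ⟨u, hu⟩
    exact h.exists_nb (c u) (by rw [hpc u hu]; exact hc _ _ hu)
  choose ξ hξ using hx
  have hcard : Nat.card {u // u ≠ a₀} = Nat.card V - 1 := by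
    have := Fintype.ofFinite V
    rw [Nat.card_eq_fintype_card, Nat.card_eq_fintype_card, Fintype.card_subtype_compl]
    simp
  let σ : Fin (Nat.card V - 1) ≃ {u // u ≠ a₀} := (Finite.equivFinOfCardEq hcard).symm
  -- Away from `a₀`, the class with index `i` consists of the neighbours of the representative `ξ (σ
  -- i)`; it does not depend on the representative because the colours of a class at `a₀` are twins.
  let P : V → Fin (Nat.card V - 1) → Set C := fun a i =>
    if a = a₀ then nbSet H p a (c (σ i)) else nbSet H p a (ξ (σ i))
  have hP₀ : ∀ i x, x ∈ P a₀ i ↔ p x = a₀ ∧ Nb H (c (σ i)) x := by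
    intro i x; simp [P, nbSet]
  have hP₁ : ∀ i a x, a ≠ a₀ → (x ∈ P a i ↔ p x = a ∧ Nb H (ξ (σ i)) x) := by
    intro i a x ha; simp [P, nbSet, ha]
  have hPp : ∀ a i, ∀ x ∈ P a i, p x = a := by
    intro a i x hx
    by_cases ha : a = a₀
    · subst ha; exact ((hP₀ i x).1 hx).1
    · exact ((hP₁ i a x ha).1 hx).1
  have hσ : ∀ i, (σ i).1 ≠ a₀ := fun i => (σ i).2
  -- two colours of `a₀` in the same class have the same neighbours
  have hcls : ∀ i x y, p x = a₀ → Nb H (c (σ i)) x → (Nb H x y ↔ Nb H (ξ (σ i)) y) := by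
    intro i x y hx hn
    have hh := hξ (σ i)
    exact ⟨fun hy => h.nb_of_common hc (hx.trans hh.1.symm) hn.symm hh.2.symm hy,
      fun hy => h.nb_of_common hc (hh.1.trans hx.symm) hh.2.symm hn.symm hy⟩
  have hdisj₀ : ∀ i j x, p x = a₀ → Nb H (c (σ i)) x → Nb H (c (σ j)) x → i = j := by
    intro i j x hx hi hj
    exact σ.injective (Subtype.ext (hole.2 x _ _ hx (hσ i) (hσ j) hi hj))
  have hex₀ : ∀ x, p x = a₀ → ∃ i, Nb H (c (σ i)) x := by
    intro x hx
    obtain ⟨u, hu, hn⟩ := hole.1 x hx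
    exact ⟨σ.symm ⟨u, hu⟩, by simpa using hn⟩
  have hn : 2 ≤ Nat.card V := by
    have : Nontrivial V := ⟨a₀, b₀, hab₀⟩
    exact Finite.one_lt_card
  have hcover : ∀ a x, p x = a → ∃ i, x ∈ P a i := by
    intro a x hx
    by_cases ha : a = a₀
    · subst ha
      obtain ⟨i, hi⟩ := hex₀ x hx
      exact ⟨i, (hP₀ i x).2 ⟨hx, hi⟩⟩
    · obtain ⟨y, hy, hxy⟩ := h.exists_nb x (b := a₀) (by rw [hx]; exact hc _ _ ha)
      obtain ⟨i, hi⟩ := hex₀ y hy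
      exact ⟨i, (hP₁ i a x ha).2 ⟨hx, (hcls i y x hy hi).1 hxy.symm⟩⟩
  refine ⟨h.cov.isCover, t, Nat.card V, ?_, by omega, ⟨(Finite.equivFin V).symm, ?_, ?_⟩, P, ?_,
    fun i => ?_, fun f => ?_⟩
  · rw [← ht a₀ b₀ hab₀]
    exact h.mult_pos (hc _ _ hab₀)
  · intro e
    obtain ⟨a, b, hab, he⟩ := Set.ncard_eq_two.1 (h.ncard_inc e)
    refine ⟨Finite.equivFin V a, Finite.equivFin V b, ?_, by simpa using he⟩
    simpa using hab
  · intro i j hij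
    exact ht _ _ fun h => hij ((Finite.equivFin V).symm.injective h)
  · intro a
    refine ⟨fun i j hij => Set.disjoint_left.2 fun x hi hj => hij ?_, ?_⟩
    · by_cases ha : a = a₀
      · subst ha
        rw [hP₀] at hi hj
        exact hdisj₀ i j x hi.1 hi.2 hj.2
      · rw [hP₁ _ _ _ ha] at hi hj
        refine hdisj₀ i j (ξ (σ j)) (hξ _).1 ?_ (hξ _).2
        exact (h.nb_of_common hc ((hξ _).1.trans (hξ _).1.symm) hi.2 hj.2 (hξ _).2.symm).symm
    · ext x
      simp only [Set.mem_iUnion, Set.mem_preimage, Set.mem_singleton_iff]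
      exact ⟨fun ⟨i, hi⟩ => hPp a i x hi, hcover a x⟩
  · refine h.inducesCompleteMultipartite (v := id) Function.injective_id
      (fun a x hx => hPp a i x hx) (fun a => ?_) (fun a b hab x hx y hy => ?_)
    · by_cases ha : a = a₀
      · subst ha
        have := h.ncard_nbSet (x := c (σ i)) (b := a) (by rw [hpc _ (hσ i)]; exact hσ i)
        rw [hpc _ (hσ i), ht _ _ (hσ i)] at this
        simpa [P] using this
      · have := h.ncard_nbSet (x := ξ (σ i)) (b := a) (by rw [(hξ _).1]; exact Ne.symm ha)
        rw [(hξ _).1, ht _ _ (Ne.symm ha)] at this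
        simpa [P, ha] using this
    · by_cases ha : a = a₀
      · subst ha
        rw [hP₀] at hx
        rw [hP₁ _ _ _ hab.symm] at hy
        exact (hcls i x y hx.1 hx.2).2 hy.2
      · rw [hP₁ _ _ _ ha] at hx
        by_cases hb : b = a₀
        · subst hb
          rw [hP₀] at hy
          exact ((hcls i y x hy.1 hy.2).2 hx.2).symm
        · rw [hP₁ _ _ _ hb] at hy
          exact h.nb_trans hc hx.2.symm hy.2 (by rw [hx.1, hy.1]; exact hab)
  · obtain ⟨x, y, hxy, hnb⟩ := h.exists_pair f
    have key : ∀ x y i, Nb H x y → p x ≠ a₀ → x ∈ P (p x) i → y ∈ P (p y) i := by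
      intro x y i hnb hx hxi
      rw [hP₁ _ _ _ hx] at hxi
      by_cases hy : p y = a₀
      · obtain ⟨j, hj⟩ := hcover _ y rfl
        rw [hy, hP₀] at hj
        have h1 := (hcls j y x hy hj.2).1 hnb.symm
        have h2 := h.nb_of_common hc ((hξ _).1.trans (hξ _).1.symm) hxi.2 h1 (hξ _).2.symm
        have : i = j := hdisj₀ i j _ (hξ (σ j)).1 h2.symm (hξ _).2
        rw [hy, hP₀, this]
        exact ⟨hy, hj.2⟩
      · rw [hP₁ _ _ _ hy]
        exact ⟨rfl, h.nb_trans hc hxi.2 hnb (by rw [(hξ _).1]; exact Ne.symm hy)⟩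
    have main : ∀ x y, Nb H x y → p x ≠ a₀ → ∃ i, ({x, y} : Set C) ⊆ ⋃ a, P a i := by
      intro x y hnb hx
      obtain ⟨i, hi⟩ := hcover _ x rfl
      refine ⟨i, ?_⟩
      rintro z (rfl | rfl)
      · exact Set.mem_iUnion.2 ⟨_, hi⟩
      · exact Set.mem_iUnion.2 ⟨_, key x z i hnb hx hi⟩
    rw [hxy]
    by_cases hx : p x = a₀
    · rw [Set.pair_comm]
      exact main y x hnb.symm fun hy => h.p_ne hnb (hx.trans hy.symm)
    · exact main x y hnb hx

end OrdinaryBlock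

end

end DPColoring

/-! ### Covers of cycles: C-configurations -/

namespace SimpleGraph

theorem cycleGraph_adj_iff_val {n : ℕ} (hn : 3 ≤ n) {i j : Fin n} :
    (cycleGraph n).Adj i j ↔ i.val + 1 = j.val ∨ j.val + 1 = i.val ∨
      (i.val = 0 ∧ j.val + 1 = n) ∨ (j.val = 0 ∧ i.val + 1 = n) := by
  rw [cycleGraph_adj', Fin.sub_def, Fin.sub_def]
  have hi := i.2
  have hj := j.2
  have key : ∀ a b : ℕ, a < n → b < n → ((n - b + a) % n = 1 ↔ b + 1 = a ∨ (a = 0 ∧ b + 1 = n)) := by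
    intro a b ha hb
    by_cases hab : b ≤ a
    · have : n - b + a = n + (a - b) := by omega
      rw [this, Nat.add_mod_left, Nat.mod_eq_of_lt (by omega)]
      omega
    · rw [Nat.mod_eq_of_lt (by omega)]
      omega
  simp only [key i.val j.val hi hj, key j.val i.val hj hi]
  tauto

end SimpleGraph

namespace DPColoring

open MultiHypergraph

section

variable {V : Type u} {E : Type v} {C : Type w} {F : Type z}
variable {G : MultiHypergraph V E} {H : MultiHypergraph C F} {p : C → V} {M : E → Set F}

namespace OrdinaryBlock

section twoNeighbors

variable {a b c : V}

theorem ncard_fiber_eq_add [Nonempty C] (h : OrdinaryBlock G H p M) (hac : a ≠ c)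
    (hN : ∀ x, G.Adj b x ↔ x = a ∨ x = c) :
    (p ⁻¹' {b}).ncard = G.mult b a + G.mult b c := by
  have := G.finite_edges
  rw [← h.degree_eq, MultiHypergraph.degree, mult, mult, ← Set.ncard_union_eq]
  · congr 1
    ext e
    constructor
    · intro he
      obtain ⟨x, hx, hxb⟩ := G.exists_mem_ne e b
      have hinc := h.inc_eq he hx hxb.symm
      rcases (hN x).1 ⟨hxb.symm, e, he, hx⟩ with rfl | rfl
      · exact Or.inl hinc
      · exact Or.inr hinc
    · rintro (he | he)
      · simp [show G.inc e = _ from he]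
      · simp [show G.inc e = _ from he]
  · refine Set.disjoint_left.2 fun e he he' => ?_
    have hab : a ≠ b := ((hN a).2 (Or.inl rfl)).1.symm
    have : a ∈ ({b, c} : Set V) := by
      rw [← show G.inc e = _ from he', show G.inc e = _ from he]; simp
    simp [hab, hac] at this

/-- At least one edge at `b` leads to `c`, so `z` has fewer neighbours at `a` than there are
colours. -/
theorem exists_not_nb [Nonempty C] (h : OrdinaryBlock G H p M) (hac : a ≠ c)
    (hN : ∀ x, G.Adj b x ↔ x = a ∨ x = c) {z : C} (hz : p z = b) :
    ∃ x, p x = a ∧ ¬ Nb H x z := by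
  by_contra hno
  push Not at hno
  have h1 := h.ncard_fiber_eq_add hac hN
  have h2 := h.mult_pos ((hN c).2 (Or.inr rfl))
  have h3 : nbSet H p a z = p ⁻¹' {a} := by
    ext x
    exact ⟨fun hx => hx.1, fun hx => ⟨hx, (hno x hx).symm⟩⟩
  have h4 := h.ncard_nbSet (x := z) (b := a) (by rw [hz]; exact ((hN a).2 (Or.inl rfl)).1)
  rw [h3, hz, h.ncard_fiber_eq a b] at h4
  omega

/-- Take a colouring with hole at `c` and colour `x` at `a`. Since `b` has no other neighbours, it
may be recoloured by `z` or by `z'`. In the first case `y` is forbidden by `b` alone, so in the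
second case no vertex but `b` can forbid it. -/
theorem nb_of_not_nb (h : OrdinaryBlock G H p M) (hac : a ≠ c)
    (hN : ∀ x, G.Adj b x ↔ x = a ∨ x = c) {x y z z' : C} (hx : p x = a) (hz : p z = b)
    (hz' : p z' = b) (hy : p y = c) (hxz : ¬ Nb H x z) (hxz' : ¬ Nb H x z') (hzy : Nb H z y) :
    Nb H z' y := by
  classical
  have hbc : b ≠ c := ((hN c).2 (Or.inr rfl)).1
  obtain ⟨k, hk, hkx⟩ := h.exists_coloring_of_color x (r := c) (by rw [hx]; exact hac.symm)
  rw [hx] at hkx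
  have hkc := h.properOn_iff.1 hk
  have key : ∀ z, p z = b → ¬ Nb H x z → ProperOn H p {c}ᶜ (Function.update k b z) := by
    intro z hz hxz
    have hb : ∀ v, v ≠ c → ¬ Nb H z (k v) := by
      intro v hv hn
      have hadj := h.adj hn
      rw [hz, hkc.1 v hv] at hadj
      rcases (hN v).1 hadj with rfl | rfl
      · rw [hkx] at hn
        exact hxz hn.symm
      · exact hv rfl
    rw [h.properOn_iff]
    refine ⟨fun v hv => ?_, fun u hu v hv => ?_⟩
    · by_cases hvb : v = b
      · subst hvb; simpa
      · rw [Function.update_of_ne hvb]; exact hkc.1 v hv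
    · by_cases hub : u = b
      · by_cases hvb : v = b
        · subst hub hvb; exact fun hn => hn.ne rfl
        · subst hub
          rw [Function.update_self, Function.update_of_ne hvb]
          exact hb v hv
      · by_cases hvb : v = b
        · subst hvb
          rw [Function.update_self, Function.update_of_ne hub]
          exact fun hn => hb u hu hn.symm
        · rw [Function.update_of_ne hub, Function.update_of_ne hvb]
          exact hkc.2 u hu v hv
  obtain ⟨u, hu, hn⟩ := (h.hole (key z' hz' hxz')).1 y hy
  by_cases hub : u = b
  · subst hub
    simpa using hn
  · rw [Function.update_of_ne hub] at hn
    have := (h.hole (key z hz hxz)).2 y u b hy hu hbc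
      (by rwa [Function.update_of_ne hub]) (by simpa using hzy)
    exact absurd this hub

theorem ncard_not_nb [Nonempty C] (h : OrdinaryBlock G H p M) (hac : a ≠ c)
    (hN : ∀ x, G.Adj b x ↔ x = a ∨ x = c) {x : C} (hx : p x = a) :
    {z | p z = b ∧ ¬ Nb H x z}.ncard = G.mult b c := by
  have hfin := H.finite_vertices
  have h1 := h.ncard_fiber_eq_add hac hN
  have h4 := h.ncard_nbSet (x := x) (b := b) (by rw [hx]; exact ((hN a).2 (Or.inl rfl)).1.symm)
  have h5 := Set.ncard_sdiff_add_ncard_of_subset (s := nbSet H p b x) (t := p ⁻¹' {b})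
    (fun y hy => hy.1)
  have h6 : p ⁻¹' {b} \ nbSet H p b x = {z | p z = b ∧ ¬ Nb H x z} := by
    ext y
    simp only [nbSet, Set.mem_sdiff, Set.mem_preimage, Set.mem_singleton_iff, Set.mem_ofPred_eq]
    tauto
  rw [h6, h4, hx, mult_comm] at h5
  omega

/-- By `nb_of_not_nb`, the non-neighbours of `x` at `b` are neighbours of `y`; both sets have as
many elements as there are edges between `b` and `c`, so they coincide. -/
theorem nb_iff_not_nb (h : OrdinaryBlock G H p M) (hac : a ≠ c)
    (hN : ∀ x, G.Adj b x ↔ x = a ∨ x = c) {x y z z' : C} (hx : p x = a) (hz : p z = b)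
    (hy : p y = c) (hxz : ¬ Nb H x z) (hzy : Nb H z y) (hz' : p z' = b) :
    Nb H z' y ↔ ¬ Nb H x z' := by
  have : Nonempty C := ⟨x⟩
  have hfin := H.finite_vertices
  have hsub : {z | p z = b ∧ ¬ Nb H x z} ⊆ nbSet H p b y := fun w hw =>
    ⟨hw.1, (h.nb_of_not_nb hac hN hx hz hw.1 hy hxz hw.2 hzy).symm⟩
  have heq := Set.eq_of_subset_of_ncard_le hsub (by
    rw [h.ncard_not_nb hac hN hx, h.ncard_nbSet (by
      rw [hy]; exact ((hN c).2 (Or.inr rfl)).1.symm), hy, mult_comm])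
  constructor
  · intro hn
    have : z' ∈ nbSet H p b y := ⟨hz', hn.symm⟩
    rw [← heq] at this
    exact this.2
  · intro hn
    have : z' ∈ nbSet H p b y := hsub ⟨hz', hn⟩
    exact this.2.symm

/-- If `w` lies at `c`, a colour `x` of `a` missed by `z` is also missed by `z'`, by
`nb_iff_not_nb`. So `z` and `z'` agree at `c` by `nb_of_not_nb`. A colour of `c` missed by both then
gives agreement at `a` in the same way. -/
theorem nb_iff_of_common (h : OrdinaryBlock G H p M) (hac : a ≠ c)
    (hN : ∀ x, G.Adj b x ↔ x = a ∨ x = c) {z z' w : C} (hz : p z = b) (hz' : p z' = b)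
    (hw : Nb H z w) (hw' : Nb H z' w) (y : C) : Nb H z y ↔ Nb H z' y := by
  have : Nonempty C := ⟨z⟩
  have hN' : ∀ x, G.Adj b x ↔ x = c ∨ x = a := fun x => by rw [hN, or_comm]
  have main : ∀ a c, a ≠ c → (∀ x, G.Adj b x ↔ x = a ∨ x = c) → p w = c →
      ∀ z z', p z = b → p z' = b → Nb H z w → Nb H z' w → ∀ y, Nb H z y → Nb H z' y := by
    intro a c hac hN hwc z z' hz hz' hw hw' y hy
    have hN' : ∀ x, G.Adj b x ↔ x = c ∨ x = a := fun x => by rw [hN, or_comm]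
    obtain ⟨x, hx, hxz⟩ := h.exists_not_nb hac hN hz
    have hxz' : ¬ Nb H x z' := (h.nb_iff_not_nb hac hN hx hz hwc hxz hw hz').1 hw'
    have hc : ∀ y, p y = c → (Nb H z y ↔ Nb H z' y) := fun y hy =>
      ⟨h.nb_of_not_nb hac hN hx hz hz' hy hxz hxz', h.nb_of_not_nb hac hN hx hz' hz hy hxz' hxz⟩
    have hpy := h.adj hy
    rw [hz, hN] at hpy
    rcases hpy with hpy | hpy
    · obtain ⟨x', hx', hxz₁⟩ := h.exists_not_nb hac.symm hN' hz
      have hxz₂ : ¬ Nb H x' z' := fun hn => hxz₁ ((hc x' hx').2 hn.symm).symm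
      exact h.nb_of_not_nb hac.symm hN' hx' hz hz' hpy hxz₁ hxz₂ hy
    · exact (hc y hpy).1 hy
  have hpw := h.adj hw
  rw [hz, hN] at hpw
  rcases hpw with hpw | hpw
  · exact ⟨main c a hac.symm hN' hpw z z' hz hz' hw hw' y,
      main c a hac.symm hN' hpw z' z hz' hz hw' hw y⟩
  · exact ⟨main a c hac hN hpw z z' hz hz' hw hw' y, main a c hac hN hpw z' z hz' hz hw' hw y⟩

/-- Let `z` be a non-neighbour of `x` and let `x'` be a neighbour of `z` at the same vertex as `x`.
All neighbours of `x'` at `b` are twins of `z`, hence non-neighbours of `x`. Counting gives one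
inequality; the other follows by exchanging `a` and `c`. -/
theorem mult_eq_of_two_neighbors [Nonempty C] (h : OrdinaryBlock G H p M) (hac : a ≠ c)
    (hN : ∀ x, G.Adj b x ↔ x = a ∨ x = c) : G.mult b a = G.mult b c := by
  have hfin := H.finite_vertices
  have main : ∀ a c, a ≠ c → (∀ x, G.Adj b x ↔ x = a ∨ x = c) → G.mult b a ≤ G.mult b c := by
    intro a c hac hN
    have hN' : ∀ x, G.Adj b x ↔ x = c ∨ x = a := fun x => by rw [hN, or_comm]
    obtain ⟨x, rfl⟩ := h.p_surjective a
    have hne := h.ncard_not_nb hac hN (rfl : p x = p x)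
    have hpos := h.mult_pos ((hN c).2 (Or.inr rfl))
    rw [← hne] at hpos
    obtain ⟨z, hz, hxz⟩ := Set.nonempty_of_ncard_ne_zero hpos.ne'
    have hbx : G.Adj b (p x) := (hN _).2 (Or.inl rfl)
    obtain ⟨x', hx', hzx'⟩ := h.exists_nb z (b := p x) (by rw [hz]; exact hbx)
    rw [← hne, mult_comm, ← hx', ← h.ncard_nbSet (by rw [hx']; exact hbx.1.symm)]
    refine Set.ncard_le_ncard ?_ (Set.toFinite _)
    rintro z' ⟨hz', hn⟩
    exact ⟨hz', fun hxz' => hxz ((h.nb_iff_of_common hac hN hz hz' hzx' hn.symm x).2 hxz'.symm).symm⟩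
  exact le_antisymm (main a c hac hN) (main c a hac.symm fun x => by rw [hN, or_comm])

/-- By equality of the multiplicities, each of the two disjoint neighbourhoods contains half of the
colours of `c`, so they are complementary. -/
theorem nb_iff_of_no_common (h : OrdinaryBlock G H p M) (hac : a ≠ c)
    (hN : ∀ x, G.Adj b x ↔ x = a ∨ x = c) {z z' : C} (hz : p z = b) (hz' : p z' = b)
    (hw : ¬ ∃ w, Nb H z w ∧ Nb H z' w) {y : C} (hy : p y = c) : Nb H z y ↔ ¬ Nb H z' y := by
  have : Nonempty C := ⟨z⟩
  have hfin := H.finite_vertices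
  have hbc : b ≠ c := ((hN c).2 (Or.inr rfl)).1
  have h1 := h.ncard_fiber_eq_add hac hN
  rw [h.mult_eq_of_two_neighbors hac hN, h.ncard_fiber_eq b c] at h1
  have h2 := h.ncard_nbSet (x := z) (b := c) (by rwa [hz])
  have h3 := h.ncard_nbSet (x := z') (b := c) (by rwa [hz'])
  have hd : Disjoint (nbSet H p c z) (nbSet H p c z') :=
    Set.disjoint_left.2 fun w hw₁ hw₂ => hw ⟨w, hw₁.2, hw₂.2⟩
  have h4 := Set.ncard_union_eq hd
  have h5 : nbSet H p c z ∪ nbSet H p c z' = p ⁻¹' {c} := by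
    refine Set.eq_of_subset_of_ncard_le ?_ ?_ (Set.toFinite _)
    · rintro w (hw | hw) <;> exact hw.1
    · rw [h4, h2, h3, hz, hz', h1]
  constructor
  · exact fun h1 h2 => hw ⟨y, h1, h2⟩
  · intro hn
    have : y ∈ nbSet H p c z ∪ nbSet H p c z' := by rw [h5]; exact hy
    rcases this with h | h
    · exact h.2
    · exact absurd h.2 hn

end twoNeighbors

/-- The label says whether a colour is a twin of the reference colour `y` of its vertex; colours
that are not twins have complementary neighbourhoods. So two labels and the adjacency of the
references determine all adjacencies of the cover. -/
theorem exists_cycle_labels [Nonempty C] (h : OrdinaryBlock G H p M)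
    (hdeg : ∀ u, ∃ d d', d ≠ d' ∧ ∀ x, G.Adj u x ↔ x = d ∨ x = d') (y : V → C)
    (hy : ∀ a, p (y a) = a) :
    ∃ (t : ℕ) (L : C → Prop), 1 ≤ t ∧ (∀ a b, G.Adj a b → G.mult a b = t) ∧
      (∀ a, {z | p z = a ∧ L z}.ncard = t) ∧ (∀ a, {z | p z = a ∧ ¬ L z}.ncard = t) ∧
      ∀ z w, G.Adj (p z) (p w) → (Nb H z w ↔ ((L z ↔ L w) ↔ Nb H (y (p z)) (y (p w)))) := by
  have hfin := H.finite_vertices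
  have hdeg' : ∀ u v, G.Adj u v → ∃ d, d ≠ v ∧ ∀ x, G.Adj u x ↔ x = d ∨ x = v := by
    intro u v huv
    obtain ⟨d, d', hne, hN⟩ := hdeg u
    rcases (hN v).1 huv with rfl | rfl
    · exact ⟨d', hne.symm, fun x => by rw [hN, or_comm]⟩
    · exact ⟨d, hne, hN⟩
  let L : C → Prop := fun z => ∃ w, Nb H z w ∧ Nb H (y (p z)) w
  have hhalf : ∀ a b, G.Adj a b → (p ⁻¹' {a}).ncard = 2 * G.mult a b := by
    intro a b hab
    obtain ⟨d, hd, hN⟩ := hdeg' a b hab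
    rw [h.ncard_fiber_eq_add hd hN, h.mult_eq_of_two_neighbors hd hN]
    omega
  obtain ⟨x₀⟩ := ‹Nonempty C›
  have : Nonempty C := ⟨x₀⟩
  obtain ⟨d₀, _, _, hd₀⟩ := hdeg (p x₀)
  have hadj₀ : G.Adj (p x₀) d₀ := (hd₀ d₀).2 (Or.inl rfl)
  have hmult : ∀ a b, G.Adj a b → G.mult a b = G.mult (p x₀) d₀ := by
    intro a b hab
    have h1 := hhalf a b hab
    have h2 := hhalf _ _ hadj₀
    rw [h.ncard_fiber_eq a (p x₀)] at h1
    omega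
  have key : ∀ z w, G.Adj (p z) (p w) →
      ((L z → (Nb H z w ↔ Nb H (y (p z)) w)) ∧ (¬ L z → (Nb H z w ↔ ¬ Nb H (y (p z)) w))) := by
    intro z w hzw
    obtain ⟨d, hd, hN⟩ := hdeg' _ _ hzw
    exact ⟨fun ⟨x, h1, h2⟩ => h.nb_iff_of_common hd hN rfl (hy _) h1 h2 w,
      fun hL => h.nb_iff_of_no_common hd hN rfl (hy _) hL rfl⟩
  have hLcard : ∀ a, {z | p z = a ∧ L z}.ncard = G.mult (p x₀) d₀ := by
    intro a
    obtain ⟨d, d', hne, hN⟩ := hdeg a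
    have had : G.Adj a d := (hN d).2 (Or.inl rfl)
    obtain ⟨w, hw, hyw⟩ := h.exists_nb (y a) (b := d) (by rwa [hy])
    have heq : {z | p z = a ∧ L z} = nbSet H p a w := by
      ext z
      constructor
      · rintro ⟨rfl, hL⟩
        exact ⟨rfl, (((key z w (by rwa [hw])).1 hL).2 hyw).symm⟩
      · rintro ⟨rfl, hn⟩
        exact ⟨rfl, w, hn.symm, hyw⟩
    rw [heq, h.ncard_nbSet (by rw [hw]; exact had.1.symm), hw, mult_comm, hmult a d had]
  clear_value L
  refine ⟨G.mult (p x₀) d₀, L, h.mult_pos hadj₀, hmult, hLcard, fun a => ?_, fun z w hzw => ?_⟩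
  · have h5 := Set.ncard_sdiff_add_ncard_of_subset (s := {z | p z = a ∧ L z}) (t := p ⁻¹' {a})
      (fun y hy => hy.1)
    have h6 : p ⁻¹' {a} \ {z | p z = a ∧ L z} = {z | p z = a ∧ ¬ L z} := by
      ext y
      simp only [Set.mem_sdiff, Set.mem_preimage, Set.mem_singleton_iff, Set.mem_ofPred_eq]
      tauto
    have h7 := hhalf _ _ hadj₀
    rw [h6, hLcard, h.ncard_fiber_eq a (p x₀)] at h5
    omega
  · have k1 := key z w hzw
    have hzw' : G.Adj (p w) (p (y (p z))) := by
      rw [hy]; exact G.adjGraph.symm.symm _ _ hzw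
    have k2 := key w (y (p z)) hzw'
    have e1 : Nb H w (y (p z)) ↔ Nb H (y (p z)) w := ⟨Nb.symm, Nb.symm⟩
    have e2 : Nb H (y (p w)) (y (p z)) ↔ Nb H (y (p z)) (y (p w)) := ⟨Nb.symm, Nb.symm⟩
    rw [e1, e2] at k2
    by_cases hz : L z
    · by_cases hw : L w
      · rw [k1.1 hz, k2.1 hw]
        exact ⟨fun hn => iff_of_true (iff_of_true hz hw) hn, fun hn => hn.1 (iff_of_true hz hw)⟩
      · rw [k1.1 hz, k2.2 hw]
        exact ⟨fun hn => iff_of_false (fun hi => hw (hi.1 hz)) hn,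
          fun hn hb => hw ((hn.2 hb).1 hz)⟩
    · by_cases hw : L w
      · rw [k1.2 hz, k2.1 hw]
        exact ⟨fun hn => iff_of_false (fun hi => hz (hi.2 hw)) hn,
          fun hn hb => hz ((hn.2 hb).2 hw)⟩
      · rw [k1.2 hz, k2.2 hw, not_not]
        exact ⟨fun hn => iff_of_true (iff_of_false hz hw) hn, fun hn => hn.1 (iff_of_false hz hw)⟩

/-- References are chosen one after another along the cycle, each adjacent to the previous one; only
the closing pair is beyond control. -/
theorem exists_walk_lift [Nonempty C] (h : OrdinaryBlock G H p M) {n : ℕ} (φ : Fin n ≃ V)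
    (hn : 3 ≤ n)
    (hφ : ∀ i j, (SimpleGraph.cycleGraph n).Adj i j ↔ G.Adj (φ i) (φ j)) :
    ∃ y : V → C, (∀ a, p (y a) = a) ∧
      ∀ i j : Fin n, i.val + 1 = j.val → Nb H (y (φ i)) (y (φ j)) := by
  classical
  have : NeZero n := ⟨by omega⟩
  obtain ⟨x₀, hx₀⟩ := h.p_surjective (φ 0)
  -- The default `x` is irrelevant: `nbr` is used only for a vertex adjacent to that of `x`.
  let nbr : C → V → C := fun x b => if hb : ∃ y, p y = b ∧ Nb H x y then hb.choose else x
  have hnbr : ∀ x b, G.Adj (p x) b → p (nbr x b) = b ∧ Nb H x (nbr x b) := by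
    intro x b hb
    have hex := h.exists_nb x hb
    simp only [nbr, dif_pos hex]
    exact hex.choose_spec
  let s : ℕ → C := fun k => Nat.rec x₀ (fun k x => nbr x (φ (Fin.ofNat n (k + 1)))) k
  have hs : ∀ k, k < n → p (s k) = φ (Fin.ofNat n k) := by
    intro k
    induction k with
    | zero => intro _; simpa [s] using hx₀
    | succ k ih =>
      intro hk
      refine (hnbr (s k) _ ?_).1
      rw [ih (by omega), ← hφ, SimpleGraph.cycleGraph_adj_iff_val hn]
      left
      simp [Nat.mod_eq_of_lt hk, Nat.mod_eq_of_lt (show k < n by omega)]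
  have hs' : ∀ k, k + 1 < n → Nb H (s k) (s (k + 1)) := by
    intro k hk
    refine (hnbr (s k) _ ?_).2
    rw [hs k (by omega), ← hφ, SimpleGraph.cycleGraph_adj_iff_val hn]
    left
    simp [Nat.mod_eq_of_lt hk, Nat.mod_eq_of_lt (show k < n by omega)]
  refine ⟨fun a => s (φ.symm a).val, fun a => ?_, fun i j hij => ?_⟩
  · rw [hs _ (φ.symm a).2]
    simp
  · simp only [Equiv.symm_apply_apply]
    rw [← hij]
    exact hs' _ (by rw [hij]; exact j.2)

/-- With references adjacent along the path, the two label classes are joined straight everywhere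
except possibly at the closing pair, where uncolorability and parity decide between straight and
crossed. -/
theorem isCConfiguration [Nonempty C] (h : OrdinaryBlock G H p M)
    (hdeg : ∀ u, ∃ d d', d ≠ d' ∧ ∀ x, G.Adj u x ↔ x = d ∨ x = d')
    (hnc : ∃ a b, a ≠ b ∧ ¬ G.Adj a b) :
    IsCConfiguration G (fun a => p ⁻¹' {a}) H := by
  classical
  have hfinV := G.finite_vertices
  obtain ⟨a₀, b₀, hab₀, hnab₀⟩ := hnc
  have : Nonempty V := ⟨a₀⟩
  obtain ⟨n, φ, hn3, hφ⟩ := SimpleGraph.exists_equiv_cycleGraph h.preconnected hdeg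
  replace hφ : ∀ i j, (SimpleGraph.cycleGraph n).Adj i j ↔ G.Adj (φ i) (φ j) := hφ
  -- A triangle is complete.
  have hn : 4 ≤ n := by
    by_contra hlt
    obtain rfl : n = 3 := by omega
    apply hnab₀
    have := hφ (φ.symm a₀) (φ.symm b₀)
    rw [SimpleGraph.cycleGraph_three_eq_top] at this
    simpa [hab₀] using this
  obtain ⟨y, hy, hpath⟩ := h.exists_walk_lift φ hn3 hφ
  obtain ⟨t, L, ht, hmult, hL, hL', hnb⟩ := h.exists_cycle_labels hdeg y hy
  let z₀ : Fin n := ⟨0, by omega⟩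
  let l : Fin n := ⟨n - 1, by omega⟩
  -- adjacent vertices are consecutive, or the first and the last one
  have hcases : ∀ a b, G.Adj a b → Nb H (y a) (y b) ∨ ({a, b} : Set V) = {φ l, φ z₀} := by
    intro a b hab
    obtain ⟨i, rfl⟩ := φ.surjective a
    obtain ⟨j, rfl⟩ := φ.surjective b
    rw [← hφ, SimpleGraph.cycleGraph_adj_iff_val hn3] at hab
    rcases hab with hij | hij | ⟨hi, hj⟩ | ⟨hj, hi⟩
    · exact Or.inl (hpath i j hij)
    · exact Or.inl (hpath j i hij).symm
    · right
      have h1 : i = z₀ := Fin.ext hi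
      have h2 : j = l := Fin.ext (by simp only [l]; omega)
      rw [h1, h2, Set.pair_comm]
    · right
      have h1 : j = z₀ := Fin.ext hj
      have h2 : i = l := Fin.ext (by simp only [l]; omega)
      rw [h1, h2]
  have hwrap : G.Adj (φ l) (φ z₀) := by
    rw [← hφ, SimpleGraph.cycleGraph_adj_iff_val hn3]
    right; right; right
    simp only [l, z₀]
    exact ⟨trivial, by omega⟩
  -- Otherwise alternating labels yield a proper colouring: consecutive labels differ while their
  -- references are adjacent, and the labels of the last and first vertex agree exactly when `n` is
  -- odd.
  have hpar : Odd n ↔ Nb H (y (φ l)) (y (φ z₀)) := by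
    by_contra hne
    have hκ : ∀ a (b : Prop), ∃ z, p z = a ∧ (L z ↔ b) := by
      intro a b
      by_cases hb : b
      · obtain ⟨z, hz⟩ := Set.nonempty_of_ncard_ne_zero
          (by rw [hL a]; omega : {z | p z = a ∧ L z}.ncard ≠ 0)
        exact ⟨z, hz.1, iff_of_true hz.2 hb⟩
      · obtain ⟨z, hz⟩ := Set.nonempty_of_ncard_ne_zero
          (by rw [hL' a]; omega : {z | p z = a ∧ ¬ L z}.ncard ≠ 0)
        exact ⟨z, hz.1, iff_of_false hz.2 hb⟩
    choose κ hκ1 hκ2 using hκ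
    refine h.not_colorable ⟨fun a => κ a (Even (φ.symm a).val), ?_⟩
    rw [h.properOn_iff]
    refine ⟨fun a _ => hκ1 _ _, ?_⟩
    have hno : ∀ i j : Fin n, i.val + 1 = j.val ∨ (j.val = 0 ∧ i.val + 1 = n) →
        ¬ Nb H (κ (φ i) (Even (φ.symm (φ i)).val)) (κ (φ j) (Even (φ.symm (φ j)).val)) := by
      intro i j hij hN
      have hadj := h.adj hN
      have := (hnb _ _ hadj).1 hN
      rw [hκ1, hκ1, hκ2, hκ2, Equiv.symm_apply_apply, Equiv.symm_apply_apply] at this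
      rcases hij with hij | ⟨hj, hi⟩
      · rw [← hij, Nat.even_add_one] at this
        have hp := hpath i j hij
        tauto
      · have h1 : j = z₀ := Fin.ext hj
        have h2 : i = l := Fin.ext (by simp only [l]; omega)
        have h3 : Odd n ↔ Even i.val := by
          have := Nat.odd_add_one (n := i.val)
          rwa [hi, Nat.not_odd_iff_even] at this
        rw [hj] at this
        rw [h3, ← h1, ← h2] at hne
        simp only [Even.zero, iff_true] at this
        exact hne this
    intro a _ b _ hN
    obtain ⟨i, rfl⟩ := φ.surjective a
    obtain ⟨j, rfl⟩ := φ.surjective b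
    have hadj := h.adj hN
    rw [hκ1, hκ1, ← hφ, SimpleGraph.cycleGraph_adj_iff_val hn3] at hadj
    rcases hadj with hij | hij | hij | hij
    · exact hno i j (Or.inl hij) hN
    · exact hno j i (Or.inl hij) hN.symm
    · exact hno j i (Or.inr hij) hN.symm
    · exact hno i j (Or.inr hij) hN
  let P : V → Fin 2 → Set C := fun a i => if i = 0 then {z | p z = a ∧ L z} else {z | p z = a ∧ ¬ L z}
  have hP : ∀ a i z, z ∈ P a i ↔ p z = a ∧ (L z ↔ i = 0) := by
    intro a i z
    fin_cases i <;> simp [P]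
  have hPcard : ∀ a i, (P a i).ncard = t := by
    intro a i
    fin_cases i
    · simpa [P] using hL a
    · simpa [P] using hL' a
  have hPp : ∀ a, IsPartition (P a) (p ⁻¹' {a}) := by
    intro a
    refine ⟨fun i j hij => Set.disjoint_left.2 fun x hx hx' => ?_, ?_⟩
    · rw [hP] at hx hx'
      have h1 := hx.2.symm.trans hx'.2
      omega
    · ext x
      simp only [Set.mem_iUnion, hP, Set.mem_preimage, Set.mem_singleton_iff]
      refine ⟨fun ⟨i, hi⟩ => hi.1, fun hx => ?_⟩
      by_cases hLx : L x
      · exact ⟨0, hx, by simpa⟩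
      · exact ⟨1, hx, by simpa⟩
  have hKtt : ∀ a b i j, G.Adj a b → ((i = j) ↔ Nb H (y a) (y b)) →
      H.InducesKtt (P a i) (P b j) t := by
    intro a b i j hab hij
    refine h.inducesKtt hab.1 (fun x hx => ((hP _ _ _).1 hx).1) (fun x hx => ((hP _ _ _).1 hx).1)
      (hPcard a i) (hPcard b j) fun x hx x' hx' => ?_
    rw [hP] at hx hx'
    rw [hnb x x' (by rw [hx.1, hx'.1]; exact hab), hx.1, hx'.1, ← hij, hx.2, hx'.2]
    omega
  have hmultiple : G.IsMultiple t (SimpleGraph.cycleGraph n) := by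
    refine ⟨φ, fun e => ?_, fun i j hij => hmult _ _ ((hφ i j).1 hij)⟩
    obtain ⟨a, b, hab, he⟩ := Set.ncard_eq_two.1 (h.ncard_inc e)
    refine ⟨φ.symm a, φ.symm b, ?_, by simpa using he⟩
    rw [hφ, Equiv.apply_symm_apply, Equiv.apply_symm_apply]
    exact ⟨hab, e, by simp [he], by simp [he]⟩
  have hmemP : ∀ x, ∃ i, x ∈ P (p x) i ∧ (L x ↔ i = 0) := by
    intro x
    by_cases hLx : L x
    · exact ⟨0, (hP _ _ _).2 ⟨rfl, by simpa⟩, by simpa⟩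
    · exact ⟨1, (hP _ _ _).2 ⟨rfl, by simpa⟩, by simpa⟩
  rcases Nat.even_or_odd n with hev | hodd
  · right
    have hW : ¬ Nb H (y (φ l)) (y (φ z₀)) := by
      rw [← hpar, Nat.not_odd_iff_even]; exact hev
    refine ⟨h.cov.isCover, t, n, ht, hn, hev, hmultiple, P, φ l, φ z₀, hPp, h.ordAdj_iff.2 hwrap,
      fun i a b hab hne => ?_, ?_, ?_, fun f => ?_⟩
    · rw [h.ordAdj_iff] at hab
      exact hKtt a b i i hab (iff_of_true rfl ((hcases a b hab).resolve_right hne))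
    · exact hKtt _ _ 0 1 hwrap (iff_of_false (by simp) hW)
    · exact hKtt _ _ 1 0 hwrap (iff_of_false (by simp) hW)
    · obtain ⟨x, x', hf, hN⟩ := h.exists_pair f
      obtain ⟨i, hi, hLi⟩ := hmemP x
      obtain ⟨j, hj, hLj⟩ := hmemP x'
      have hadj := h.adj hN
      have hiff := (hnb x x' hadj).1 hN
      by_cases hpair : ({p x, p x'} : Set V) = {φ l, φ z₀}
      · right
        have aux : ∀ x x' i j, x ∈ P (φ l) i → x' ∈ P (φ z₀) j → (L x ↔ i = 0) → (L x' ↔ j = 0) →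
            ((L x ↔ L x') ↔ Nb H (y (φ l)) (y (φ z₀))) →
            ({x, x'} : Set C) ⊆ P (φ l) 0 ∪ P (φ z₀) 1 ∨
              ({x, x'} : Set C) ⊆ P (φ l) 1 ∪ P (φ z₀) 0 := by
          intro x x' i j hx hx' h1 h2 h3
          have hij : i ≠ j := by
            rintro rfl
            exact hW (h3.1 (h1.trans h2.symm))
          fin_cases i
          · fin_cases j
            · exact absurd rfl hij
            · left
              rintro w (rfl | rfl)
              · exact Or.inl hx
              · exact Or.inr hx'
          · fin_cases j
            · right
              rintro w (rfl | rfl)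
              · exact Or.inl hx
              · exact Or.inr hx'
            · exact absurd rfl hij
        rw [hf]
        rcases Set.pair_eq_pair_iff.1 hpair with ⟨h1, h2⟩ | ⟨h1, h2⟩
        · rw [h1] at hi hiff
          rw [h2] at hj hiff
          exact aux x x' i j hi hj hLi hLj hiff
        · rw [h1] at hi hiff
          rw [h2] at hj hiff
          rw [Set.pair_comm]
          refine aux x' x j i hj hi hLj hLi ?_
          rw [iff_comm (a := L x'), hiff]
          exact ⟨Nb.symm, Nb.symm⟩
      · left
        have hnbyy := (hcases _ _ hadj).resolve_right hpair
        have hij : i = j := by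
          have h1 := hiff.2 hnbyy
          rw [hLi, hLj] at h1
          omega
        subst hij
        refine ⟨i, p x, p x', h.ordAdj_iff.2 hadj, hpair, ?_⟩
        rw [hf]
        rintro w (rfl | rfl)
        · exact Or.inl hi
        · exact Or.inr hj
  · left
    have hW := hpar.1 hodd
    have hall : ∀ a b, G.Adj a b → Nb H (y a) (y b) := by
      intro a b hab
      rcases hcases a b hab with h1 | h1
      · exact h1
      · rcases Set.pair_eq_pair_iff.1 h1 with ⟨rfl, rfl⟩ | ⟨rfl, rfl⟩
        · exact hW
        · exact hW.symm
    refine ⟨h.cov.isCover, t, n, ht, ?_, hodd, hmultiple, P, hPp, fun i a b hab => ?_, fun f => ?_⟩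
    · rcases hodd with ⟨m, rfl⟩
      omega
    · rw [h.ordAdj_iff] at hab
      exact hKtt a b i i hab (iff_of_true rfl (hall a b hab))
    · obtain ⟨x, x', hf, hN⟩ := h.exists_pair f
      obtain ⟨i, hi, hLi⟩ := hmemP x
      obtain ⟨j, hj, hLj⟩ := hmemP x'
      have hadj := h.adj hN
      have hij : i = j := by
        have h1 := ((hnb x x' hadj).1 hN).2 (hall _ _ hadj)
        rw [hLi, hLj] at h1
        omega
      subst hij
      refine ⟨i, p x, p x', h.ordAdj_iff.2 hadj, ?_⟩
      rw [hf]
      rintro w (rfl | rfl)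
      · exact Or.inl hi
      · exact Or.inr hj

end OrdinaryBlock

/-- A connected uncolorable degree-feasible cover without cut vertices is a K-, C- or
E-configuration. -/
theorem UncolorableBlock.classification [Nonempty C] (h : UncolorableBlock G H p M) (e : E) :
    IsKConfiguration G (fun a => p ⁻¹' {a}) H ∨ IsCConfiguration G (fun a => p ⁻¹' {a}) H ∨
      IsEConfiguration G (fun a => p ⁻¹' {a}) H := by
  by_cases h1 : ∀ r e e', r ∈ G.inc e → r ∈ G.inc e' → e = e'
  · exact Or.inr (Or.inr (h.isEConfiguration h1 e))
  push Not at h1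
  obtain ⟨r, e₁, e₂, hr₁, hr₂, hne⟩ := h1
  have hfin := G.finite_edges
  -- All degrees agree, since they are the sizes of the fibres.
  have hdeg : ∀ a, 2 ≤ G.degree a := by
    intro a
    rw [h.degree_eq, h.ncard_fiber_eq a r, ← h.degree_eq, MultiHypergraph.degree,
      ← Set.ncard_pair hne]
    refine Set.ncard_le_ncard ?_ (Set.toFinite _)
    rintro e (rfl | rfl) <;> assumption
  have hord : OrdinaryBlock G H p M := by
    refine ⟨h, fun e => le_antisymm ?_ (G.two_le_ncard_inc e)⟩
    by_contra hlt
    obtain ⟨r, hr⟩ := Set.nonempty_of_ncard_ne_zero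
      (by have := G.two_le_ncard_inc e; omega : (G.inc e).ncard ≠ 0)
    obtain ⟨e', he', hne'⟩ := Set.exists_ne_of_one_lt_ncard (hdeg r) e
    exact h.not_three_le hr he' hne' (by omega)
  rcases SimpleGraph.eq_top_or_isCycles h.preconnected h.noCutVertex hord.neighborsSeparate with
    hc | ⟨hnc, hdeg⟩
  · obtain ⟨a, b, hab, -⟩ := Set.ncard_eq_two.1 (hord.ncard_inc e)
    exact Or.inl (hord.isKConfiguration hc hab)
  · exact Or.inr (Or.inl (hord.isCConfiguration hdeg hnc))

end

end DPColoring

/-! ### Splitting at a cut vertex -/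

namespace DPColoring

open MultiHypergraph

section

variable {V : Type u} {E : Type v} {C : Type w} {F : Type z}

/-- A type is the disjoint sum of two complementary subsets. -/
noncomputable def sumEquivOfDisjoint {α : Type*} {A B : Set α} (hd : ∀ x ∈ A, x ∉ B)
    (hu : ∀ x, x ∈ A ∨ x ∈ B) : A ⊕ B ≃ α :=
  Equiv.ofBijective (Sum.elim Subtype.val Subtype.val) <| by
    constructor
    · rintro (⟨x, hx⟩ | ⟨x, hx⟩) (⟨y, hy⟩ | ⟨y, hy⟩) hxy <;>
        simp only [Sum.elim_inl, Sum.elim_inr] at hxy <;> subst hxy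
      · rfl
      · exact (hd x hx hy).elim
      · exact (hd x hy hx).elim
      · rfl
    · intro x
      rcases hu x with hx | hx
      · exact ⟨Sum.inl ⟨x, hx⟩, rfl⟩
      · exact ⟨Sum.inr ⟨x, hx⟩, rfl⟩

/-- The subhypergraph induced by `W`. -/
def MultiHypergraph.induce (G : MultiHypergraph V E) (W : Set V) :
    MultiHypergraph W {e | G.inc e ⊆ W} where
  inc e := Subtype.val ⁻¹' G.inc e.1
  finite_vertices := by
    have := G.finite_vertices
    infer_instance
  finite_edges := by
    have := G.finite_edges
    infer_instance
  two_le_ncard_inc e := by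
    rw [Set.ncard_preimage_of_injective_subset_range Subtype.val_injective]
    · exact G.two_le_ncard_inc e.1
    · rw [Subtype.range_val]
      exact e.2

theorem MultiHypergraph.image_induce_inc (G : MultiHypergraph V E) (W : Set V)
    (e : {e | G.inc e ⊆ W}) : Subtype.val '' (G.induce W).inc e = G.inc e.1 := by
  have := Subtype.image_preimage_val W (G.inc e.1)
  rw [Set.inter_eq_right.2 e.2] at this
  exact this

theorem MultiHypergraph.exists_mem_inc (G : MultiHypergraph V E) (e : E) : ∃ a, a ∈ G.inc e :=
  Set.nonempty_of_ncard_ne_zero (by have := G.two_le_ncard_inc e; omega)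

/-- `G` is the union of its subhypergraphs induced by `W₁` and `W₂`, which share only `r`. -/
structure Separation (G : MultiHypergraph V E) (r : V) (W₁ W₂ : Set V) : Prop where
  mem_left : r ∈ W₁
  mem_right : r ∈ W₂
  eq_of_mem : ∀ a ∈ W₁, a ∈ W₂ → a = r
  mem_or : ∀ a, a ∈ W₁ ∨ a ∈ W₂
  inc_subset : ∀ e, G.inc e ⊆ W₁ ∨ G.inc e ⊆ W₂

variable {G : MultiHypergraph V E} {H : MultiHypergraph C F} {p : C → V} {M : E → Set F}
  {r : V} {W₁ W₂ : Set V}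

namespace Separation

theorem symm (s : Separation G r W₁ W₂) : Separation G r W₂ W₁ :=
  ⟨s.mem_right, s.mem_left, fun a h₁ h₂ => s.eq_of_mem a h₂ h₁, fun a => (s.mem_or a).symm,
    fun e => (s.inc_subset e).symm⟩

theorem not_both (s : Separation G r W₁ W₂) {e : E} (h₁ : G.inc e ⊆ W₁) : ¬ G.inc e ⊆ W₂ := by
  intro h₂
  obtain ⟨b, hb, hne⟩ := G.exists_mem_ne e r
  exact hne (s.eq_of_mem b (h₁ hb) (h₂ hb))

theorem connected (s : Separation G r W₁ W₂) (h : G.adjGraph.Preconnected) :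
    (G.induce W₁).adjGraph.Preconnected := by
  have key : ∀ z, ∀ hz : z ∈ W₁,
      (G.induce W₁).adjGraph.Reachable ⟨z, hz⟩ ⟨r, s.mem_left⟩ := by
    intro z
    refine (h z r).head_induction (P := fun z => ∀ hz : z ∈ W₁,
      (G.induce W₁).adjGraph.Reachable ⟨z, hz⟩ ⟨r, s.mem_left⟩) (fun _ => .refl _) ?_
    rintro x y ⟨hxy, e, hx, hy⟩ - ih hxW
    by_cases hxr : x = r
    · subst hxr; exact .refl _
    have he : G.inc e ⊆ W₁ := (s.inc_subset e).resolve_right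
      fun h2 => hxr (s.eq_of_mem x hxW (h2 hx))
    refine SimpleGraph.Reachable.trans (SimpleGraph.Adj.reachable ?_) (ih (he hy))
    exact ⟨fun h => hxy (congrArg Subtype.val h), ⟨e, he⟩, hx, hy⟩
  exact fun a b => (key a a.2).trans (key b b.2).symm

end Separation

/-- There is a separation at each cut vertex. -/
theorem exists_separation (hcut : ¬ G.adjGraph.NoCutVertex) :
    ∃ r W₁ W₂ a b, Separation G r W₁ W₂ ∧ a ∉ W₁ ∧ b ∉ W₂ := by
  unfold SimpleGraph.NoCutVertex at hcut
  push Not at hcut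
  obtain ⟨r, a, b, har, hbr, hn⟩ := hcut
  -- One side is the component of `b` after removing `r`, the other side is everything else; `r`
  -- belongs to both. The vertices `a` and `b` witness that both sides are proper subsets.
  refine ⟨r, {z | z = r ∨ (G.adjGraph.away {r}).Reachable z b},
    {z | z = r ∨ ¬ (G.adjGraph.away {r}).Reachable z b}, a, b,
    ⟨Or.inl rfl, Or.inl rfl, ?_, ?_, ?_⟩, ?_, ?_⟩
  · rintro z (rfl | h1) (h2 | h2)
    · rfl
    · rfl
    · exact h2
    · exact absurd h1 h2
  · intro z
    by_cases hz : (G.adjGraph.away {r}).Reachable z b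
    · exact Or.inl (Or.inr hz)
    · exact Or.inr (Or.inr hz)
  · intro e
    by_cases hex : ∃ z ∈ G.inc e, z ≠ r ∧ (G.adjGraph.away {r}).Reachable z b
    · left
      obtain ⟨z, hz, hzr, hzb⟩ := hex
      intro y hy
      by_cases hyr : y = r
      · exact Or.inl hyr
      right
      by_cases hyz : y = z
      · rwa [hyz]
      · exact SimpleGraph.Reachable.trans (SimpleGraph.Adj.reachable
          ⟨⟨hyz, e, hy, hz⟩, hyr, hzr⟩) hzb
    · right
      push Not at hex
      intro y hy
      by_cases hyr : y = r
      · exact Or.inl hyr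
      · exact Or.inr (hex y hy hyr)
  · rintro (h | h)
    · exact har h
    · exact hn h
  · rintro (h | h)
    · exact hbr h
    · exact h (.refl _)

/-- A minimal uncolorable degree-feasible configuration. -/
structure Critical (G : MultiHypergraph V E) (H : MultiHypergraph C F) (p : C → V)
    (M : E → Set F) : Prop where
  cov : Cov G H p M
  preconnected : G.adjGraph.Preconnected
  degree_le : ∀ a, G.degree a ≤ (p ⁻¹' {a}).ncard
  not_colorable : ¬ ∃ c, ProperOn H p Set.univ c
  minimal : ∀ f, ∃ c : V → C, (∀ a, p (c a) = a) ∧ ∀ f', H.inc f' ⊆ Set.range c → f' = f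

/-- The colours of the cut vertex `r` which are forbidden by edges within `W`. -/
def sideColors (G : MultiHypergraph V E) (H : MultiHypergraph C F) (p : C → V) (M : E → Set F)
    (r : V) (W : Set V) : Set C :=
  {x | p x = r ∧ ∃ c e, ProperOn H p {r}ᶜ c ∧ G.inc e ⊆ W ∧ Blocks G H M c r e x}

/-- The colours belonging to the part of the cover over `W`. -/
def partColors (G : MultiHypergraph V E) (H : MultiHypergraph C F) (p : C → V) (M : E → Set F)
    (r : V) (W : Set V) : Set C :=
  {x | p x ∈ W ∧ (p x = r → x ∈ sideColors G H p M r W)}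

namespace Critical

open Classical in
/-- Colourings of the two sides of a separation can be combined. -/
theorem properOn_mix (h : Cov G H p M) (s : Separation G r W₁ W₂) {c c' : V → C}
    (hc : ProperOn H p {r}ᶜ c) (hc' : ProperOn H p {r}ᶜ c') :
    ProperOn H p {r}ᶜ fun a => if a ∈ W₁ then c a else c' a := by
  rw [h.properOn_iff] at hc hc' ⊢
  refine ⟨fun a ha => ?_, fun e f hf hall => ?_⟩
  · by_cases h1 : a ∈ W₁
    · simpa [h1] using hc.1 a ha
    · simpa [h1] using hc'.1 a ha
  · rcases s.inc_subset e with he | he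
    · refine hc.2 e f hf fun a ha => ?_
      simpa [he ha] using hall a ha
    · refine hc'.2 e f hf fun a ha => ?_
      have h1 : a ∉ W₁ := fun h1 => (hall a ha).1 (s.eq_of_mem a h1 (he ha))
      simpa [h1] using hall a ha

theorem blocks_congr {c c' : V → C} {e : E} {x : C}
    (hcc : ∀ a ∈ G.inc e, a ≠ r → c a = c' a) (hb : Blocks G H M c r e x) :
    Blocks G H M c' r e x := by
  obtain ⟨hr, f, hf, hx, hall⟩ := hb
  exact ⟨hr, f, hf, hx, fun a ha har => hcc a ha har ▸ hall a ha har⟩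

/-- A colour forbidden from the left by one colouring and from the right by another would be
forbidden twice by the combined colouring. -/
theorem disjoint_sideColors (h : Critical G H p M) (s : Separation G r W₁ W₂) {x : C}
    (h₁ : x ∈ sideColors G H p M r W₁) : x ∉ sideColors G H p M r W₂ := by
  classical
  rintro ⟨hx, c', e', hc', he', hb'⟩
  obtain ⟨-, c, e, hc, he, hb⟩ := h₁
  have hm := properOn_mix h.cov s hc hc'
  have := (h.cov.hole (h.degree_le r) h.not_colorable hm).2.2.1 x e e' hx
    (blocks_congr (fun a ha _ => by simp [he ha]) hb)
    (blocks_congr (fun a ha har => by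
      have : a ∉ W₁ := fun h1 => har (s.eq_of_mem a h1 (he' ha))
      simp [this]) hb')
  subst this
  exact s.not_both he he'

theorem exists_hole_coloring [Nonempty C] (h : Critical G H p M) (r : V) :
    ∃ c, ProperOn H p {r}ᶜ c := by
  obtain ⟨x⟩ := ‹Nonempty C›
  obtain ⟨c, hc, -⟩ := h.cov.exists_extension h.degree_le (properOn_empty (H := H) fun _ => x)
    (r := r) (by simp) (fun a _ => by rw [SimpleGraph.away_empty]; exact h.preconnected a r)
  exact ⟨c, hc⟩

theorem mem_sideColors_or [Nonempty C] (h : Critical G H p M) (s : Separation G r W₁ W₂) {x : C}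
    (hx : p x = r) : x ∈ sideColors G H p M r W₁ ∨ x ∈ sideColors G H p M r W₂ := by
  obtain ⟨c, hc⟩ := h.exists_hole_coloring r
  obtain ⟨e, hb⟩ := (h.cov.hole (h.degree_le r) h.not_colorable hc).1 x hx
  rcases s.inc_subset e with he | he
  · exact Or.inl ⟨hx, c, e, hc, he, hb⟩
  · exact Or.inr ⟨hx, c, e, hc, he, hb⟩

theorem mem_partColors_or [Nonempty C] (h : Critical G H p M) (s : Separation G r W₁ W₂) (x : C) :
    x ∈ partColors G H p M r W₁ ∨ x ∈ partColors G H p M r W₂ := by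
  by_cases hx : p x = r
  · rcases h.mem_sideColors_or s hx with h1 | h1
    · exact Or.inl ⟨hx ▸ s.mem_left, fun _ => h1⟩
    · exact Or.inr ⟨hx ▸ s.mem_right, fun _ => h1⟩
  · rcases s.mem_or (p x) with h1 | h1
    · exact Or.inl ⟨h1, fun h => absurd h hx⟩
    · exact Or.inr ⟨h1, fun h => absurd h hx⟩

theorem disjoint_partColors (h : Critical G H p M) (s : Separation G r W₁ W₂) (x : C)
    (h₁ : x ∈ partColors G H p M r W₁) : x ∉ partColors G H p M r W₂ := by
  intro h₂
  have hx := s.eq_of_mem _ h₁.1 h₂.1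
  exact h.disjoint_sideColors s (h₁.2 hx) (h₂.2 hx)

/-- By minimality some choice of colours contains `f` and no other edge. If `f` has a colour at `r`,
uncolouring `r` leaves a proper colouring in which `e` forbids precisely this colour through `f`, so
it belongs to the side of `e`. -/
theorem cover_inc_subset (h : Critical G H p M) {W : Set V} {e : E} (he : G.inc e ⊆ W) {f : F}
    (hf : f ∈ M e) : H.inc f ⊆ partColors G H p M r W := by
  intro x hx
  have hpx := (h.cov.bijOn hf).mapsTo hx
  refine ⟨he hpx, fun hxr => ⟨hxr, ?_⟩⟩
  obtain ⟨c, hc, hmin⟩ := h.minimal f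
  have hrange : H.inc f ⊆ Set.range c := by
    by_contra hno
    refine h.not_colorable ⟨c, fun a _ => hc a, fun f' hf' => ?_⟩
    rw [Set.image_univ] at hf'
    exact hno (hmin f' hf' ▸ hf')
  have hxc : ∀ y ∈ H.inc f, c (p y) = y := by
    intro y hy
    obtain ⟨a, rfl⟩ := hrange hy
    rw [hc]
  refine ⟨c, e, ⟨fun a _ => hc a, fun f' hf' => ?_⟩, he, hxr ▸ hpx, f, hf, hx, fun a ha _ => ?_⟩
  · obtain rfl := hmin f' (hf'.trans (Set.image_subset_range _ _))
    obtain ⟨a, ha, rfl⟩ := hf' hx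
    exact ha ((hc a).symm.trans hxr)
  · obtain ⟨y, hy, rfl⟩ := (h.cov.bijOn hf).surjOn ha
    rwa [hxc y hy]

theorem inc_subset_of_cover (h : Cov G H p M) {W : Set V} {e : E} {f : F} (hf : f ∈ M e)
    (hs : H.inc f ⊆ partColors G H p M r W) : G.inc e ⊆ W := by
  intro a ha
  obtain ⟨x, hx, rfl⟩ := (h.bijOn hf).surjOn ha
  exact (hs hx).1

/-- The vertex of a colour in the part over `W`. -/
def partMap (G : MultiHypergraph V E) (H : MultiHypergraph C F) (p : C → V) (M : E → Set F)
    (r : V) (W : Set V) (x : partColors G H p M r W) : W := ⟨p x, x.2.1⟩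

/-- The matchings of the part over `W`. -/
def partMatching (G : MultiHypergraph V E) (H : MultiHypergraph C F) (p : C → V) (M : E → Set F)
    (r : V) (W : Set V) (e : {e | G.inc e ⊆ W}) :
    Set {f | H.inc f ⊆ partColors G H p M r W} := {f | f.1 ∈ M e.1}

theorem cov_part (h : Critical G H p M) :
    Cov (G.induce W₁) (H.induce (partColors G H p M r W₁)) (partMap G H p M r W₁)
      (partMatching G H p M r W₁) where
  matching hf hf' hx hx' := Subtype.ext (h.cov.matching hf hf' hx hx')
  bijOn {e f} hf := by
    have hb := h.cov.bijOn (e := e.1) (f := f.1) hf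
    refine ⟨fun x hx => hb.mapsTo hx, fun x hx y hy hxy => ?_, fun a ha => ?_⟩
    · exact Subtype.ext (hb.injOn hx hy (congrArg Subtype.val hxy))
    · obtain ⟨x, hx, hxa⟩ := hb.surjOn ha
      exact ⟨⟨x, f.2 hx⟩, hx, Subtype.ext hxa⟩
  exists_mem f := by
    obtain ⟨e, he⟩ := h.cov.exists_mem f.1
    exact ⟨⟨e, inc_subset_of_cover h.cov he f.2⟩, he⟩

/-- At `r`, a colouring with a hole assigns different forbidden colours to the edges within `W₁`,
and these are side colours. Elsewhere the whole fibre is kept. -/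
theorem degree_le_part [Nonempty C] (h : Critical G H p M) (s : Separation G r W₁ W₂) (a : W₁) :
    (G.induce W₁).degree a ≤ (partMap G H p M r W₁ ⁻¹' {a}).ncard := by
  have hfinE := G.finite_edges
  have hfinC := H.finite_vertices
  have h1 : (Subtype.val '' (partMap G H p M r W₁ ⁻¹' {a})).ncard =
    (partMap G H p M r W₁ ⁻¹' {a}).ncard := Set.ncard_image_of_injective _ Subtype.val_injective
  have h2 : (Subtype.val '' {e | a ∈ (G.induce W₁).inc e}).ncard = (G.induce W₁).degree a :=
    Set.ncard_image_of_injective _ Subtype.val_injective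
  rw [← h1, ← h2]
  by_cases har : a.1 = r
  · obtain ⟨c, hc⟩ := h.exists_hole_coloring r
    have hole := h.cov.hole (h.degree_le r) h.not_colorable hc
    choose! g hg1 hg2 using hole.2.1
    refine Set.ncard_le_ncard_of_injOn g ?_ ?_ (Set.toFinite _)
    · rintro _ ⟨e, he, rfl⟩
      have hre : r ∈ G.inc e.1 := har ▸ he
      refine ⟨⟨g e.1, ?_, fun _ => ⟨hg1 _ hre, c, e.1, hc, e.2, hg2 _ hre⟩⟩, ?_, rfl⟩
      · rw [hg1 _ hre]; exact s.mem_left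
      · exact Subtype.ext ((hg1 _ hre).trans har.symm)
    · rintro _ ⟨e, he, rfl⟩ _ ⟨e', he', rfl⟩ hee
      have hre : r ∈ G.inc e.1 := har ▸ he
      have hre' : r ∈ G.inc e'.1 := har ▸ he'
      exact hole.2.2.1 _ _ _ (hg1 _ hre) (hg2 _ hre) (hee ▸ hg2 _ hre')
  · have h3 := h.degree_le a
    refine le_trans (Set.ncard_le_ncard ?_ (Set.toFinite _))
      (h3.trans (Set.ncard_le_ncard ?_ (Set.toFinite _)))
    · rintro _ ⟨e, he, rfl⟩
      exact he
    · intro x hx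
      have hx' : p x = a := hx
      exact ⟨⟨x, by rw [hx']; exact a.2, fun h => absurd (hx'.symm.trans h) har⟩,
        Subtype.ext hx', rfl⟩

/-- Extend a colouring of the part by one of `G` with a hole at `r`. Some edge forbids the colour
used at `r`: an edge within `W₁` contradicts properness, and one within `W₂` makes this a side
colour of both sides. -/
theorem not_colorable_part [Nonempty C] (h : Critical G H p M) (s : Separation G r W₁ W₂) :
    ¬ ∃ c, ProperOn (H.induce (partColors G H p M r W₁)) (partMap G H p M r W₁) Set.univ c := by
  classical
  rintro ⟨c₁, hc₁, hp₁⟩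
  obtain ⟨c₀, hc₀⟩ := h.exists_hole_coloring r
  let c : V → C := fun a => if ha : a ∈ W₁ then (c₁ ⟨a, ha⟩).1 else c₀ a
  have hcW : ∀ a, ∀ ha : a ∈ W₁, c a = (c₁ ⟨a, ha⟩).1 := fun a ha => by simp [c, ha]
  have hcN : ∀ a, a ∉ W₁ → c a = c₀ a := fun a ha => by simp [c, ha]
  have hpc : ∀ a, a ∈ W₁ → p (c a) = a := fun a ha => by
    rw [hcW a ha]
    exact congrArg Subtype.val (hc₁ ⟨a, ha⟩ trivial)
  have hno : ∀ e f, f ∈ M e → G.inc e ⊆ W₁ → ¬ ∀ a ∈ G.inc e, c a ∈ H.inc f := by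
    intro e f hf he hall
    refine hp₁ ⟨f, h.cover_inc_subset he hf⟩ ?_
    rintro ⟨x, hx⟩ hxf
    have hxf' : x ∈ H.inc f := hxf
    have hpx := (h.cov.bijOn hf).mapsTo hxf'
    refine ⟨⟨p x, he hpx⟩, trivial, Subtype.ext ?_⟩
    rw [← hcW]
    exact (h.cov.bijOn hf).injOn (hall _ hpx) hxf' (hpc _ (he hpx))
  have hc : ProperOn H p {r}ᶜ c := by
    rw [h.cov.properOn_iff]
    refine ⟨fun a ha => ?_, fun e f hf hall => ?_⟩
    · by_cases haW : a ∈ W₁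
      · exact hpc a haW
      · rw [hcN a haW]; exact hc₀.1 a ha
    · rcases s.inc_subset e with he | he
      · exact hno e f hf he fun a ha => (hall a ha).2
      · refine (h.cov.properOn_iff.1 hc₀).2 e f hf fun a ha => ?_
        have h1 : a ∉ W₁ := fun h1 => (hall a ha).1 (s.eq_of_mem a h1 (he ha))
        rw [← hcN a h1]
        exact hall a ha
  have hr₁ : c r ∈ partColors G H p M r W₁ := by rw [hcW r s.mem_left]; exact (c₁ _).2
  have hpr := hpc r s.mem_left
  obtain ⟨e, hre, f, hf, hxf, hall⟩ :=
    (h.cov.hole (h.degree_le r) h.not_colorable hc).1 (c r) hpr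
  rcases s.inc_subset e with he | he
  · refine hno e f hf he fun a ha => ?_
    by_cases har : a = r
    · rwa [har]
    · exact hall a ha har
  · exact h.disjoint_sideColors s (hr₁.2 hpr) ⟨hpr, c, e, hc, he, hre, f, hf, hxf, hall⟩

/-- For minimality, a choice of colours for `G` whose only conflict is the given edge is restricted
to the side. -/
theorem part [Nonempty C] (h : Critical G H p M) (s : Separation G r W₁ W₂) :
    Critical (G.induce W₁) (H.induce (partColors G H p M r W₁)) (partMap G H p M r W₁)
      (partMatching G H p M r W₁) where
  cov := h.cov_part
  preconnected := s.connected h.preconnected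
  degree_le := h.degree_le_part s
  not_colorable := h.not_colorable_part s
  minimal f := by
    obtain ⟨c, hc, hmin⟩ := h.minimal f.1
    have hpart : ∀ W, c r ∈ partColors G H p M r W → ∀ a ∈ W, c a ∈ partColors G H p M r W := by
      intro W hr a ha
      refine ⟨by rwa [hc], fun har => ?_⟩
      rw [hc] at har
      rw [har]
      exact hr.2 (hc r)
    -- If the colour of `r` belonged to the other side, the restriction to that side would be free
    -- of conflicts, contradicting its uncolorability.
    rcases h.mem_partColors_or s (c r) with h1 | h1
    · refine ⟨fun a => ⟨c a, hpart W₁ h1 a a.2⟩, fun a => Subtype.ext (hc a), fun f' hf' => ?_⟩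
      refine Subtype.ext (hmin f'.1 fun x hx => ?_)
      obtain ⟨a, ha⟩ := hf' (show (⟨x, f'.2 hx⟩ : partColors G H p M r W₁) ∈ _ from hx)
      exact ⟨a.1, congrArg Subtype.val ha⟩
    · refine (h.not_colorable_part s.symm ⟨fun a => ⟨c a, hpart W₂ h1 a a.2⟩,
        fun a _ => Subtype.ext (hc a), fun f' hf' => ?_⟩).elim
      have : f'.1 = f.1 := by
        refine hmin f'.1 fun x hx => ?_
        obtain ⟨a, -, ha⟩ := hf' (show (⟨x, f'.2 hx⟩ : partColors G H p M r W₂) ∈ _ from hx)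
        exact ⟨a.1, congrArg Subtype.val ha⟩
      obtain ⟨x, hx⟩ := H.exists_mem_inc f.1
      exact h.disjoint_partColors s x (f.2 hx) (f'.2 (this ▸ hx))

/-- A minimal uncolorable configuration with a separation arises by merging its two parts. -/
noncomputable def merging [Nonempty C] (h : Critical G H p M) (s : Separation G r W₁ W₂) :
    Merging (G.induce W₁) (fun a => partMap G H p M r W₁ ⁻¹' {a})
      (H.induce (partColors G H p M r W₁)) ⟨r, s.mem_left⟩
      (G.induce W₂) (fun a => partMap G H p M r W₂ ⁻¹' {a})
      (H.induce (partColors G H p M r W₂)) ⟨r, s.mem_right⟩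
      G (fun a => p ⁻¹' {a}) H where
  φ₁ := Subtype.val
  φ₂ := Subtype.val
  ε := sumEquivOfDisjoint (fun _ h₁ h₂ => s.not_both h₁ h₂) s.inc_subset
  κ := sumEquivOfDisjoint (h.disjoint_partColors s) (h.mem_partColors_or s)
  η := sumEquivOfDisjoint
    (fun f h₁ h₂ => by
      obtain ⟨x, hx⟩ := H.exists_mem_inc f
      exact h.disjoint_partColors s x (h₁ hx) (h₂ hx))
    (fun f => by
      obtain ⟨e, he⟩ := h.cov.exists_mem f
      exact (s.inc_subset e).imp (fun h1 => h.cover_inc_subset h1 he)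
        (fun h1 => h.cover_inc_subset h1 he))
  φ₁_injective := Subtype.val_injective
  φ₂_injective := Subtype.val_injective
  φ_eq_iff a b := by
    refine ⟨fun hab => ⟨Subtype.ext ?_, Subtype.ext ?_⟩, fun hab => by rw [hab.1, hab.2]⟩
    · exact s.eq_of_mem _ a.2 (hab ▸ b.2)
    · exact s.eq_of_mem _ (hab ▸ a.2) b.2
  φ_surjective c := by simpa using s.mem_or c
  inc_left e := (G.image_induce_inc W₁ e).symm
  inc_right e := (G.image_induce_inc W₂ e).symm
  cover_inc_left f := (H.image_induce_inc _ f).symm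
  cover_inc_right f := (H.image_induce_inc _ f).symm
  X_merged := by
    ext x
    constructor
    · intro hx
      rcases h.mem_partColors_or s x with h1 | h1
      · exact Or.inl ⟨⟨x, h1⟩, Subtype.ext hx, rfl⟩
      · exact Or.inr ⟨⟨x, h1⟩, Subtype.ext hx, rfl⟩
    · rintro (⟨y, hy, rfl⟩ | ⟨y, hy, rfl⟩)
      · exact congrArg Subtype.val hy
      · exact congrArg Subtype.val hy
  X_left a ha := by
    ext x
    constructor
    · intro hx
      have hx' : p x = a := hx
      refine ⟨⟨x, ?_, fun hr => ?_⟩, Subtype.ext hx', rfl⟩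
      · rw [hx']; exact a.2
      · exact absurd (Subtype.ext (hx'.symm.trans hr)) ha
    · rintro ⟨y, hy, rfl⟩
      exact congrArg Subtype.val hy
  X_right a ha := by
    ext x
    constructor
    · intro hx
      have hx' : p x = a := hx
      refine ⟨⟨x, ?_, fun hr => ?_⟩, Subtype.ext hx', rfl⟩
      · rw [hx']; exact a.2
      · exact absurd (Subtype.ext (hx'.symm.trans hr)) ha
    · rintro ⟨y, hy, rfl⟩
      exact congrArg Subtype.val hy

/-- Any colour of a single vertex would already colour it, so there are none; this is the
K-configuration with `n = 1`. -/
theorem isKConfiguration_of_subsingleton [Subsingleton V] (h : Critical G H p M) :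
    IsKConfiguration G (fun a => p ⁻¹' {a}) H := by
  have hC : IsEmpty C := by
    refine ⟨fun x => h.not_colorable ⟨fun _ => x, ?_⟩⟩
    have := properOn_singleton (H := H) (p := p) x
    rwa [show ({p x} : Set V) = Set.univ from Set.eq_univ_of_forall fun a =>
      Subsingleton.elim a (p x)] at this
  have hF : IsEmpty F := ⟨fun f => by
    obtain ⟨x, -⟩ := H.exists_mem_inc f
    exact hC.elim x⟩
  have hE : IsEmpty E := ⟨fun e => by
    obtain ⟨a, ha⟩ := G.exists_mem_inc e
    obtain ⟨b, -, hb⟩ := G.exists_mem_ne e a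
    exact hb (Subsingleton.elim _ _)⟩
  have hV : Nonempty V := by
    by_contra hV
    rw [not_nonempty_iff] at hV
    exact h.not_colorable ⟨fun a => isEmptyElim a, fun a => isEmptyElim a, fun f => hF.elim f⟩
  obtain ⟨a⟩ := hV
  refine ⟨h.cov.isCover, 1, 1, le_rfl, le_rfl, ⟨Equiv.ofBijective (fun _ => a) ⟨?_, ?_⟩,
    fun e => hE.elim e, fun i j hij => absurd (Subsingleton.elim i j) hij⟩, fun _ => Fin.elim0,
    fun _ => ⟨fun i => i.elim0, ?_⟩, fun i => i.elim0, fun f => hF.elim f⟩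
  · exact fun _ _ _ => Subsingleton.elim _ _
  · exact fun b => ⟨0, Subsingleton.elim _ _⟩
  · ext x
    exact hC.elim x

/-- Strong induction on the number of vertices. The types are quantified inside because the two
parts live on subtypes. -/
theorem constructible : ∀ (n : ℕ) {V : Type u} {E : Type v} {C : Type w} {F : Type z}
    {G : MultiHypergraph V E} {H : MultiHypergraph C F} {p : C → V} {M : E → Set F},
    Critical G H p M → Nat.card V = n → Constructible G (fun a => p ⁻¹' {a}) H := by
  intro n
  induction n using Nat.strong_induction_on with
  | _ n ih =>
    intro V E C F G H p M h hn
    have hfin := G.finite_vertices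
    have hfinC := H.finite_vertices
    have hfinE := G.finite_edges
    rcases subsingleton_or_nontrivial V with hV | hV
    · exact .ofK h.isKConfiguration_of_subsingleton
    obtain ⟨a, b, hab⟩ := exists_pair_ne V
    obtain ⟨e, ha⟩ : ∃ e, a ∈ G.inc e := by
      obtain hab' := h.preconnected a b
      revert hab
      refine hab'.head_induction (P := fun a => a ≠ b → ∃ e, a ∈ G.inc e) (fun h => absurd rfl h) ?_
      rintro x y ⟨-, e, hx, -⟩ - - -
      exact ⟨e, hx⟩
    have hC : Nonempty C := by
      have h1 := h.degree_le a
      have h2 : 0 < G.degree a := (Set.ncard_pos (Set.toFinite _)).2 ⟨e, ha⟩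
      obtain ⟨x, -⟩ := Set.nonempty_of_ncard_ne_zero (by omega : (p ⁻¹' {a}).ncard ≠ 0)
      exact ⟨x⟩
    by_cases hcut : G.adjGraph.NoCutVertex
    · have hb : UncolorableBlock G H p M :=
        ⟨h.cov, h.preconnected, hcut, h.degree_le, h.not_colorable⟩
      rcases hb.classification e with h1 | h1 | h1
      · exact .ofK h1
      · exact .ofC h1
      · exact .ofE h1
    · obtain ⟨r, W₁, W₂, a, b, s, ha, hb⟩ := exists_separation hcut
      have hlt : ∀ (W : Set V) a, a ∉ W → Nat.card W < n := by
        intro W a ha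
        rw [← hn, Nat.card_coe_set_eq]
        exact Set.ncard_lt_card (fun h => ha (h ▸ Set.mem_univ a))
      exact .merge _ _ (ih _ (hlt W₁ a ha) (h.part s) rfl) (ih _ (hlt W₂ b hb) (h.part s.symm) rfl)
        (h.merging s)

end Critical

/-- Minimal uncolorable degree-feasible configurations are constructible. -/
theorem MinimalUncolorable.constructible {X : V → Set C} (hGXH : DegreeFeasible G X H)
    (hm : MinimalUncolorable G X H) : Constructible G X H := by
  obtain ⟨p, M, hcov, rfl⟩ := hGXH.cover.exists_cov
  refine Critical.constructible _ (M := M) ⟨hcov, hGXH.connected.preconnected, hGXH.degree_le,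
    fun hc => hm.not_colorable (exists_proper_iff_colorable.1 hc), fun f => ?_⟩ rfl
  obtain ⟨c, hc1, hc2⟩ := exists_proper_iff_colorable.2 (hm.colorable_deleteEdge f)
  refine ⟨c, fun a => hc1 a trivial, fun f' hf' => ?_⟩
  by_contra hne
  refine hc2 ⟨f', hne⟩ ?_
  rw [Set.image_univ]
  exact hf'

end

end DPColoring

/-! ### Constructible configurations: mergings -/

namespace DPColoring

open MultiHypergraph

/-- Uncolorable, but colorable after deletion of any edge of the cover, and after deletion of any
vertex. -/
structure Robust {V : Type u} {C : Type w} {F : Type z} (X : V → Set C)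
    (H : MultiHypergraph C F) : Prop where
  not_colorable : ¬ Colorable X H
  colorable_deleteEdge : ∀ f, Colorable X (H.deleteEdge f)
  colorable_deleteVertex : ∀ v, ∃ T : Set C, T ∩ X v = ∅ ∧ (∀ a, a ≠ v → (T ∩ X a).ncard = 1) ∧
    H.Independent T

namespace Merging

variable {V V₁ V₂ : Type u} {E E₁ E₂ : Type v} {C C₁ C₂ : Type w} {F F₁ F₂ : Type z}
  {G₁ : MultiHypergraph V₁ E₁} {X₁ : V₁ → Set C₁} {H₁ : MultiHypergraph C₁ F₁} {v₁ : V₁}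
  {G₂ : MultiHypergraph V₂ E₂} {X₂ : V₂ → Set C₂} {H₂ : MultiHypergraph C₂ F₂} {v₂ : V₂}
  {G : MultiHypergraph V E} {X : V → Set C} {H : MultiHypergraph C F}

/-- The two parts of a merging can be exchanged. -/
def symm (m : Merging G₁ X₁ H₁ v₁ G₂ X₂ H₂ v₂ G X H) :
    Merging G₂ X₂ H₂ v₂ G₁ X₁ H₁ v₁ G X H where
  φ₁ := m.φ₂
  φ₂ := m.φ₁
  ε := (Equiv.sumComm _ _).trans m.ε
  κ := (Equiv.sumComm _ _).trans m.κ
  η := (Equiv.sumComm _ _).trans m.η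
  φ₁_injective := m.φ₂_injective
  φ₂_injective := m.φ₁_injective
  φ_eq_iff a b := by rw [eq_comm, m.φ_eq_iff, and_comm]
  φ_surjective c := (m.φ_surjective c).symm
  inc_left := m.inc_right
  inc_right := m.inc_left
  cover_inc_left := m.cover_inc_right
  cover_inc_right := m.cover_inc_left
  X_merged := by
    rw [← (m.φ_eq_iff v₁ v₂).2 ⟨rfl, rfl⟩, m.X_merged, Set.union_comm]
    rfl
  X_left := m.X_right
  X_right := m.X_left

/-- The union of the images of two colour sets. -/
def combine (m : Merging G₁ X₁ H₁ v₁ G₂ X₂ H₂ v₂ G X H) (T₁ : Set C₁) (T₂ : Set C₂) : Set C :=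
  {x | (∃ y ∈ T₁, m.κ (Sum.inl y) = x) ∨ ∃ y ∈ T₂, m.κ (Sum.inr y) = x}

variable (m : Merging G₁ X₁ H₁ v₁ G₂ X₂ H₂ v₂ G X H) {T₁ : Set C₁} {T₂ : Set C₂}

theorem combine_symm : m.symm.combine T₂ T₁ = m.combine T₁ T₂ := by
  ext x
  exact or_comm

theorem left_mem_combine {y : C₁} : m.κ (Sum.inl y) ∈ m.combine T₁ T₂ ↔ y ∈ T₁ := by
  constructor
  · rintro (⟨z, hz, h⟩ | ⟨z, hz, h⟩)
    · cases m.κ.injective h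
      exact hz
    · cases m.κ.injective h
  · exact fun h => Or.inl ⟨y, h, rfl⟩

theorem exists_eq_combine (T : Set C) : ∃ T₁ T₂, T = m.combine T₁ T₂ := by
  refine ⟨(fun x => m.κ (Sum.inl x)) ⁻¹' T, (fun x => m.κ (Sum.inr x)) ⁻¹' T, ?_⟩
  ext x
  constructor
  · intro hx
    obtain ⟨y | y, rfl⟩ := m.κ.surjective x
    · exact Or.inl ⟨y, hx, rfl⟩
    · exact Or.inr ⟨y, hx, rfl⟩
  · rintro (⟨y, hy, rfl⟩ | ⟨y, hy, rfl⟩) <;> exact hy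

theorem injective_left : Function.Injective fun x => m.κ (Sum.inl x) :=
  m.κ.injective.comp Sum.inl_injective

theorem ncard_combine_left {a : V₁} (ha : a ≠ v₁) :
    (m.combine T₁ T₂ ∩ X (m.φ₁ a)).ncard = (T₁ ∩ X₁ a).ncard := by
  have : m.combine T₁ T₂ ∩ X (m.φ₁ a) = (fun x => m.κ (Sum.inl x)) '' (T₁ ∩ X₁ a) := by
    rw [m.X_left a ha]
    ext x
    constructor
    · rintro ⟨hx, y, hy, rfl⟩
      exact ⟨y, ⟨m.left_mem_combine.1 hx, hy⟩, rfl⟩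
    · rintro ⟨y, hy, rfl⟩
      exact ⟨m.left_mem_combine.2 hy.1, y, hy.2, rfl⟩
  rw [this, Set.ncard_image_of_injective _ m.injective_left]

theorem ncard_combine_right {b : V₂} (hb : b ≠ v₂) :
    (m.combine T₁ T₂ ∩ X (m.φ₂ b)).ncard = (T₂ ∩ X₂ b).ncard := by
  rw [← m.combine_symm]
  exact m.symm.ncard_combine_left hb

theorem ncard_combine_merged :
    (m.combine T₁ T₂ ∩ X (m.φ₁ v₁)).ncard = (T₁ ∩ X₁ v₁).ncard + (T₂ ∩ X₂ v₂).ncard := by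
  have hf₁ := H₁.finite_vertices
  have hf₂ := H₂.finite_vertices
  have : m.combine T₁ T₂ ∩ X (m.φ₁ v₁) =
      (fun x => m.κ (Sum.inl x)) '' (T₁ ∩ X₁ v₁) ∪ (fun x => m.κ (Sum.inr x)) '' (T₂ ∩ X₂ v₂) := by
    rw [m.X_merged]
    ext x
    constructor
    · rintro ⟨hx, ⟨y, hy, rfl⟩ | ⟨y, hy, rfl⟩⟩
      · exact Or.inl ⟨y, ⟨m.left_mem_combine.1 hx, hy⟩, rfl⟩
      · rw [← m.combine_symm] at hx
        exact Or.inr ⟨y, ⟨m.symm.left_mem_combine.1 hx, hy⟩, rfl⟩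
    · rintro (⟨y, hy, rfl⟩ | ⟨y, hy, rfl⟩)
      · exact ⟨m.left_mem_combine.2 hy.1, Or.inl ⟨y, hy.2, rfl⟩⟩
      · refine ⟨?_, Or.inr ⟨y, hy.2, rfl⟩⟩
        rw [← m.combine_symm]
        exact m.symm.left_mem_combine.2 hy.1
  rw [this, Set.ncard_union_eq, Set.ncard_image_of_injective _ m.injective_left,
    Set.ncard_image_of_injective (f := fun x => m.κ (Sum.inr x)) _ m.symm.injective_left]
  rw [Set.disjoint_left]
  rintro _ ⟨y, -, rfl⟩ ⟨z, -, hz⟩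
  cases m.κ.injective hz

theorem inc_left_subset_combine {f : F₁} :
    H.inc (m.η (Sum.inl f)) ⊆ m.combine T₁ T₂ ↔ H₁.inc f ⊆ T₁ := by
  rw [m.cover_inc_left, Set.image_subset_iff]
  exact forall₂_congr fun y _ => m.left_mem_combine

theorem inc_right_subset_combine {f : F₂} :
    H.inc (m.η (Sum.inr f)) ⊆ m.combine T₁ T₂ ↔ H₂.inc f ⊆ T₂ := by
  rw [← m.combine_symm]
  exact m.symm.inc_left_subset_combine

theorem forall_vertex {P : V → Prop} : (∀ c, P c) ↔
    P (m.φ₁ v₁) ∧ (∀ a, a ≠ v₁ → P (m.φ₁ a)) ∧ ∀ b, b ≠ v₂ → P (m.φ₂ b) := by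
  refine ⟨fun h => ⟨h _, fun a _ => h _, fun b _ => h _⟩, fun ⟨h1, h2, h3⟩ c => ?_⟩
  rcases m.φ_surjective c with ⟨a, rfl⟩ | ⟨b, rfl⟩
  · by_cases ha : a = v₁
    · rwa [ha]
    · exact h2 a ha
  · by_cases hb : b = v₂
    · rw [hb, ← (m.φ_eq_iff v₁ v₂).2 ⟨rfl, rfl⟩]
      exact h1
    · exact h3 b hb

theorem forall_cover_edge {P : F → Prop} : (∀ f, P f) ↔
    (∀ f, P (m.η (Sum.inl f))) ∧ ∀ f, P (m.η (Sum.inr f)) := by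
  rw [← m.η.forall_congr_right, Sum.forall]

/-- The merged vertex owns the colours of both `v₁` and `v₂`, so it is coloured on exactly one of
the two sides. -/
theorem isTransversal_combine : IsTransversal X (m.combine T₁ T₂) ↔
    (T₁ ∩ X₁ v₁).ncard + (T₂ ∩ X₂ v₂).ncard = 1 ∧ (∀ a, a ≠ v₁ → (T₁ ∩ X₁ a).ncard = 1) ∧
      ∀ b, b ≠ v₂ → (T₂ ∩ X₂ b).ncard = 1 := by
  rw [IsTransversal, m.forall_vertex, m.ncard_combine_merged]
  refine and_congr_right fun _ => and_congr ?_ ?_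
  · exact forall₂_congr fun a ha => by rw [m.ncard_combine_left ha]
  · exact forall₂_congr fun a ha => by rw [m.ncard_combine_right ha]

theorem independent_combine : H.Independent (m.combine T₁ T₂) ↔
    H₁.Independent T₁ ∧ H₂.Independent T₂ := by
  rw [Independent, m.forall_cover_edge]
  simp only [m.inc_left_subset_combine, m.inc_right_subset_combine]
  rfl

/-- The left part without `f` also colours the merged vertex, so the right part has to be coloured
with `v₂` omitted. This is where deletion of vertices is needed. -/
theorem colorable_delete_left (h₁ : Robust X₁ H₁) (h₂ : Robust X₂ H₂) (f : F₁) :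
    Colorable X (H.deleteEdge (m.η (Sum.inl f))) := by
  obtain ⟨T₁, ht, hi⟩ := h₁.colorable_deleteEdge f
  obtain ⟨T₂, h0, ht₂, hi₂⟩ := h₂.colorable_deleteVertex v₂
  refine ⟨m.combine T₁ T₂, m.isTransversal_combine.2 ⟨?_, fun a _ => ht a, ht₂⟩, ?_⟩
  · rw [h0, ht v₁, Set.ncard_empty]
  · have : ∀ f', f' ≠ m.η (Sum.inl f) → ¬ H.inc f' ⊆ m.combine T₁ T₂ := by
      rw [m.forall_cover_edge]
      refine ⟨fun f' hne => ?_, fun f' _ => ?_⟩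
      · rw [m.inc_left_subset_combine]
        exact hi ⟨f', fun h => hne (by rw [h])⟩
      · rw [m.inc_right_subset_combine]
        exact hi₂ f'
    exact fun f' => this f'.1 f'.2

theorem colorable_delete_vertex_left (h₁ : Robust X₁ H₁) (h₂ : Robust X₂ H₂) (a : V₁) :
    ∃ T : Set C, T ∩ X (m.φ₁ a) = ∅ ∧ (∀ c, c ≠ m.φ₁ a → (T ∩ X c).ncard = 1) ∧
      H.Independent T := by
  have hfin := H.finite_vertices
  obtain ⟨T₁, h0₁, ht₁, hi₁⟩ := h₁.colorable_deleteVertex a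
  obtain ⟨T₂, h0₂, ht₂, hi₂⟩ := h₂.colorable_deleteVertex v₂
  refine ⟨m.combine T₁ T₂, ?_, ?_, m.independent_combine.2 ⟨hi₁, hi₂⟩⟩
  · rw [← Set.ncard_eq_zero (Set.toFinite _)]
    by_cases ha : a = v₁
    · subst ha
      rw [m.ncard_combine_merged, h0₁, h0₂, Set.ncard_empty]
      simp
    · rw [m.ncard_combine_left ha, h0₁, Set.ncard_empty]
  · rw [m.forall_vertex]
    refine ⟨fun hne => ?_, fun a' ha' hne => ?_, fun b hb _ => ?_⟩
    · rw [m.ncard_combine_merged, h0₂, Set.ncard_empty, ht₁ v₁ (fun h => hne (congrArg m.φ₁ h))]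
    · rw [m.ncard_combine_left ha', ht₁ a' (fun h => hne (congrArg m.φ₁ h))]
    · rw [m.ncard_combine_right hb, ht₂ b hb]

/-- In a colouring of the merging, the side that provides the colour of the merged vertex would be
completely coloured; hence uncolorability is inherited. -/
theorem robust (m : Merging G₁ X₁ H₁ v₁ G₂ X₂ H₂ v₂ G X H) (h₁ : Robust X₁ H₁) (h₂ : Robust X₂ H₂) : Robust X H where
  not_colorable := by
    rintro ⟨T, hT, hi⟩
    obtain ⟨T₁, T₂, rfl⟩ := m.exists_eq_combine T
    rw [m.isTransversal_combine] at hT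
    rw [m.independent_combine] at hi
    obtain ⟨h0, ht₁, ht₂⟩ := hT
    rcases Nat.eq_zero_or_pos (T₁ ∩ X₁ v₁).ncard with h | h
    · refine h₂.not_colorable ⟨T₂, fun b => ?_, hi.2⟩
      by_cases hb : b = v₂
      · subst hb; omega
      · exact ht₂ b hb
    · refine h₁.not_colorable ⟨T₁, fun a => ?_, hi.1⟩
      by_cases ha : a = v₁
      · subst ha; omega
      · exact ht₁ a ha
  colorable_deleteEdge := by
    rw [m.forall_cover_edge]
    exact ⟨fun f => m.colorable_delete_left h₁ h₂ f, fun f => m.symm.colorable_delete_left h₂ h₁ f⟩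
  colorable_deleteVertex v := by
    rcases m.φ_surjective v with ⟨a, rfl⟩ | ⟨b, rfl⟩
    · exact m.colorable_delete_vertex_left h₁ h₂ a
    · exact m.symm.colorable_delete_vertex_left h₂ h₁ b

end Merging

/-! ### Constructible configurations: E- and K-configurations -/

section

variable {V : Type u} {E : Type v} {C : Type w} {F : Type z}
variable {G : MultiHypergraph V E} {X : V → Set C} {H : MultiHypergraph C F}

/-- The only choice of colours consists of all colours, and the single edge of the cover contains
all of them. -/
theorem IsEConfiguration.robust (h : IsEConfiguration G X H) : Robust X H := by
  obtain ⟨hcov, ⟨e, he, hE⟩, hX, φ, ψ, hψ⟩ := h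
  have hinc : ∀ f, H.inc f = Set.univ := by
    intro f
    have h1 := hψ f
    rw [hE (ψ f), he] at h1
    refine Set.eq_univ_of_forall fun x => ?_
    have : φ x ∈ φ '' H.inc f := h1 ▸ Set.mem_univ _
    simpa using this
  refine ⟨?_, fun f => ⟨Set.univ, fun a => by rw [Set.univ_inter, hX], fun f' => ?_⟩, fun v =>
    ⟨(X v)ᶜ, by simp, fun a ha => ?_, fun f hf => ?_⟩⟩
  · rintro ⟨T, hT, hi⟩
    refine hi (ψ.symm e) fun x _ => ?_
    obtain ⟨a, ha⟩ : ∃ a, x ∈ X a := by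
      have : x ∈ ⋃ a, X a := hcov.iUnion_eq ▸ Set.mem_univ x
      simpa using this
    obtain ⟨y, hy⟩ := Set.ncard_eq_one.1 (hT a)
    obtain ⟨y', hy'⟩ := Set.ncard_eq_one.1 (hX a)
    have h1 : y ∈ T ∩ X a := hy ▸ rfl
    have h2 := h1.2
    rw [hy'] at h2 ha
    rw [show x = y from ha.trans h2.symm]
    exact h1.1
  · exact (f'.2 (ψ.injective ((hE _).trans (hE _).symm))).elim
  · rw [Set.inter_eq_right.2, hX]
    exact Set.subset_compl_iff_disjoint_right.2 (hcov.disjoint a v ha)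
  · rw [hinc] at hf
    obtain ⟨y, hy⟩ := Set.ncard_eq_one.1 (hX v)
    have h1 : y ∈ X v := hy ▸ rfl
    exact hf (Set.mem_univ y) h1

/-- A criterion for covers by ordinary edges which are described by classes `P a i` of colours, such
that the colours of any two related classes are completely joined. -/
theorem robust_of_classes {I : Type*} (hcov : IsCover G X H) {P : V → I → Set C}
    (hP : ∀ a, IsPartition (P a) (X a)) (hne : ∀ a i, (P a i).Nonempty)
    {R : V → I → V → I → Prop} (hR : ∀ a i b j, R a i b j → a ≠ b)
    (hedge : ∀ f, ∃ a i b j, R a i b j ∧ ∃ x ∈ P a i, ∃ y ∈ P b j, H.inc f = {x, y})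
    (huniq : ∀ a i b j, R a i b j → ∀ x ∈ P a i, ∀ y ∈ P b j, ∃! f, H.inc f = {x, y})
    (hunc : ∀ g : V → I, ∃ a b, R a (g a) b (g b))
    (hcrit : ∀ a i b j, R a i b j → ∃ g : V → I, g a = i ∧ g b = j ∧
      ∀ a' b', R a' (g a') b' (g b') → ({a', b'} : Set V) = {a, b})
    (hdel : ∀ v, ∃ g : V → I, ∀ a b, a ≠ v → b ≠ v → ¬ R a (g a) b (g b)) : Robust X H := by
  classical
  obtain ⟨p, M, -, rfl⟩ := hcov.exists_cov
  have hp : ∀ a i x, x ∈ P a i → p x = a := by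
    intro a i x hx
    have : x ∈ ⋃ i, P a i := Set.mem_iUnion.2 ⟨i, hx⟩
    rw [(hP a).2] at this
    exact this
  have hpi : ∀ a i j x, x ∈ P a i → x ∈ P a j → i = j := by
    intro a i j x hx hx'
    by_contra hij
    exact Set.disjoint_left.1 ((hP a).1 i j hij) hx hx'
  have hex : ∀ a x, p x = a → ∃ i, x ∈ P a i := by
    intro a x hx
    have : x ∈ ⋃ i, P a i := by rw [(hP a).2]; exact hx
    exact Set.mem_iUnion.1 this
  have hrep : ∀ (ρ : V → C) (g : V → I), (∀ a, ρ a ∈ P a (g a)) → ∀ (A : Set V) f,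
      H.inc f ⊆ ρ '' A → ∃ a ∈ A, ∃ b ∈ A, R a (g a) b (g b) ∧ H.inc f = {ρ a, ρ b} := by
    intro ρ g hρ A f hf
    obtain ⟨a, i, b, j, hr, x, hx, y, hy, hxy⟩ := hedge f
    rw [hxy] at hf
    obtain ⟨a', ha', rfl⟩ := hf (Set.mem_insert x _)
    obtain ⟨b', hb', rfl⟩ := hf (Set.mem_insert_of_mem _ rfl)
    obtain rfl : a' = a := (hp _ _ _ (hρ a')).symm.trans (hp _ _ _ hx)
    obtain rfl : b' = b := (hp _ _ _ (hρ b')).symm.trans (hp _ _ _ hy)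
    obtain rfl := hpi _ _ _ _ (hρ a') hx
    obtain rfl := hpi _ _ _ _ (hρ b') hy
    exact ⟨a', ha', b', hb', hr, hxy⟩
  have htrans : ∀ (ρ : V → C) (g : V → I), (∀ a, ρ a ∈ P a (g a)) → ∀ (A : Set V), ∀ a ∈ A,
      (ρ '' A ∩ p ⁻¹' {a}).ncard = 1 := by
    intro ρ g hρ A a ha
    rw [Set.ncard_eq_one]
    refine ⟨ρ a, Set.eq_singleton_iff_unique_mem.2 ⟨⟨⟨a, ha, rfl⟩, hp _ _ _ (hρ a)⟩, ?_⟩⟩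
    rintro _ ⟨⟨b, -, rfl⟩, hb⟩
    rw [show b = a from (hp _ _ _ (hρ b)).symm.trans hb]
  refine ⟨?_, fun f => ?_, fun v => ?_⟩
  · rintro ⟨T, hT, hi⟩
    choose c hc using fun a => Set.ncard_eq_one.1 (hT a)
    have hc' : ∀ a, c a ∈ T ∩ p ⁻¹' {a} := fun a => by rw [hc]; rfl
    choose g hg using fun a => hex a (c a) (hc' a).2
    obtain ⟨a, b, hr⟩ := hunc g
    obtain ⟨f, hf, -⟩ := huniq _ _ _ _ hr _ (hg a) _ (hg b)
    refine hi f ?_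
    rw [hf]
    rintro x (rfl | rfl)
    · exact (hc' a).1
    · exact (hc' b).1
  · obtain ⟨a, i, b, j, hr, x, hx, y, hy, hxy⟩ := hedge f
    obtain ⟨g, hga, hgb, hg⟩ := hcrit a i b j hr
    choose ρ₀ hρ₀ using hne
    have hab := hR _ _ _ _ hr
    -- The ends `x` and `y` of the deleted edge represent the classes at `a` and `b`, arbitrary
    -- colours the others. The only conflicting pair is `{a, b}`, and the deleted edge is the only
    -- one joining `x` and `y`.
    let ρ : V → C := Function.update (Function.update (fun a => ρ₀ a (g a)) b y) a x
    have hρa : ρ a = x := by simp [ρ]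
    have hρb : ρ b = y := by simp [ρ, hab.symm]
    have hρ : ∀ c, ρ c ∈ P c (g c) := by
      intro c
      by_cases hca : c = a
      · rw [hca, hρa, hga]; exact hx
      by_cases hcb : c = b
      · rw [hcb, hρb, hgb]; exact hy
      simpa [ρ, hca, hcb] using hρ₀ c (g c)
    refine ⟨ρ '' Set.univ, fun c => htrans ρ g hρ _ c trivial, fun f' hf' => f'.2 ?_⟩
    obtain ⟨a', -, b', -, hr', hinc⟩ := hrep ρ g hρ _ f'.1 hf'
    have hpair := hg a' b' hr'
    refine (huniq _ _ _ _ hr x hx y hy).unique ?_ hxy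
    rw [hinc, ← Set.image_pair, hpair, Set.image_pair, hρa, hρb]
  · obtain ⟨g, hg⟩ := hdel v
    choose ρ hρ using fun a => hne a (g a)
    refine ⟨ρ '' {v}ᶜ, ?_, fun a ha => htrans ρ g hρ _ a ha, fun f hf => ?_⟩
    · ext x
      simp only [Set.mem_inter_iff, Set.mem_empty_iff_false, iff_false]
      rintro ⟨⟨b, hb, rfl⟩, hx⟩
      exact hb ((hp _ _ _ (hρ b)).symm.trans hx)
    · obtain ⟨a, ha, b, hb, hr, -⟩ := hrep ρ g hρ _ f hf
      exact hg a b ha hb hr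

/-- The vertices other than `a` receive all labels bijectively, with a transposition moving `i` to
`b`; then `a` repeats the label of `b`. -/
theorem exists_injOn_labels [Finite V] {k : ℕ} (hk : Nat.card V = k + 1) {a b : V} (hab : a ≠ b)
    (i : Fin k) : ∃ g : V → Fin k, g a = i ∧ g b = i ∧ Set.InjOn g {a}ᶜ := by
  classical
  have hcard : Nat.card {u // u ≠ a} = k := by
    have := Fintype.ofFinite V
    rw [Nat.card_eq_fintype_card] at hk ⊢
    rw [Fintype.card_subtype_compl, hk]
    simp
  let σ : {u // u ≠ a} ≃ Fin k := Finite.equivFinOfCardEq hcard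
  let τ : {u // u ≠ a} ≃ Fin k := σ.trans (Equiv.swap (σ ⟨b, hab.symm⟩) i)
  refine ⟨fun u => if hu : u = a then i else τ ⟨u, hu⟩, by simp, ?_, ?_⟩
  · simp [hab.symm, τ]
  · intro u hu v hv huv
    simp only [Set.mem_compl_iff, Set.mem_singleton_iff] at hu hv
    simp only [hu, hv, dif_neg, not_false_eq_true] at huv
    exact congrArg Subtype.val (τ.injective huv)

/-- There is one class fewer than there are vertices, so two vertices always choose the same class;
by `exists_injOn_labels` this can be made to happen for one prescribed pair and class only. -/
theorem IsKConfiguration.robust (h : IsKConfiguration G X H) : Robust X H := by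
  obtain ⟨hcov, t, n, ht, hn, ⟨φ, -, -⟩, P, hP, hmulti, hedge⟩ := h
  have hfin := G.finite_vertices
  have hcard : Nat.card V = n := by
    rw [← Nat.card_congr φ, Nat.card_fin]
  obtain ⟨k, rfl⟩ : ∃ k, n = k + 1 := ⟨n - 1, by omega⟩
  change V → Fin k → Set C at P
  replace hP : ∀ a, IsPartition (ι := Fin k) (P a) (X a) := hP
  replace hmulti : ∀ i : Fin k, H.InducesCompleteMultipartite (fun a => P a i) t := hmulti
  replace hedge : ∀ f, ∃ i : Fin k, H.inc f ⊆ ⋃ a, P a i := hedge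
  rcases Nat.eq_zero_or_pos k with rfl | hk
  · have hX : ∀ a, X a = ∅ := fun a => by
      rw [← (hP a).2]
      exact Set.iUnion_of_empty _
    refine ⟨?_, fun f => ?_, fun v => ⟨∅, by simp, fun a ha => ?_, fun f => ?_⟩⟩
    · rintro ⟨T, hT, -⟩
      have := hT (φ 0)
      simp [hX] at this
    · exact (hedge f).choose.elim0
    · refine absurd ?_ ha
      rw [← φ.apply_symm_apply a, ← φ.apply_symm_apply v,
        @Subsingleton.elim (Fin 1) _ (φ.symm a) (φ.symm v)]
    · exact (hedge f).choose.elim0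
  have hdel : ∀ a b i, a ≠ b → ∃ g : V → Fin k, g a = i ∧ g b = i ∧
      ∀ a' b', a' ≠ b' ∧ g a' = g b' → ({a', b'} : Set V) = {a, b} := by
    intro a b i hab
    obtain ⟨g, hga, hgb, hinj⟩ := exists_injOn_labels hcard hab i
    refine ⟨g, hga, hgb, ?_⟩
    rintro a' b' ⟨hne, hg⟩
    by_cases ha : a' = a
    · subst ha
      rw [hinj (x₁ := b') (x₂ := b) hne.symm hab.symm (by rw [← hg, hga, hgb])]
    · by_cases hb : b' = a
      · subst hb
        rw [hinj (x₁ := a') (x₂ := b) ha hab.symm (by rw [hg, hga, hgb]), Set.pair_comm]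
      · exact absurd (hinj ha hb hg) hne
  refine robust_of_classes hcov hP (R := fun a i b j => a ≠ b ∧ i = j) (fun a i => ?_)
    (fun a i b j hr => hr.1) (fun f => ?_) ?_ (fun g => ?_) ?_ (fun v => ?_)
  · refine Set.nonempty_of_ncard_ne_zero ?_
    rw [(hmulti i).1 a]
    omega
  · obtain ⟨i, hi⟩ := hedge f
    obtain ⟨a, b, hab, x, hx, y, hy, hxy⟩ := (hmulti i).2.2.1 f hi
    exact ⟨a, i, b, i, ⟨hab, rfl⟩, x, hx, y, hy, hxy⟩
  · rintro a i b _ ⟨hab, rfl⟩ x hx y hy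
    exact (hmulti i).2.2.2 a b hab x hx y hy
  · by_contra hno
    push Not at hno
    have hinj : Function.Injective g := fun a b hab => by
      by_contra hne
      exact hno a b hne hab
    have := Nat.card_le_card_of_injective g hinj
    rw [hcard, Nat.card_fin] at this
    omega
  · rintro a i b _ ⟨hab, rfl⟩
    exact hdel a b i hab
  · have : Nontrivial V := Finite.one_lt_card_iff_nontrivial.1 (by omega)
    obtain ⟨b, hb⟩ := exists_ne v
    -- The only collision involves `v`, so it disappears when `v` is left uncoloured.
    obtain ⟨g, -, -, hg⟩ := hdel v b ⟨0, hk⟩ hb.symm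
    refine ⟨g, fun a' b' ha' hb' hr => ?_⟩
    have hmem : v ∈ ({a', b'} : Set V) := by rw [hg a' b' hr]; simp
    rcases hmem with h | h
    · exact ha' h.symm
    · exact hb' h.symm

end

end DPColoring

/-! ### Constructible configurations: C-configurations -/

namespace SimpleGraph

/-- A cyclic order can be rotated such that a given adjacent pair consists of the last and the first
vertex. -/
theorem exists_rotation {V : Type*} {n : ℕ} (hn : 3 ≤ n) (φ : Fin n ≃ V) {c c' : V}
    (hcc : (cycleGraph n).Adj (φ.symm c) (φ.symm c')) :
    ∃ ψ : Fin n ≃ V, (∀ a b, (cycleGraph n).Adj (ψ.symm a) (ψ.symm b) ↔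
        (cycleGraph n).Adj (φ.symm a) (φ.symm b)) ∧
      ∀ z l : Fin n, z.val = 0 → l.val + 1 = n → ({c, c'} : Set V) = {ψ l, ψ z} := by
  obtain ⟨m, rfl⟩ : ∃ m, n = m + 2 := ⟨n - 2, by omega⟩
  have main : ∀ j : Fin (m + 2), ∃ ψ : Fin (m + 2) ≃ V,
      (∀ a b, (cycleGraph (m + 2)).Adj (ψ.symm a) (ψ.symm b) ↔
        (cycleGraph (m + 2)).Adj (φ.symm a) (φ.symm b)) ∧
      ∀ z l : Fin (m + 2), z.val = 0 → l.val + 1 = m + 2 → ψ z = φ j ∧ ψ l = φ (j - 1) := by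
    intro j
    -- Shifting by `j` puts `j` first and its predecessor `j - 1` last.
    refine ⟨(Equiv.addRight j).trans φ, fun a b => ?_, fun z l hz hl => ?_⟩
    · rw [cycleGraph_adj, cycleGraph_adj]
      simp
    · obtain rfl : z = 0 := Fin.ext hz
      obtain rfl : l = Fin.last (m + 1) := Fin.ext (by simp only [Fin.val_last]; omega)
      have h1 : Fin.last (m + 1) = -1 := by
        rw [eq_neg_iff_add_eq_zero]
        exact Fin.last_add_one _
      constructor
      · simp
      · simp only [Equiv.trans_apply, Equiv.coe_addRight, h1]
        congr 1
        abel
  rw [cycleGraph_adj] at hcc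
  rcases hcc with h | h
  · obtain ⟨ψ, h1, h2⟩ := main (φ.symm c)
    refine ⟨ψ, h1, fun z l hz hl => ?_⟩
    obtain ⟨h3, h4⟩ := h2 z l hz hl
    have : φ.symm c - 1 = φ.symm c' := by rw [← h]; abel
    rw [h3, h4, this, Equiv.apply_symm_apply, Equiv.apply_symm_apply, Set.pair_comm]
  · obtain ⟨ψ, h1, h2⟩ := main (φ.symm c')
    refine ⟨ψ, h1, fun z l hz hl => ?_⟩
    obtain ⟨h3, h4⟩ := h2 z l hz hl
    have : φ.symm c' - 1 = φ.symm c := by rw [← h]; abel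
    rw [h3, h4, this, Equiv.apply_symm_apply, Equiv.apply_symm_apply]

theorem exists_cycleGraph_adj {n : ℕ} (hn : 3 ≤ n) (i : Fin n) :
    ∃ j, (cycleGraph n).Adj i j := by
  have hi := i.2
  by_cases h : i.val + 1 < n
  · exact ⟨⟨i + 1, h⟩, (cycleGraph_adj_iff_val hn).2 (Or.inl rfl)⟩
  · exact ⟨⟨0, by omega⟩, (cycleGraph_adj_iff_val hn).2
      (Or.inr (Or.inr (Or.inr ⟨rfl, by omega⟩)))⟩

end SimpleGraph

namespace DPColoring

open MultiHypergraph

section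

variable {V : Type u} {E : Type v} {C : Type w} {F : Type z}
variable {G : MultiHypergraph V E} {X : V → Set C} {H : MultiHypergraph C F}

theorem MultiHypergraph.InducesKtt.exists_pair {A B : Set C} {t : ℕ} (h : H.InducesKtt A B t)
    {f : F} (hf : H.inc f ⊆ A ∪ B) : ∃ x ∈ A, ∃ y ∈ B, H.inc f = {x, y} := by
  obtain ⟨i, j, hij, x, hx, y, hy, hxy⟩ := h.2.2.1 f (hf.trans (by
    rintro x (hx | hx)
    · exact Set.mem_iUnion.2 ⟨0, hx⟩
    · exact Set.mem_iUnion.2 ⟨1, hx⟩))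
  fin_cases i <;> fin_cases j
  · exact absurd rfl hij
  · exact ⟨x, hx, y, hy, hxy⟩
  · exact ⟨y, hy, x, hx, hxy.trans (Set.pair_comm _ _)⟩
  · exact absurd rfl hij

theorem MultiHypergraph.InducesKtt.existsUnique {A B : Set C} {t : ℕ} (h : H.InducesKtt A B t)
    {x y : C} (hx : x ∈ A) (hy : y ∈ B) : ∃! f, H.inc f = {x, y} :=
  h.2.2.2 0 1 (by simp) x hx y hy

theorem MultiHypergraph.InducesKtt.ncard_left {A B : Set C} {t : ℕ} (h : H.InducesKtt A B t) :
    A.ncard = t := h.1 0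

theorem MultiHypergraph.IsMultiple.ordAdj_iff {n t : ℕ} (ht : 1 ≤ t)
    (h : G.IsMultiple t (SimpleGraph.cycleGraph n)) : ∃ φ : Fin n ≃ V, ∀ a b, G.OrdAdj a b ↔
      (SimpleGraph.cycleGraph n).Adj (φ.symm a) (φ.symm b) := by
  obtain ⟨φ, h1, h2⟩ := h
  refine ⟨φ, fun a b => ⟨?_, fun hab => ?_⟩⟩
  · rintro ⟨e, he⟩
    obtain ⟨i, j, hij, he'⟩ := h1 e
    rw [he] at he'
    rcases Set.pair_eq_pair_iff.1 he' with ⟨rfl, rfl⟩ | ⟨rfl, rfl⟩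
    · simpa using hij
    · simpa using hij.symm
  · have h3 := h2 _ _ hab
    simp only [Equiv.apply_symm_apply] at h3
    exact Set.nonempty_of_ncard_ne_zero (by omega : {e | G.inc e = {a, b}}.ncard ≠ 0)

theorem eq_alternating_iff (i : Fin 2) (x y : ℕ) :
    ((if Even x then i else i + 1) = if Even y then i else i + 1) ↔ (Even x ↔ Even y) := by
  have : i ≠ i + 1 := by omega
  by_cases hx : Even x <;> by_cases hy : Even y <;> simp [hx, hy, this, this.symm]

/-- The criterion for classes arranged in a cycle, where the two classes are interchanged between the
last and the first vertex if and only if the length is even. -/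
theorem robust_of_cycle (hcov : IsCover G X H) {n : ℕ} (hn : 3 ≤ n) (φ : Fin n ≃ V)
    {P : V → Fin 2 → Set C} (hP : ∀ a, IsPartition (P a) (X a)) (hne : ∀ a i, (P a i).Nonempty)
    {tw : V → V → Prop} (hsymm : ∀ a b, tw a b → tw b a)
    (htw : ∀ i j : Fin n, i.val + 1 = j.val → ¬ tw (φ i) (φ j))
    (hwrap : ∀ i j : Fin n, i.val + 1 = n → j.val = 0 → (tw (φ i) (φ j) ↔ Even n))
    (hedge : ∀ f, ∃ a i b j, (SimpleGraph.cycleGraph n).Adj (φ.symm a) (φ.symm b) ∧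
      (i = j ↔ ¬ tw a b) ∧ ∃ x ∈ P a i, ∃ y ∈ P b j, H.inc f = {x, y})
    (huniq : ∀ a i b j, (SimpleGraph.cycleGraph n).Adj (φ.symm a) (φ.symm b) → (i = j ↔ ¬ tw a b) →
      ∀ x ∈ P a i, ∀ y ∈ P b j, ∃! f, H.inc f = {x, y}) : Robust X H := by
  classical
  let R : V → Fin 2 → V → Fin 2 → Prop := fun a i b j =>
    (SimpleGraph.cycleGraph n).Adj (φ.symm a) (φ.symm b) ∧ (i = j ↔ ¬ tw a b)
  have hRsymm : ∀ a i b j, R a i b j → R b j a i := fun a i b j ⟨h1, h2⟩ =>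
    ⟨h1.symm, by rw [eq_comm, h2, not_iff_not]; exact ⟨hsymm _ _, hsymm _ _⟩⟩
  -- colouring all vertices alternately, starting behind the vertex with index `k`
  have halt : ∀ (k k' : Fin n) (i j : Fin 2),
      (k.val + 1 = k'.val ∨ (k.val + 1 = n ∧ k'.val = 0)) → R (φ k) i (φ k') j →
      ∃ g : V → Fin 2, g (φ k) = i ∧ g (φ k') = j ∧
        ∀ a b, R a (g a) b (g b) → ({a, b} : Set V) = {φ k, φ k'} := by
    intro k k' i j hkk hr
    -- The parity of `N` alternates along the path except between `k` and its successor, where `N`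
    -- jumps by two. The offset makes `N k = 2 * k` even, so that `φ k` gets class `i`. At the
    -- closing pair, for `k` not last, `N` differs by `n`, which compensates the twist; for `k` last
    -- there is no jump, and this pair is the conflict.
    let N : Fin n → ℕ := fun m => if m.val ≤ k.val then k.val + m.val else k.val + m.val + 1
    let g : V → Fin 2 := fun a => if Even (N (φ.symm a)) then i else i + 1
    have hg : ∀ m m' : Fin n, g (φ m) = g (φ m') ↔ (Even (N m) ↔ Even (N m')) := by
      intro m m'
      simp only [g, Equiv.symm_apply_apply]
      exact eq_alternating_iff _ _ _
    have hno : ∀ m m' : Fin n, (m.val + 1 = m'.val ∨ (m.val + 1 = n ∧ m'.val = 0)) →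
        R (φ m) (g (φ m)) (φ m') (g (φ m')) → m = k ∧ m' = k' := by
      rintro m m' hmm ⟨-, hiff⟩
      rw [hg] at hiff
      by_contra hne
      have hmk : m.val ≠ k.val := by
        intro h
        refine hne ⟨Fin.ext h, Fin.ext ?_⟩
        have := m'.2
        have := k'.2
        omega
      have hk := k.2
      rcases hmm with hm | ⟨hm, hm'⟩
      · have h1 := hiff.2 (htw m m' hm)
        simp only [N, ← hm] at h1
        split_ifs at h1
        · rw [← Nat.add_assoc, Nat.even_add_one] at h1; tauto
        · omega
        · omega
        · rw [← Nat.add_assoc, Nat.even_add_one (n := k.val + m.val + 1)] at h1; tauto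
      · rw [hwrap m m' hm hm'] at hiff
        have h1 : N m = k.val + n := by
          simp only [N]
          rw [if_neg (by omega)]
          omega
        have h2 : N m' = k.val := by
          simp only [N, hm', Nat.zero_le, if_true, Nat.add_zero]
        rw [h1, h2, Nat.even_add] at hiff
        tauto
    have hgk : g (φ k) = i := by
      simp only [g, Equiv.symm_apply_apply]
      rw [if_pos]
      simp [N]
    refine ⟨g, hgk, ?_, ?_⟩
    · have hr2 := hr.2
      have h2 : g (φ k) = g (φ k') ↔ ¬ tw (φ k) (φ k') := by
        rw [hg]
        have h1 : Even (N k) := by simp [N]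
        rcases hkk with hkk | ⟨hkk, hk'⟩
        · have h3 : N k' = (k.val + 1) + (k.val + 1) := by
            simp only [N, ← hkk]
            rw [if_neg (by omega)]
            omega
          have h4 : Even (N k') := by rw [h3]; exact ⟨_, rfl⟩
          exact iff_of_true (iff_of_true h1 h4) (htw _ _ hkk)
        · have h3 : N k' = k.val := by
            simp only [N, hk', Nat.zero_le, if_true, Nat.add_zero]
          have h4 : Even n ↔ ¬ Even k.val := by
            have := Nat.even_add_one (n := k.val)
            rwa [hkk] at this
          rw [hwrap _ _ hkk hk', h3, h4]
          tauto
      -- With only two classes, the class of `φ k'` is determined by whether the pair is twisted.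
      rw [hgk] at h2
      by_cases htw' : tw (φ k) (φ k')
      · have h3 : i ≠ j := fun h => (hr2.1 h) htw'
        have h4 : i ≠ g (φ k') := fun h => (h2.1 h) htw'
        omega
      · rw [← hr2.2 htw', ← h2.2 htw']
    · intro a b hab
      obtain ⟨m, rfl⟩ := φ.surjective a
      obtain ⟨m', rfl⟩ := φ.surjective b
      have hadj := hab.1
      rw [Equiv.symm_apply_apply, Equiv.symm_apply_apply,
        SimpleGraph.cycleGraph_adj_iff_val hn] at hadj
      rcases hadj with h | h | h | h
      · obtain ⟨rfl, rfl⟩ := hno m m' (Or.inl h) hab; rfl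
      · obtain ⟨rfl, rfl⟩ := hno m' m (Or.inl h) (hRsymm _ _ _ _ hab); exact Set.pair_comm _ _
      · obtain ⟨rfl, rfl⟩ := hno m' m (Or.inr ⟨h.2, h.1⟩) (hRsymm _ _ _ _ hab)
        exact Set.pair_comm _ _
      · obtain ⟨rfl, rfl⟩ := hno m m' (Or.inr ⟨h.2, h.1⟩) hab; rfl
  have hcrit : ∀ a i b j, R a i b j → ∃ g : V → Fin 2, g a = i ∧ g b = j ∧
      ∀ a' b', R a' (g a') b' (g b') → ({a', b'} : Set V) = {a, b} := by
    intro a i b j hr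
    obtain ⟨k, rfl⟩ := φ.surjective a
    obtain ⟨k', rfl⟩ := φ.surjective b
    have hadj := hr.1
    rw [Equiv.symm_apply_apply, Equiv.symm_apply_apply,
      SimpleGraph.cycleGraph_adj_iff_val hn] at hadj
    have hswap : (∃ g : V → Fin 2, g (φ k') = j ∧ g (φ k) = i ∧
        ∀ a b, R a (g a) b (g b) → ({a, b} : Set V) = {φ k', φ k}) →
        ∃ g : V → Fin 2, g (φ k) = i ∧ g (φ k') = j ∧
        ∀ a b, R a (g a) b (g b) → ({a, b} : Set V) = {φ k, φ k'} := by
      rintro ⟨g, h1, h2, h3⟩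
      exact ⟨g, h2, h1, fun a b hab => (h3 a b hab).trans (Set.pair_comm _ _)⟩
    rcases hadj with h | h | h | h
    · exact halt k k' i j (Or.inl h) hr
    · exact hswap (halt k' k j i (Or.inl h) (hRsymm _ _ _ _ hr))
    · exact hswap (halt k' k j i (Or.inr ⟨h.2, h.1⟩) (hRsymm _ _ _ _ hr))
    · exact halt k k' i j (Or.inr ⟨h.2, h.1⟩) hr
  refine robust_of_classes hcov hP hne (R := R) (fun a i b j hr => ?_) (fun f => ?_)
    (fun a i b j hr => huniq a i b j hr.1 hr.2) (fun g => ?_) hcrit (fun v => ?_)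
  · intro hab
    exact hr.1.ne (by rw [hab])
  · obtain ⟨a, i, b, j, h1, h2, h3⟩ := hedge f
    exact ⟨a, i, b, j, ⟨h1, h2⟩, h3⟩
  · by_contra hno
    push Not at hno
    let z₀ : Fin n := ⟨0, by omega⟩
    -- Without conflicts the class alternates along the path, so first and last class agree exactly
    -- when `n` is odd. That is exactly when the closing pair is untwisted, which makes it a
    -- conflict.
    have hind : ∀ m, ∀ hm : m < n, g (φ ⟨m, hm⟩) = g (φ z₀) ↔ Even m := by
      intro m
      induction m with
      | zero => intro hm; simp [z₀]
      | succ m ih =>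
        intro hm
        have h1 : ¬ R (φ ⟨m, by omega⟩) (g (φ ⟨m, by omega⟩)) (φ ⟨m + 1, hm⟩) (g (φ ⟨m + 1, hm⟩)) :=
          hno _ _
        have hadj : (SimpleGraph.cycleGraph n).Adj (φ.symm (φ ⟨m, by omega⟩))
            (φ.symm (φ ⟨m + 1, hm⟩)) := by
          rw [Equiv.symm_apply_apply, Equiv.symm_apply_apply,
            SimpleGraph.cycleGraph_adj_iff_val hn]
          exact Or.inl rfl
        have h2 : g (φ ⟨m, by omega⟩) ≠ g (φ ⟨m + 1, hm⟩) := fun h =>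
          h1 ⟨hadj, iff_of_true h (htw _ _ rfl)⟩
        rw [Nat.even_add_one, ← ih (by omega)]
        omega
    have h1 : ¬ R (φ ⟨n - 1, by omega⟩) (g (φ ⟨n - 1, by omega⟩)) (φ z₀) (g (φ z₀)) := hno _ _
    refine h1 ⟨?_, ?_⟩
    · rw [Equiv.symm_apply_apply, Equiv.symm_apply_apply, SimpleGraph.cycleGraph_adj_iff_val hn]
      right; right; right
      exact ⟨rfl, by simp only; omega⟩
    · rw [hind, hwrap _ _ (by simp only; omega) rfl]
      have := Nat.even_add_one (n := n - 1)
      rw [show n - 1 + 1 = n by omega] at this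
      rw [this, not_not]
  · obtain ⟨k, rfl⟩ := φ.surjective v
    obtain ⟨k', hk⟩ : ∃ k' : Fin n, k.val + 1 = k'.val ∨ (k.val + 1 = n ∧ k'.val = 0) := by
      have hk := k.2
      by_cases h : k.val + 1 < n
      · exact ⟨⟨k + 1, h⟩, Or.inl rfl⟩
      · exact ⟨⟨0, by omega⟩, Or.inr ⟨by omega, rfl⟩⟩
    have hadj : (SimpleGraph.cycleGraph n).Adj (φ.symm (φ k)) (φ.symm (φ k')) := by
      rw [Equiv.symm_apply_apply, Equiv.symm_apply_apply, SimpleGraph.cycleGraph_adj_iff_val hn]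
      rcases hk with h | h
      · exact Or.inl h
      · exact Or.inr (Or.inr (Or.inr ⟨h.2, h.1⟩))
    obtain ⟨j, hj⟩ : ∃ j : Fin 2, R (φ k) 0 (φ k') j := by
      by_cases h : tw (φ k) (φ k')
      · exact ⟨1, hadj, by simp [h]⟩
      · exact ⟨0, hadj, by simp [h]⟩
    -- The only conflict is placed on a pair containing the deleted vertex.
    obtain ⟨g, -, -, hg⟩ := hcrit _ _ _ _ hj
    refine ⟨g, fun a b ha hb hr => ?_⟩
    have hmem : φ k ∈ ({a, b} : Set V) := by rw [hg a b hr]; simp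
    rcases hmem with h | h
    · exact ha h.symm
    · exact hb h.symm

theorem IsOddCConfiguration.robust (h : IsOddCConfiguration G X H) : Robust X H := by
  obtain ⟨hcov, t, n, ht, hn, hodd, hmult, P, hP, hK, hedge⟩ := h
  obtain ⟨φ, hφ⟩ := hmult.ordAdj_iff ht
  refine robust_of_cycle hcov (by omega) φ hP (fun a i => ?_) (tw := fun _ _ => False)
    (fun _ _ h => h) (fun _ _ _ h => h)
    (fun i j _ _ => by simpa using hodd) (fun f => ?_) ?_
  · obtain ⟨j, hj⟩ := SimpleGraph.exists_cycleGraph_adj (by omega) (φ.symm a)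
    have h1 := (hK i a (φ j) ((hφ _ _).2 (by simpa using hj))).ncard_left
    exact Set.nonempty_of_ncard_ne_zero (by omega)
  · obtain ⟨i, a, b, hab, hf⟩ := hedge f
    exact ⟨a, i, b, i, (hφ a b).1 hab, by simp, (hK i a b hab).exists_pair hf⟩
  · intro a i b j hab hij x hx y hy
    obtain rfl : i = j := hij.2 (fun h => h)
    exact (hK i a b ((hφ a b).2 hab)).existsUnique hx hy

/-- After a rotation the interchanged pair `{c, c'}` is the closing pair of the cycle, so it
provides the twist required by `robust_of_cycle`. -/
theorem IsEvenCConfiguration.robust (h : IsEvenCConfiguration G X H) : Robust X H := by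
  obtain ⟨hcov, t, n, ht, hn, heven, hmult, P, c, c', hP, hcc, hK, hK₁, hK₂, hedge⟩ := h
  obtain ⟨φ₀, hφ₀⟩ := hmult.ordAdj_iff ht
  obtain ⟨φ, hφ, hlast⟩ := SimpleGraph.exists_rotation (by omega) φ₀ ((hφ₀ _ _).1 hcc)
  have hφ' : ∀ a b, G.OrdAdj a b ↔ (SimpleGraph.cycleGraph n).Adj (φ.symm a) (φ.symm b) :=
    fun a b => (hφ₀ a b).trans (hφ a b).symm
  have hcc' : (SimpleGraph.cycleGraph n).Adj (φ.symm c) (φ.symm c') := (hφ' _ _).1 hcc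
  refine robust_of_cycle hcov (by omega) φ hP (fun a i => ?_)
    (tw := fun a b => ({a, b} : Set V) = {c, c'}) (fun a b h => (Set.pair_comm _ _).trans h)
    (fun i j hij htw => ?_) (fun i j hi hj => iff_of_true (hlast j i hj hi).symm heven)
    (fun f => ?_) ?_
  · have hne : (P a i).ncard = t := by
      obtain ⟨j, hj⟩ := SimpleGraph.exists_cycleGraph_adj (by omega) (φ.symm a)
      have hadj : G.OrdAdj a (φ j) := (hφ' _ _).2 (by simpa using hj)
      by_cases hpair : ({a, φ j} : Set V) = {c, c'}
      · rcases Set.pair_eq_pair_iff.1 hpair with ⟨rfl, -⟩ | ⟨rfl, -⟩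
        · fin_cases i
          · exact hK₁.ncard_left
          · exact hK₂.ncard_left
        · fin_cases i
          · exact hK₂.1 1
          · exact hK₁.1 1
      · exact (hK i a _ hadj hpair).ncard_left
    exact Set.nonempty_of_ncard_ne_zero (by omega)
  · rw [hlast ⟨0, by omega⟩ ⟨n - 1, by omega⟩ rfl (by simp only; omega)] at htw
    have hi := i.2
    have hj := j.2
    rcases Set.pair_eq_pair_iff.1 htw with ⟨h1, h2⟩ | ⟨h1, h2⟩
    · have := congrArg Fin.val (φ.injective h1)
      simp only at this
      omega
    · have h3 := congrArg Fin.val (φ.injective h1)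
      have h4 := congrArg Fin.val (φ.injective h2)
      simp only at h3 h4
      omega
  · rcases hedge f with ⟨i, a, b, hab, hne, hf⟩ | hf | hf
    · exact ⟨a, i, b, i, (hφ' a b).1 hab, by simpa using hne, (hK i a b hab hne).exists_pair hf⟩
    · exact ⟨c, 0, c', 1, hcc', by simp, hK₁.exists_pair hf⟩
    · exact ⟨c, 1, c', 0, hcc', by simp, hK₂.exists_pair hf⟩
  · intro a i b j hab hij x hx y hy
    by_cases hpair : ({a, b} : Set V) = {c, c'}
    · have hij' : i ≠ j := fun h => (hij.1 h) hpair
      rcases Set.pair_eq_pair_iff.1 hpair with ⟨rfl, rfl⟩ | ⟨rfl, rfl⟩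
      · fin_cases i <;> fin_cases j
        · exact absurd rfl hij'
        · exact hK₁.existsUnique hx hy
        · exact hK₂.existsUnique hx hy
        · exact absurd rfl hij'
      · rw [Set.pair_comm]
        fin_cases i <;> fin_cases j
        · exact absurd rfl hij'
        · exact hK₂.existsUnique hy hx
        · exact hK₁.existsUnique hy hx
        · exact absurd rfl hij'
    · obtain rfl : i = j := hij.2 hpair
      exact (hK i a b ((hφ' a b).2 hab) hpair).existsUnique hx hy

theorem Constructible.robust (h : Constructible G X H) : Robust X H := by
  induction h with
  | ofK h => exact h.robust
  | ofC h => exact h.elim (fun h => h.robust) (fun h => h.robust)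
  | ofE h => exact h.robust
  | merge v₁ v₂ _ _ m ih₁ ih₂ => exact m.robust ih₁ ih₂

end

end DPColoring

theorem theorem2 {V : Type u} {E : Type v} {C : Type w} {F : Type z}
    (G : DPColoring.MultiHypergraph V E) (X : V → Set C) (H : DPColoring.MultiHypergraph C F)
    (hGXH : DPColoring.DegreeFeasible G X H) :
    DPColoring.MinimalUncolorable G X H ↔ DPColoring.Constructible G X H :=
  ⟨fun h => h.constructible hGXH, fun h =>
    ⟨hGXH.toFeasible, h.robust.not_colorable, h.robust.colorable_deleteEdge⟩⟩
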